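/- Let $C=(\mathbb R/4\pi\mathbb Z)\times\mathbb R$ with coordinates $\lambda=(\gamma,c)$, $N=C\times(0,\infty)$ and $M=\mathrm{SH}(2)\cong\mathbb R^3$ with coordinates $q=(x,y,z)$. For $\lambda=(\gamma,c)\in C$ let $(\gamma_t,c_t)\in C$ and $(x_t,y_t,z_t)\in M$, $t\in\mathbb R$, be the solution of $$\dot\gamma=c,\quad \dot c=-\sin\gamma,\quad \dot x=\cos\tfrac{\gamma}{2}\cosh z,\quad \dot y=\cos\tfrac{\gamma}{2}\sinh z,\quad \dot z=\sin\tfrac{\gamma}{2}$$ with $(\gamma_0,c_0)=\lambda$ and $(x_0,y_0,z_0)=(0,0,0)$, and put $\mathrm{Exp}(\lambda,t)=(x_t,y_t,z_t)$. Let $E=\frac{c^2}{2}-\cos\gamma$ and $$C_1=\{-1<E<1\},\quad C_2=\{E>1\},\quad C_3=\{E=1,\,c\ne0\},\quad C_4=\{E=-1,\,c=0\},\quad C_5=\{E=1,\,c=0\}.$$ Let $K(k)=\int_0^{\pi/2}\frac{d\theta}{\sqrt{1-k^2\sin^2\theta}}$ and define $\mathbf t:C\to(0,+\infty]$ by $\mathbf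 t=4K(k)$ with $k=\sqrt{(E+1)/2}$ on $C_1$, $\mathbf t=4kK(k)$ with $k=\sqrt{2/(E+1)}$ on $C_2$, $\mathbf t=2\pi$ on $C_4$, and $\mathbf t=+\infty$ on $C_3\cup C_5$. Put $$D_1=\{(\lambda,t)\in N:\ \lambda\in C_1\cup C_2\cup C_3\cup C_5,\ t<\mathbf t(\lambda),\ \sin\tfrac{\gamma_{t/2}}{2}>0\},$$ $$D_2=\{(\lambda,t)\in N:\ \lambda\in C_1\cup C_2\cup C_3\cup C_5,\ t<\mathbf t(\lambda),\ \sin\tfrac{\gamma_{t/2}}{2}<0\},$$ $$M_1=\{q\in M: z>0\},\qquad M_2=\{q\in M: z<0\}.$$ Then $D_1,D_2$ are open in $N$, and for $i=1,2$ the restriction $\mathrm{Exp}:D_i\to M_i$ is a ($C^\infty$) diffeomorphism of $D_i$ onto $M_i$. -/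

import Mathlib

noncomputable section

namespace SH2

open Set Real
open scoped Manifold ContDiff Topology NNReal

/-! ### The circle `ℝ / 4πℤ` as a smooth manifold -/

instance periodPos : Fact ((0 : ℝ) < 4 * π) := ⟨by positivity⟩

/-- The smooth structure of `ℝ / 4πℤ`: the charts are the inverses of the projection restricted
to the open intervals `(a, a + 4π)`. -/
instance angleChartedSpace : ChartedSpace ℝ (AddCircle (4 * π)) where
  atlas := range fun a : ℝ => (AddCircle.openPartialHomeomorphCoe (4 * π) a).symm
  chartAt γ := (AddCircle.openPartialHomeomorphCoe (4 * π)
    ((AddCircle.equivIco (4 * π) 0 γ : ℝ) - 2 * π)).symm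
  mem_chart_source γ := by
    intro h
    have h : γ = ((((AddCircle.equivIco (4 * π) 0 γ : ℝ) - 2 * π : ℝ)) : AddCircle (4 * π)) := h
    have h2 : ((AddCircle.equivIco (4 * π) 0 γ : ℝ) : AddCircle (4 * π)) = γ :=
      (AddCircle.equivIco (4 * π) 0).symm_apply_apply γ
    rw [AddCircle.coe_sub, h2, eq_comm, sub_eq_self,
      AddCircle.coe_eq_zero_iff_of_mem_Ico] at h
    · linarith [pi_pos]
    · constructor <;> linarith [pi_pos]
  chart_mem_atlas γ := mem_range_self _

instance angleIsManifold : IsManifold 𝓘(ℝ, ℝ) ∞ (AddCircle (4 * π)) := by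
  refine isManifold_of_contDiffOn _ _ _ ?_
  rintro _ _ ⟨a, rfl⟩ ⟨b, rfl⟩
  dsimp only
  set e := AddCircle.openPartialHomeomorphCoe (4 * π) a with he
  set e' := AddCircle.openPartialHomeomorphCoe (4 * π) b with he'
  set T := e.symm.symm.trans e'.symm with hT
  have hcoe : ∀ y : ℝ, ((T y : ℝ) : AddCircle (4 * π)) = (y : AddCircle (4 * π)) := fun y =>
    (AddCircle.equivIco (4 * π) b).symm_apply_apply (y : AddCircle (4 * π))
  intro x hx
  have hx : x ∈ T.source := by simpa using hx.1
  have hcont : ContinuousAt (fun y => T y - y) x :=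
    (T.continuousAt hx).sub continuousAt_id
  have hev : ∀ᶠ y in 𝓝 x, T y = y + (T x - x) := by
    filter_upwards [Metric.continuousAt_iff'.1 hcont (4 * π) periodPos.out] with y hy
    obtain ⟨n, hn⟩ := (AddCircle.coe_eq_zero_iff (4 * π)).1
      (show ((T y - y - (T x - x) : ℝ) : AddCircle (4 * π)) = 0 by
        simp only [AddCircle.coe_sub, hcoe, sub_self])
    rw [Real.dist_eq, ← hn, zsmul_eq_mul, abs_mul, abs_of_pos periodPos.out] at hy
    have h1 : |(n : ℝ)| < 1 := by
      have := periodPos.out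
      by_contra hcon
      nlinarith
    have h0 : n = 0 := Int.abs_lt_one_iff.1 (by exact_mod_cast h1)
    rw [h0, zero_smul] at hn
    linarith
  have : ContDiffAt ℝ ∞ (fun y : ℝ => y + (T x - x)) x := by fun_prop
  exact (this.congr_of_eventuallyEq hev).contDiffWithinAt

/-! ### The pendulum `γ' = c`, `c' = -sin γ` -/

/-- `u t = (γ_t, c_t)` is a trajectory of the pendulum, with `γ` lifted to `ℝ`. -/
def IsPendulumSolution (u : ℝ → ℝ × ℝ) : Prop :=
  ∀ t, HasDerivAt u ((u t).2, -sin (u t).1) t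

theorem existsUnique_pendulum (p : ℝ × ℝ) :
    ∃! u : ℝ → ℝ × ℝ, u 0 = p ∧ IsPendulumSolution u := by
  set v : ℝ × ℝ → ℝ × ℝ := fun w => (w.2, -sin w.1) with hv
  have hlip : LipschitzWith 1 v := by
    refine LipschitzWith.of_dist_le_mul fun a b => ?_
    rw [Prod.dist_eq, Prod.dist_eq, NNReal.coe_one, one_mul, max_comm]
    refine max_le_max ?_ le_rfl
    simp only [hv, Real.dist_eq]
    rw [show -sin a.1 - -sin b.1 = -(sin a.1 - sin b.1) by ring, abs_neg]
    have := Real.lipschitzWith_sin.dist_le_mul a.1 b.1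
    simpa [Real.dist_eq] using this
  have hex : ∃ u : ℝ → ℝ × ℝ, u 0 = p ∧ IsPendulumSolution u := by
    have hloc : ∀ x : ℝ × ℝ, ∃ u : ℝ → ℝ × ℝ, u 0 = x ∧
        IsMIntegralCurveOn (I := 𝓘(ℝ, ℝ × ℝ)) u v (Ioo (-(1 / 2)) (1 / 2)) := by
      intro x
      have hpl : IsPicardLindelof (fun _ => v) (tmin := -(1 / 2)) (tmax := 1 / 2)
          ⟨0, by norm_num⟩ x (‖x‖₊ + 1) 0 (2 * (‖x‖₊ + 1)) 1 := by
        refine IsPicardLindelof.of_time_independent ?_ hlip.lipschitzOnWith ?_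
        · intro y hy
          have hy' : ‖y‖ ≤ 2 * ‖x‖ + 1 := by
            have h1 := norm_le_norm_add_norm_sub' y x
            rw [mem_closedBall_iff_norm] at hy
            push_cast at hy
            linarith
          rw [Prod.norm_def]
          push_cast
          refine max_le ?_ ?_
          · have := norm_snd_le y
            show ‖y.2‖ ≤ _
            linarith
          · show ‖-sin y.1‖ ≤ _
            rw [norm_neg, Real.norm_eq_abs]
            have := abs_sin_le_one y.1
            have := norm_nonneg x
            linarith
        · norm_num
          apply le_of_eq; ring
      obtain ⟨u, hu0, hu⟩ := hpl.exists_eq_forall_mem_Icc_hasDerivWithinAt₀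
      refine ⟨u, hu0, fun t ht => ?_⟩
      have h := ((hu t (Ioo_subset_Icc_self ht)).mono Ioo_subset_Icc_self)
      exact h.hasFDerivWithinAt.hasMFDerivWithinAt
    obtain ⟨u, hu0, hu⟩ := exists_isMIntegralCurve_of_isMIntegralCurveOn
      (I := 𝓘(ℝ, ℝ × ℝ)) (v := v)
      (contMDiff_vectorSpace_iff_contDiff.2 (by
        show ContDiff ℝ 1 (fun w : ℝ × ℝ => (w.2, -sin w.1))
        fun_prop)) (by norm_num : (0 : ℝ) < 1 / 2) hloc p
    refine ⟨u, hu0, fun t => ?_⟩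
    have h : HasFDerivAt u (ContinuousLinearMap.toSpanSingleton ℝ (v (u t))) t := (hu t).hasFDerivAt
    simpa [hv] using h.hasDerivAt
  obtain ⟨u, hu0, hu⟩ := hex
  refine ⟨u, ⟨hu0, hu⟩, fun w hw => ?_⟩
  exact ODE_solution_unique_univ (v := fun _ => v) (s := fun _ => univ) (t₀ := 0)
    (fun _ => hlip.lipschitzOnWith) (fun t => ⟨hw.2 t, mem_univ _⟩)
    (fun t => ⟨hu t, mem_univ _⟩) (by rw [hw.1, hu0])

/-- The trajectory `t ↦ (γ_t, c_t)` of the pendulum that starts at `p = (γ, c)`. -/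
def pendulumFlow (p : ℝ × ℝ) : ℝ → ℝ × ℝ := (existsUnique_pendulum p).choose

theorem pendulumFlow_zero (p : ℝ × ℝ) : pendulumFlow p 0 = p :=
  (existsUnique_pendulum p).choose_spec.1.1

theorem pendulumFlow_solution (p : ℝ × ℝ) : IsPendulumSolution (pendulumFlow p) :=
  (existsUnique_pendulum p).choose_spec.1.2

theorem pendulumFlow_eq {p : ℝ × ℝ} {u : ℝ → ℝ × ℝ} (h0 : u 0 = p) (h : IsPendulumSolution u) :
    pendulumFlow p = u :=
  ((existsUnique_pendulum p).choose_spec.2 u ⟨h0, h⟩).symm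

theorem pendulumFlow_add_period (γ c : ℝ) :
    pendulumFlow (γ + 4 * π, c) = fun t => pendulumFlow (γ, c) t + (4 * π, 0) := by
  refine pendulumFlow_eq (by simp [pendulumFlow_zero]) fun t => ?_
  have h := (pendulumFlow_solution (γ, c) t).add_const ((4 * π, 0) : ℝ × ℝ)
  have hs : sin ((pendulumFlow (γ, c) t).1 + 4 * π) = sin (pendulumFlow (γ, c) t).1 := by
    simpa using Real.sin_add_nat_mul_two_pi (pendulumFlow (γ, c) t).1 2 |> fun h => by
      rw [← h]; congr 1; push_cast; ring
  simpa [hs] using h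

/-! ### The horizontal subsystem and the exponential mapping -/

/-- `q t = (x_t, y_t, z_t)` solves
`x' = cos (γ / 2) cosh z`, `y' = cos (γ / 2) sinh z`, `z' = sin (γ / 2)`, `q 0 = (0, 0, 0)`,
where `u t = (γ_t, c_t)`. -/
def IsHorizontalSolution (u : ℝ → ℝ × ℝ) (q : ℝ → ℝ × ℝ × ℝ) : Prop :=
  q 0 = (0, 0, 0) ∧ ∀ t, HasDerivAt q
    (cos ((u t).1 / 2) * cosh (q t).2.2, cos ((u t).1 / 2) * sinh (q t).2.2, sin ((u t).1 / 2)) t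

theorem existsUnique_horizontal {u : ℝ → ℝ × ℝ} (hu : Continuous u) :
    ∃! q : ℝ → ℝ × ℝ × ℝ, IsHorizontalSolution u q := by
  have prim : ∀ f : ℝ → ℝ, Continuous f → ∀ t, HasDerivAt (fun s => ∫ r in (0 : ℝ)..s, f r) (f t) t :=
    fun f hf t => intervalIntegral.integral_hasDerivAt_right (hf.intervalIntegrable _ _)
      (hf.stronglyMeasurableAtFilter _ _) hf.continuousAt
  have uniq : ∀ f g h : ℝ → ℝ, f 0 = g 0 → (∀ t, HasDerivAt f (h t) t) →
      (∀ t, HasDerivAt g (h t) t) → f = g := by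
    intro f g h h0 hf hg
    have hd : ∀ t, HasDerivAt (fun s => f s - g s) 0 t := fun t => by
      have h := (hf t).sub (hg t)
      rwa [sub_self] at h
    funext t
    have := is_const_of_deriv_eq_zero (fun t => (hd t).differentiableAt)
      (fun t => (hd t).deriv) t 0
    simp only [h0, sub_self] at this
    linarith
  set z : ℝ → ℝ := fun t => ∫ r in (0 : ℝ)..t, sin ((u r).1 / 2) with hz
  have hz' : ∀ t, HasDerivAt z (sin ((u t).1 / 2)) t := prim _ (by fun_prop)
  have hzc : Continuous z := continuous_iff_continuousAt.2 fun t => (hz' t).continuousAt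
  refine ⟨fun t => (∫ r in (0 : ℝ)..t, cos ((u r).1 / 2) * cosh (z r),
    ∫ r in (0 : ℝ)..t, cos ((u r).1 / 2) * sinh (z r), z t), ⟨by simp [hz], fun t => ?_⟩, ?_⟩
  · exact (prim (fun r => cos ((u r).1 / 2) * cosh (z r)) (by fun_prop) t).prodMk
      ((prim (fun r => cos ((u r).1 / 2) * sinh (z r)) (by fun_prop) t).prodMk (hz' t))
  · rintro q ⟨hq0, hq⟩
    have h1 : ∀ t, HasDerivAt (fun s => (q s).1) (cos ((u t).1 / 2) * cosh (q t).2.2) t :=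
      fun t => by simpa using ((hq t).hasFDerivAt.fst).hasDerivAt
    have h2 : ∀ t, HasDerivAt (fun s => (q s).2.1) (cos ((u t).1 / 2) * sinh (q t).2.2) t :=
      fun t => by simpa using ((hq t).hasFDerivAt.snd.fst).hasDerivAt
    have h3 : ∀ t, HasDerivAt (fun s => (q s).2.2) (sin ((u t).1 / 2)) t :=
      fun t => by simpa using ((hq t).hasFDerivAt.snd.snd).hasDerivAt
    have e3 : (fun s => (q s).2.2) = z := uniq _ _ _ (by simp [hq0, hz]) h3 hz'
    have e3' : ∀ t, (q t).2.2 = z t := fun t => congrFun e3 t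
    simp only [e3'] at h1 h2
    have e1 := uniq _ _ _ (by simp [hq0]) h1
      (prim (fun r => cos ((u r).1 / 2) * cosh (z r)) (by fun_prop))
    have e2 := uniq _ _ _ (by simp [hq0]) h2
      (prim (fun r => cos ((u r).1 / 2) * sinh (z r)) (by fun_prop))
    funext t
    exact Prod.ext (congrFun e1 t) (Prod.ext (congrFun e2 t) (e3' t))

theorem continuous_pendulumFlow (p : ℝ × ℝ) : Continuous (pendulumFlow p) :=
  continuous_iff_continuousAt.2 fun t => (pendulumFlow_solution p t).continuousAt

/-- The curve `t ↦ (x_t, y_t, z_t)` with the initial covector `p = (γ, c)`, `γ` lifted to `ℝ`. -/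
def extremal (p : ℝ × ℝ) : ℝ → ℝ × ℝ × ℝ :=
  (existsUnique_horizontal (continuous_pendulumFlow p)).choose

theorem extremal_spec (p : ℝ × ℝ) : IsHorizontalSolution (pendulumFlow p) (extremal p) :=
  (existsUnique_horizontal (continuous_pendulumFlow p)).choose_spec.1

theorem extremal_eq {p : ℝ × ℝ} {q : ℝ → ℝ × ℝ × ℝ}
    (h : IsHorizontalSolution (pendulumFlow p) q) : extremal p = q :=
  ((existsUnique_horizontal (continuous_pendulumFlow p)).choose_spec.2 q h).symm

theorem extremal_add_period (γ c : ℝ) : extremal (γ + 4 * π, c) = extremal (γ, c) := by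
  obtain ⟨h0, h⟩ := extremal_spec (γ, c)
  refine extremal_eq ⟨h0, fun t => ?_⟩
  have h1 : ((pendulumFlow (γ, c) t).1 + 4 * π) / 2 = (pendulumFlow (γ, c) t).1 / 2 + 2 * π := by
    ring
  simpa [pendulumFlow_add_period, h1] using h t

/-- The cylinder `C = (ℝ / 4πℤ) × ℝ` of the pairs `(γ, c)`. -/
abbrev PhaseCylinder : Type := AddCircle (4 * π) × ℝ

/-- The state space `M = SH(2) ≅ ℝ³` with the coordinates `(x, y, z)`. -/
abbrev M : Type := ℝ × ℝ × ℝ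

/-- The flow of the pendulum on the cylinder: `(γ, c) ↦ (γ_t, c_t)`. -/
def phaseFlow (t : ℝ) (l : PhaseCylinder) : PhaseCylinder :=
  (show Function.Periodic (fun γ : ℝ =>
      ((((pendulumFlow (γ, l.2) t).1 : AddCircle (4 * π)), (pendulumFlow (γ, l.2) t).2) :
        PhaseCylinder)) (4 * π) from fun γ => by
    simp [pendulumFlow_add_period]).lift l.1

/-- The exponential mapping `(l, t) ↦ (x_t, y_t, z_t)`. -/
def Exp (ν : PhaseCylinder × ℝ) : M :=
  (show Function.Periodic (fun γ : ℝ => extremal (γ, ν.1.2) ν.2) (4 * π) from fun γ => by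
    simp [extremal_add_period]).lift ν.1.1

theorem phaseFlow_coe (t γ c : ℝ) : phaseFlow t ((γ : AddCircle (4 * π)), c) =
    (((pendulumFlow (γ, c) t).1 : AddCircle (4 * π)), (pendulumFlow (γ, c) t).2) := rfl

theorem Exp_coe (γ c t : ℝ) : Exp (((γ : AddCircle (4 * π)), c), t) = extremal (γ, c) t := rfl

/-! ### The domains -/

/-- `γ ↦ sin (γ / 2)` on `ℝ / 4πℤ`. -/
def sinHalf : AddCircle (4 * π) → ℝ :=
  (show Function.Periodic (fun γ : ℝ => sin (γ / 2)) (4 * π) from fun γ => by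
    show sin ((γ + 4 * π) / 2) = sin (γ / 2)
    rw [show (γ + 4 * π) / 2 = γ / 2 + 2 * π by ring, sin_add_two_pi]).lift

/-- `γ ↦ cos γ` on `ℝ / 4πℤ`. -/
def cosAngle : AddCircle (4 * π) → ℝ :=
  (show Function.Periodic cos (4 * π) from fun γ => by
    rw [show γ + 4 * π = γ + 2 * π + 2 * π by ring, cos_add_two_pi, cos_add_two_pi]).lift

/-- The energy `E = c² / 2 - cos γ` of the pendulum. -/
def energy (l : PhaseCylinder) : ℝ := l.2 ^ 2 / 2 - cosAngle l.1

def C₁ : Set PhaseCylinder := {l | -1 < energy l ∧ energy l < 1}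

def C₂ : Set PhaseCylinder := {l | 1 < energy l}

def C₃ : Set PhaseCylinder := {l | energy l = 1 ∧ l.2 ≠ 0}

def C₄ : Set PhaseCylinder := {l | energy l = -1 ∧ l.2 = 0}

def C₅ : Set PhaseCylinder := {l | energy l = 1 ∧ l.2 = 0}

/-- The complete elliptic integral of the first kind, as a function of the modulus `k`. -/
def ellipticK (k : ℝ) : ℝ := ∫ θ in (0 : ℝ)..(π / 2), 1 / √(1 - k ^ 2 * sin θ ^ 2)

/-- The modulus `k`: `√((E + 1) / 2)` on `C₁` and `√(2 / (E + 1))` on `C₂`. -/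
def modulus (l : PhaseCylinder) : ℝ :=
  if energy l < 1 then √((energy l + 1) / 2) else √(2 / (energy l + 1))

open scoped Classical in
/-- The bound `𝐭` on the cut time: `4 K(k)` on `C₁`, `4 k K(k)` on `C₂`, `2 π` on `C₄`, and `+∞` on
the rest of the cylinder, which is `C₃ ∪ C₅`. -/
def cutBound (l : PhaseCylinder) : EReal :=
  if l ∈ C₁ then ((4 * ellipticK (modulus l) : ℝ) : EReal)
  else if l ∈ C₂ then ((4 * modulus l * ellipticK (modulus l) : ℝ) : EReal)
  else if l ∈ C₄ then ((2 * π : ℝ) : EReal)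
  else ⊤

/-- The domain `D₁` in the preimage `N = C × (0, ∞)`. -/
def D₁ : Set (PhaseCylinder × ℝ) :=
  {ν | ν.1 ∈ C₁ ∪ C₂ ∪ C₃ ∪ C₅ ∧ 0 < ν.2 ∧ (ν.2 : EReal) < cutBound ν.1 ∧
    0 < sinHalf (phaseFlow (ν.2 / 2) ν.1).1}

/-- The domain `D₂` in the preimage `N = C × (0, ∞)`. -/
def D₂ : Set (PhaseCylinder × ℝ) :=
  {ν | ν.1 ∈ C₁ ∪ C₂ ∪ C₃ ∪ C₅ ∧ 0 < ν.2 ∧ (ν.2 : EReal) < cutBound ν.1 ∧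
    sinHalf (phaseFlow (ν.2 / 2) ν.1).1 < 0}

/-- The half-space `M₁ = {z > 0}`, as an open submanifold of `M`. -/
def M₁ : TopologicalSpace.Opens M :=
  ⟨{q | 0 < q.2.2}, isOpen_lt continuous_const (by fun_prop)⟩

/-- The half-space `M₂ = {z < 0}`, as an open submanifold of `M`. -/
def M₂ : TopologicalSpace.Opens M :=
  ⟨{q | q.2.2 < 0}, isOpen_lt (by fun_prop) continuous_const⟩

/-- The model of the 3-manifold `C × ℝ`. -/
abbrev modelN := (𝓘(ℝ, ℝ).prod 𝓘(ℝ, ℝ)).prod 𝓘(ℝ, ℝ)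

/-- The map `f` restricts to a `C^∞` diffeomorphism of the open submanifold `D` of `C × ℝ` onto the
open submanifold `V` of `M`. -/
def RestrictsToDiffeomorphism (f : PhaseCylinder × ℝ → M)
    (D : TopologicalSpace.Opens (PhaseCylinder × ℝ)) (V : TopologicalSpace.Opens M) : Prop :=
  ∃ Φ : Diffeomorph modelN 𝓘(ℝ, M) D V ∞, ∀ ν : D, (Φ ν : M) = f ν

end SH2

end

namespace SH2

open Set Real Filter
open scoped Manifold ContDiff Topology NNReal

noncomputable section

/-! ### Smooth dependence of fixed points on parameters -/

/-! The argument is of Hadamard type. `Exp : D₁ → M₁` is a local diffeomorphism and is proper, and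
`M₁` is connected, so the image, being open and closed in `M₁`, is everything (`surjOn_Exp`). For
injectivity, the set of points with two preimages is also open and closed in `M₁`, and it misses
`(0, 0, 1)`, whose only preimage is the unstable equilibrium followed for time one (`injOn_Exp`).
The symmetry `(γ, c, y, z) ↦ (-γ, -c, -y, -z)` carries the result over to `D₂` and `M₂`.

Put `θ = γ / 2`, `d = c / 2`; then `sin² θ + d²` is conserved (`kap`, equal to `(E + 1) / 2`). Off
the separatrix `sin θ` changes sign after a half period `H`, and the bound on `t` is `2 H`. If `sin
θ` is positive at `m = t / 2`, the displacement `z (m + r) - z (m - r)` has its first positive zero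
at `r = H`. Hence `D₁` is described by positivity of displacements (`coe_mem_D₁_iff_disp`), a
condition that makes sense across the separatrix, where `H` blows up. It gives openness and the
inclusion of the image in `M₁`.

Properness (`exists_tendsto_subseq`): a lower bound on `z` bounds `c`. If the times were unbounded,
the conserved momenta would bound the integral of `cos² θ` along a limiting trajectory, forcing it
onto the separatrix; there `z` grows linearly, a contradiction (`time_not_tendsto_atTop`).

Nondegeneracy (`fderiv_liftedExp_injective`): the Gauss lemma removes the time direction. Off the
separatrix the conserved momenta reduce the equation in variations to a two by two system with
determinant `jac`. When `sin θ` is nonzero at both ends, `jac` is `sin (θ 0) * sin (θ t)` times the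
product of the increments of two barriers minus a square. The barriers decrease, minus twice their
derivatives are squares of two functions with constant product, and the sign of `jac` follows from
the Cauchy–Schwarz inequality, monotonicity and periodicity (`IsPend.jac_pos`). The separatrix and
the equilibria are integrated explicitly.

Smoothness of the flow comes from the implicit function theorem for the Picard operator, for short
times, and then from the group law. -/

theorem contDiffAt_of_isFixedPt {A X : Type*} [NormedAddCommGroup A] [NormedSpace ℝ A]
    [CompleteSpace A] [NormedAddCommGroup X] [NormedSpace ℝ X] [CompleteSpace X]
    {N : A × X → X} {g : A → X} {a : A} {k : ℝ≥0} (hk : k < 1)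
    (hN : ContDiffAt ℝ ∞ N (a, g a)) (hg : ∀ b, N (b, g b) = g b)
    (hlip : ∀ᶠ b in 𝓝 a, LipschitzWith k fun u => N (b, u)) :
    ContDiffAt ℝ ∞ g a := by
  set f : A × X → X := fun q => q.2 - N q with hf
  have hfs : ContDiffAt ℝ ∞ f (a, g a) := contDiffAt_snd.sub hN
  have hNd : DifferentiableAt ℝ N (a, g a) := hN.differentiableAt (by simp)
  have hder : fderiv ℝ f (a, g a) ∘L .inr ℝ A X
      = 1 - (fderiv ℝ N (a, g a) ∘L .inr ℝ A X) := by
    have h1 : fderiv ℝ f (a, g a) = .snd ℝ A X - fderiv ℝ N (a, g a) :=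
      (hasFDerivAt_snd.sub hNd.hasFDerivAt).fderiv
    rw [h1]
    ext v
    simp
  have hnorm : ‖fderiv ℝ N (a, g a) ∘L .inr ℝ A X‖ < 1 := by
    have h2 : HasFDerivAt (fun u => N (a, u)) (fderiv ℝ N (a, g a) ∘L .inr ℝ A X) (g a) :=
      hNd.hasFDerivAt.comp (g a) (hasFDerivAt_prodMk_right a (g a))
    have h3 := norm_fderiv_le_of_lipschitz ℝ (x₀ := g a) hlip.self_of_nhds
    rw [h2.fderiv] at h3
    exact h3.trans_lt (by exact_mod_cast hk)
  have hinv : (fderiv ℝ f (a, g a) ∘L .inr ℝ A X).IsInvertible := by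
    rw [hder]
    exact ⟨ContinuousLinearEquiv.unitsEquiv ℝ X (Units.oneSub _ hnorm), rfl⟩
  have h0 : f (a, g a) = 0 := by simp [hf, hg]
  have hev := hfs.eventually_apply_implicitFunction (by simp) hinv
  have hψ := hfs.contDiffAt_implicitFunction (by simp) hinv
  -- The implicit function also consists of fixed points, and a contraction has only one. Thus no
  -- prior continuity of `g` is needed.
  refine hψ.congr_of_eventuallyEq ?_
  filter_upwards [hev, hlip] with b hb hbl
  rw [h0] at hb
  have hb' : N (b, hfs.implicitFunction (by simp) hinv b) = hfs.implicitFunction (by simp) hinv b :=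
    (sub_eq_zero.1 hb).symm
  have h4 := hbl.dist_le_mul (g b) (hfs.implicitFunction (by simp) hinv b)
  simp only [hb', hg] at h4
  have hk' : (k : ℝ) < 1 := by exact_mod_cast hk
  have h5 := dist_nonneg (x := g b) (y := hfs.implicitFunction (by simp) hinv b)
  exact dist_le_zero.1 (by nlinarith)

/-! ### Superposition and integration operators on `C([0, 1])` -/

/-- Continuous functions on the unit interval. -/
abbrev Path1 : Type := C(Icc (0 : ℝ) 1, ℝ)

def compSin (u : Path1) : Path1 := ⟨fun t => sin (u t), by fun_prop⟩

def compCos (u : Path1) : Path1 := ⟨fun t => cos (u t), by fun_prop⟩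

def compExp (u : Path1) : Path1 := ⟨fun t => exp (u t), by fun_prop⟩

theorem contDiff_normedSpace_exp {A : Type*} [NormedRing A] [NormedAlgebra ℝ A]
    [CompleteSpace A] : ContDiff ℝ ∞ (NormedSpace.exp : A → A) :=
  contDiff_iff_contDiffAt.2 fun x => (NormedSpace.exp_analytic (𝕂 := ℝ) x).contDiffAt

theorem continuousMap_exp_apply {𝕜 : Type*} [RCLike 𝕜] (u : C(Icc (0 : ℝ) 1, 𝕜))
    (t : Icc (0 : ℝ) 1) : NormedSpace.exp u t = NormedSpace.exp (u t) := by
  let _ : Algebra ℚ C(Icc (0 : ℝ) 1, 𝕜) := Algebra.compHom _ (algebraMap ℚ ℝ)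
  exact NormedSpace.map_exp (Pi.evalRingHom (fun _ : Icc (0 : ℝ) 1 => 𝕜) t |>.comp
    (ContinuousMap.coeFnRingHom : C(Icc (0 : ℝ) 1, 𝕜) →+* _))
    (continuous_eval_const t) u

-- This superposition operator is the exponential of the Banach algebra `C([0, 1])`, hence analytic.
-- Sine and cosine are handled below as imaginary and real parts of the complex version.
@[fun_prop]
theorem contDiff_compExp : ContDiff ℝ ∞ compExp := by
  have h : compExp = NormedSpace.exp := by
    funext u
    ext t
    rw [continuousMap_exp_apply, ← Real.exp_eq_exp_ℝ]
    rfl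
  rw [h]
  exact contDiff_normedSpace_exp

/-- `u ↦ exp (i u)` -/
def compCExp (u : Path1) : C(Icc (0 : ℝ) 1, ℂ) :=
  NormedSpace.exp (Complex.I • Complex.ofRealCLM.compLeftContinuous ℝ _ u)

theorem compCExp_apply (u : Path1) (t : Icc (0 : ℝ) 1) :
    compCExp u t = Complex.exp (u t * Complex.I) := by
  rw [compCExp, continuousMap_exp_apply, ← Complex.exp_eq_exp_ℂ]
  simp [mul_comm]

@[fun_prop]
theorem contDiff_compCExp : ContDiff ℝ ∞ compCExp :=
  contDiff_normedSpace_exp.comp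
    ((Complex.ofRealCLM.compLeftContinuous ℝ (Icc (0 : ℝ) 1)).contDiff.const_smul Complex.I)

@[fun_prop]
theorem contDiff_compSin : ContDiff ℝ ∞ compSin := by
  have h : compSin = fun u => Complex.imCLM.compLeftContinuous ℝ _ (compCExp u) := by
    funext u
    ext t
    simp [compCExp_apply, compSin, Complex.exp_ofReal_mul_I_im]
  rw [h]
  exact (ContinuousLinearMap.contDiff _).comp contDiff_compCExp

@[fun_prop]
theorem contDiff_compCos : ContDiff ℝ ∞ compCos := by
  have h : compCos = fun u => Complex.reCLM.compLeftContinuous ℝ _ (compCExp u) := by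
    funext u
    ext t
    simp [compCExp_apply, compCos, Complex.exp_ofReal_mul_I_re]
  rw [h]
  exact (ContinuousLinearMap.contDiff _).comp contDiff_compCExp

theorem dist_compSin_le (u v : Path1) : dist (compSin u) (compSin v) ≤ dist u v := by
  refine (ContinuousMap.dist_le dist_nonneg).2 fun t => ?_
  have := Real.lipschitzWith_sin.dist_le_mul (u t) (v t)
  simp only [NNReal.coe_one, one_mul] at this
  exact this.trans (ContinuousMap.dist_apply_le_dist t)

/-- The extension of `u` to the real line by constants. -/
def Path1.extend (u : Path1) : ℝ → ℝ := fun t => u (projIcc 0 1 zero_le_one t)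

theorem Path1.continuous_extend (u : Path1) : Continuous u.extend :=
  u.continuous.comp continuous_projIcc

/-- `u ↦ ∫₀ u` as an operator on `C([0, 1])`. -/
def primitive : Path1 →L[ℝ] Path1 :=
  LinearMap.mkContinuous
    { toFun := fun u => ⟨fun t => ∫ r in (0 : ℝ)..t, u.extend r, by
        have : Continuous fun t : ℝ => ∫ r in (0 : ℝ)..t, u.extend r :=
          intervalIntegral.continuous_primitive
            (fun a b => u.continuous_extend.intervalIntegrable a b) 0
        exact this.comp continuous_subtype_val⟩
      map_add' := fun u v => by
        ext t
        exact intervalIntegral.integral_add (u.continuous_extend.intervalIntegrable _ _)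
          (v.continuous_extend.intervalIntegrable _ _)
      map_smul' := fun a u => by
        ext t
        exact intervalIntegral.integral_const_mul a u.extend } 1 fun u => by
    refine (ContinuousMap.norm_le _ (by positivity)).2 fun t => ?_
    have h := intervalIntegral.norm_integral_le_of_norm_le_const (a := 0) (b := (t : ℝ))
      (f := u.extend) (C := ‖u‖) fun r _ => u.norm_coe_le_norm _
    refine h.trans ?_
    rw [sub_zero, abs_of_nonneg t.2.1, one_mul]
    exact mul_le_of_le_one_right (norm_nonneg u) t.2.2

theorem primitive_apply (u : Path1) (t : Icc (0 : ℝ) 1) :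
    primitive u t = ∫ r in (0 : ℝ)..t, u.extend r := rfl

theorem norm_primitive_le (u : Path1) : ‖primitive u‖ ≤ ‖u‖ := by
  have := (LinearMap.mkContinuous_norm_le _ zero_le_one _ :
    ‖primitive‖ ≤ 1)
  simpa using primitive.le_of_opNorm_le this u

theorem dist_primitive_le (u v : Path1) : dist (primitive u) (primitive v) ≤ dist u v := by
  rw [dist_eq_norm, dist_eq_norm, ← map_sub]
  exact norm_primitive_le _

theorem primitive_eq_of_hasDerivAt {f f' : ℝ → ℝ} (hf : ∀ t, HasDerivAt f (f' t) t)
    (hf' : Continuous f') (w : Path1) (hw : ∀ t : Icc (0 : ℝ) 1, w t = f' t)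
    (t : Icc (0 : ℝ) 1) : primitive w t = f t - f 0 := by
  rw [primitive_apply, ← intervalIntegral.integral_eq_sub_of_hasDerivAt (fun r _ => hf r)
    (hf'.intervalIntegrable _ _)]
  refine intervalIntegral.integral_congr fun r hr => ?_
  rw [uIcc_of_le t.2.1] at hr
  simp only [Path1.extend]
  rw [hw, projIcc_of_mem zero_le_one ⟨hr.1, hr.2.trans t.2.2⟩]

/-! ### The flow of the pendulum is smooth for short times -/

/-- The path `τ ↦ (γ_{sτ}, c_{sτ})`, `τ ∈ [0, 1]`. -/
def pendulumPath (a : (ℝ × ℝ) × ℝ) : Path1 × Path1 :=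
  (⟨fun τ => (pendulumFlow a.1 (a.2 * τ)).1, by
    have := continuous_pendulumFlow a.1; fun_prop⟩,
   ⟨fun τ => (pendulumFlow a.1 (a.2 * τ)).2, by
    have := continuous_pendulumFlow a.1; fun_prop⟩)

/-- The Picard operator of the pendulum with rescaled time. -/
def pendulumPicard (q : ((ℝ × ℝ) × ℝ) × (Path1 × Path1)) : Path1 × Path1 :=
  (ContinuousLinearMap.const ℝ _ q.1.1.1 + q.1.2 • primitive q.2.2,
   ContinuousLinearMap.const ℝ _ q.1.1.2 - q.1.2 • primitive (compSin q.2.1))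

theorem contDiff_pendulumPicard : ContDiff ℝ ∞ pendulumPicard := by
  unfold pendulumPicard
  fun_prop

theorem hasDerivAt_pendulumFlow_fst (p : ℝ × ℝ) (t : ℝ) :
    HasDerivAt (fun s => (pendulumFlow p s).1) (pendulumFlow p t).2 t := by
  simpa using ((pendulumFlow_solution p t).hasFDerivAt.fst).hasDerivAt

theorem hasDerivAt_pendulumFlow_snd (p : ℝ × ℝ) (t : ℝ) :
    HasDerivAt (fun s => (pendulumFlow p s).2) (-sin (pendulumFlow p t).1) t := by
  simpa using ((pendulumFlow_solution p t).hasFDerivAt.snd).hasDerivAt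

theorem pendulumPicard_pendulumPath (a : (ℝ × ℝ) × ℝ) :
    pendulumPicard (a, pendulumPath a) = pendulumPath a := by
  have hc := continuous_pendulumFlow a.1
  have hm : ∀ t : ℝ, HasDerivAt (fun τ : ℝ => a.2 * τ) a.2 t := fun t => by
    simpa using (hasDerivAt_id t).const_mul a.2
  have h1 := fun t => (hasDerivAt_pendulumFlow_fst a.1 (a.2 * t)).comp t (hm t)
  have h2 := fun t => (hasDerivAt_pendulumFlow_snd a.1 (a.2 * t)).comp t (hm t)
  refine Prod.ext ?_ ?_
  · ext t
    have := primitive_eq_of_hasDerivAt h1 (by fun_prop) (a.2 • (pendulumPath a).2)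
      (fun t => by simp [pendulumPath, mul_comm]) t
    simp only [map_smul, ContinuousMap.smul_apply, Function.comp_apply, mul_zero,
      pendulumFlow_zero] at this
    simp only [pendulumPicard, ContinuousMap.add_apply, ContinuousMap.smul_apply, this]
    simp [pendulumPath]
  · ext t
    have := primitive_eq_of_hasDerivAt h2 (by fun_prop) (-a.2 • compSin (pendulumPath a).1)
      (fun t => by simp [pendulumPath, compSin, mul_comm]) t
    rw [map_smul, ContinuousMap.smul_apply, neg_smul] at this
    simp only [Function.comp_apply, mul_zero, pendulumFlow_zero] at this
    change a.1.2 - a.2 * primitive (compSin (pendulumPath a).1) t = (pendulumFlow a.1 (a.2 * t)).2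
    rw [smul_eq_mul] at this
    linarith

/-- After rescaling to `[0, 1]` the time enters as a factor, so that the operator contracts exactly
in the range of times below one used next. -/
theorem lipschitzWith_pendulumPicard (a : (ℝ × ℝ) × ℝ) :
    LipschitzWith ‖a.2‖₊ fun u => pendulumPicard (a, u) := by
  refine LipschitzWith.of_dist_le_mul fun u v => ?_
  rw [Prod.dist_eq, Prod.dist_eq]
  simp only [pendulumPicard, dist_add_left, dist_sub_left, coe_nnnorm]
  rw [mul_max_of_nonneg _ _ (norm_nonneg _), max_comm]
  exact max_le_max ((dist_smul_le _ _ _).trans (mul_le_mul_of_nonneg_left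
      ((dist_primitive_le _ _).trans (dist_compSin_le _ _)) (norm_nonneg _)))
    ((dist_smul_le _ _ _).trans
      (mul_le_mul_of_nonneg_left (dist_primitive_le _ _) (norm_nonneg _)))

theorem contDiffAt_pendulumPath {a : (ℝ × ℝ) × ℝ} (ha : |a.2| < 1) :
    ContDiffAt ℝ ∞ pendulumPath a := by
  -- A constant strictly between `|a.2|` and `1` serves all nearby parameters at once.
  obtain ⟨k, hk1, hk2⟩ := exists_between ha
  lift k to ℝ≥0 using (abs_nonneg _).trans hk1.le
  refine contDiffAt_of_isFixedPt (k := k) (by exact_mod_cast hk2)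
    contDiff_pendulumPicard.contDiffAt pendulumPicard_pendulumPath ?_
  have : ∀ᶠ b : (ℝ × ℝ) × ℝ in 𝓝 a, |b.2| < k :=
    (continuous_snd.abs.continuousAt.eventually_lt continuousAt_const hk1)
  filter_upwards [this] with b hb
  exact (lipschitzWith_pendulumPicard b).weaken (by
    rw [← NNReal.coe_le_coe]; simpa using hb.le)

/-! ### The exponential mapping is smooth -/

theorem hasDerivAt_extremal_fst (p : ℝ × ℝ) (t : ℝ) :
    HasDerivAt (fun s => (extremal p s).1)
      (cos ((pendulumFlow p t).1 / 2) * cosh (extremal p t).2.2) t := by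
  simpa using (((extremal_spec p).2 t).hasFDerivAt.fst).hasDerivAt

theorem hasDerivAt_extremal_snd (p : ℝ × ℝ) (t : ℝ) :
    HasDerivAt (fun s => (extremal p s).2.1)
      (cos ((pendulumFlow p t).1 / 2) * sinh (extremal p t).2.2) t := by
  simpa using (((extremal_spec p).2 t).hasFDerivAt.snd.fst).hasDerivAt

theorem hasDerivAt_extremal_trd (p : ℝ × ℝ) (t : ℝ) :
    HasDerivAt (fun s => (extremal p s).2.2) (sin ((pendulumFlow p t).1 / 2)) t := by
  simpa using (((extremal_spec p).2 t).hasFDerivAt.snd.snd).hasDerivAt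

theorem extremal_zero (p : ℝ × ℝ) : extremal p 0 = (0, 0, 0) := (extremal_spec p).1

theorem continuous_extremal (p : ℝ × ℝ) : Continuous (extremal p) :=
  continuous_iff_continuousAt.2 fun t => ((extremal_spec p).2 t).continuousAt

/-- The path `τ ↦ z_{sτ}` in terms of the path of `γ`. -/
def zPath (s : ℝ) (u : Path1) : Path1 := s • primitive (compSin ((1 / 2 : ℝ) • u))

/-- The paths `τ ↦ x_{sτ} ± y_{sτ}` in terms of the path of `γ`. -/
def xyPath (σ s : ℝ) (u : Path1) : Path1 :=
  s • primitive (compCos ((1 / 2 : ℝ) • u) * compExp (σ • zPath s u))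

theorem zPath_apply (a : (ℝ × ℝ) × ℝ) (t : Icc (0 : ℝ) 1) :
    zPath a.2 (pendulumPath a).1 t = (extremal a.1 (a.2 * t)).2.2 := by
  have hm : ∀ t : ℝ, HasDerivAt (fun τ : ℝ => a.2 * τ) a.2 t := fun t => by
    simpa using (hasDerivAt_id t).const_mul a.2
  have hc := continuous_pendulumFlow a.1
  have := primitive_eq_of_hasDerivAt
    (fun t => (hasDerivAt_extremal_trd a.1 (a.2 * t)).comp t (hm t)) (by fun_prop)
    (a.2 • compSin ((1 / 2 : ℝ) • (pendulumPath a).1))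
    (fun t => by simp [compSin, pendulumPath, mul_comm, div_eq_mul_inv]) t
  simp only [map_smul, Function.comp_apply, mul_zero, extremal_zero, sub_zero] at this
  exact this

/-- For `σ = ±1` the combination `x + σ y` has velocity `cos θ * exp (σ z)`, so the exponential
superposition operator replaces `cosh` and `sinh`. -/
theorem xyPath_apply (σ : ℝ) (hσ : σ ^ 2 = 1) (a : (ℝ × ℝ) × ℝ) (t : Icc (0 : ℝ) 1) :
    xyPath σ a.2 (pendulumPath a).1 t
      = (extremal a.1 (a.2 * t)).1 + σ * (extremal a.1 (a.2 * t)).2.1 := by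
  have hm : ∀ t : ℝ, HasDerivAt (fun τ : ℝ => a.2 * τ) a.2 t := fun t => by
    simpa using (hasDerivAt_id t).const_mul a.2
  have hc := continuous_pendulumFlow a.1
  have hq := continuous_extremal a.1
  have he : ∀ z, exp (σ * z) = cosh z + σ * sinh z := fun z => by
    rcases (Commute.all σ 1).sq_eq_sq_iff_eq_or_eq_neg.1 (by rw [hσ, one_pow]) with rfl | rfl
    · simp [Real.cosh_add_sinh]
    · simp [← sub_eq_add_neg, Real.cosh_sub_sinh]
  have := primitive_eq_of_hasDerivAt
    (fun t => ((hasDerivAt_extremal_fst a.1 (a.2 * t)).comp t (hm t)).add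
      (((hasDerivAt_extremal_snd a.1 (a.2 * t)).comp t (hm t)).const_mul σ)) (by fun_prop)
    (a.2 • (compCos ((1 / 2 : ℝ) • (pendulumPath a).1) * compExp (σ • zPath a.2 (pendulumPath a).1)))
    (fun t => by
      simp only [ContinuousMap.smul_apply, ContinuousMap.mul_apply, compCos, compExp,
        ContinuousMap.coe_mk, zPath_apply, smul_eq_mul, he]
      simp only [pendulumPath, ContinuousMap.coe_mk]
      rw [show (1 / 2 : ℝ) * (pendulumFlow a.1 (a.2 * t)).1 = (pendulumFlow a.1 (a.2 * t)).1 / 2 by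
        ring]
      ring) t
  simp only [map_smul, Pi.add_apply, Function.comp_apply, mul_zero, extremal_zero, sub_zero,
    add_zero] at this
  exact this

/-- The pair of the flow and of the exponential mapping in lifted coordinates. -/
def lifted (a : (ℝ × ℝ) × ℝ) : (ℝ × ℝ) × M := (pendulumFlow a.1 a.2, extremal a.1 a.2)

@[fun_prop]
theorem contDiff_zPath : ContDiff ℝ ∞ fun q : ℝ × Path1 => zPath q.1 q.2 := by
  unfold zPath
  generalize primitive = J
  fun_prop

theorem contDiff_xyPath (σ : ℝ) : ContDiff ℝ ∞ fun q : ℝ × Path1 => xyPath σ q.1 q.2 := by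
  unfold xyPath
  generalize primitive = J
  fun_prop

theorem contDiffAt_lifted_of_abs_lt_one {a : (ℝ × ℝ) × ℝ} (ha : |a.2| < 1) :
    ContDiffAt ℝ ∞ lifted a := by
  have hp := contDiffAt_pendulumPath ha
  obtain ⟨ev, hev⟩ : ∃ ev : Path1 →L[ℝ] ℝ, ∀ u, ev u = u ⟨1, by simp⟩ :=
    ⟨ContinuousMap.evalCLM ℝ _, fun _ => rfl⟩
  have hsu : ContDiffAt ℝ ∞ (fun b : (ℝ × ℝ) × ℝ => (b.2, (pendulumPath b).1)) a :=
    contDiffAt_snd.prodMk hp.fst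
  have hz : ContDiffAt ℝ ∞ (fun b => ev (zPath b.2 (pendulumPath b).1)) a :=
    (ev.contDiff.comp contDiff_zPath).contDiffAt.comp a hsu
  have hxy : ∀ σ : ℝ, ContDiffAt ℝ ∞ (fun b => ev (xyPath σ b.2 (pendulumPath b).1)) a :=
    fun σ => (ev.contDiff.comp (contDiff_xyPath σ)).contDiffAt.comp a hsu
  have heq : lifted = fun b => ((ev (pendulumPath b).1, ev (pendulumPath b).2),
      ((ev (xyPath 1 b.2 (pendulumPath b).1) + ev (xyPath (-1) b.2 (pendulumPath b).1)) / 2,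
       (ev (xyPath 1 b.2 (pendulumPath b).1) - ev (xyPath (-1) b.2 (pendulumPath b).1)) / 2,
       ev (zPath b.2 (pendulumPath b).1))) := by
    funext b
    simp only [hev, zPath_apply, xyPath_apply 1 (by norm_num),
      xyPath_apply (-1) (by norm_num), mul_one]
    refine Prod.ext ?_ (Prod.ext ?_ (Prod.ext ?_ rfl))
    · simp [lifted, pendulumPath]
    · simp only [lifted]; ring
    · simp only [lifted]; ring
  rw [heq]
  refine ContDiffAt.prodMk (((ev.contDiff.contDiffAt).comp a hp.fst).prodMk
    ((ev.contDiff.contDiffAt).comp a hp.snd)) ?_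
  exact (((hxy 1).add (hxy (-1))).div_const 2).prodMk
    ((((hxy 1).sub (hxy (-1))).div_const 2).prodMk hz)

theorem pendulumFlow_add (p : ℝ × ℝ) (t r : ℝ) :
    pendulumFlow p (t + r) = pendulumFlow (pendulumFlow p t) r := by
  have h : pendulumFlow (pendulumFlow p t) = fun r => pendulumFlow p (t + r) :=
    pendulumFlow_eq (by simp) fun r => (pendulumFlow_solution p (t + r)).comp_const_add t r
  rw [h]

/-- Left invariance on `SH(2)`: the rest of the curve is the extremal of the current covector,
translated by the point already reached; the translation boosts `(x, y)` by `z`. -/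
theorem extremal_add (p : ℝ × ℝ) (t r : ℝ) :
    extremal p (t + r) =
      ((extremal p t).1 + cosh (extremal p t).2.2 * (extremal (pendulumFlow p t) r).1
        + sinh (extremal p t).2.2 * (extremal (pendulumFlow p t) r).2.1,
       (extremal p t).2.1 + sinh (extremal p t).2.2 * (extremal (pendulumFlow p t) r).1
        + cosh (extremal p t).2.2 * (extremal (pendulumFlow p t) r).2.1,
       (extremal p t).2.2 + (extremal (pendulumFlow p t) r).2.2) := by
  set x := (extremal p t).1
  set y := (extremal p t).2.1
  set z := (extremal p t).2.2
  have h : extremal (pendulumFlow p t) = fun r =>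
      (cosh z * ((extremal p (t + r)).1 - x) - sinh z * ((extremal p (t + r)).2.1 - y),
       cosh z * ((extremal p (t + r)).2.1 - y) - sinh z * ((extremal p (t + r)).1 - x),
       (extremal p (t + r)).2.2 - z) := by
    refine extremal_eq ⟨by simp [x, y, z], fun r => ?_⟩
    have hx := ((hasDerivAt_extremal_fst p (t + r)).comp_const_add t r).sub_const x
    have hy := ((hasDerivAt_extremal_snd p (t + r)).comp_const_add t r).sub_const y
    have hz := ((hasDerivAt_extremal_trd p (t + r)).comp_const_add t r).sub_const z
    refine (((hx.const_mul (cosh z)).sub (hy.const_mul (sinh z))).prodMk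
      (((hy.const_mul (cosh z)).sub (hx.const_mul (sinh z))).prodMk hz)).congr_deriv ?_
    rw [← pendulumFlow_add, cosh_sub, sinh_sub]
    refine Prod.ext ?_ (Prod.ext ?_ rfl)
    · dsimp only; ring
    · dsimp only; ring
  have hcs := Real.cosh_sq z
  rw [h]
  refine Prod.ext ?_ (Prod.ext ?_ ?_)
  · dsimp only; linear_combination (x - (extremal p (t + r)).1) * hcs
  · dsimp only; linear_combination (y - (extremal p (t + r)).2.1) * hcs
  · dsimp only; ring

theorem contDiffAt_concat {w v : (ℝ × ℝ) × ℝ → (ℝ × ℝ) × M} {a : (ℝ × ℝ) × ℝ}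
    (hw : ContDiffAt ℝ ∞ w a) (hv : ContDiffAt ℝ ∞ v a) :
    ContDiffAt ℝ ∞ (fun b => ((v b).1,
      ((w b).2.1 + cosh (w b).2.2.2 * (v b).2.1 + sinh (w b).2.2.2 * (v b).2.2.1,
       (w b).2.2.1 + sinh (w b).2.2.2 * (v b).2.1 + cosh (w b).2.2.2 * (v b).2.2.1,
       (w b).2.2.2 + (v b).2.2.2))) a := by
  have hc : ContDiffAt ℝ ∞ (fun b => cosh (w b).2.2.2) a :=
    Real.contDiff_cosh.contDiffAt.comp a hw.snd.snd.snd
  have hs : ContDiffAt ℝ ∞ (fun b => sinh (w b).2.2.2) a :=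
    Real.contDiff_sinh.contDiffAt.comp a hw.snd.snd.snd
  fun_prop

/-- The group law expresses the time `t` maps through those at `t / 2`, so each induction step
doubles the range of times where smoothness is known. -/
theorem contDiff_lifted : ContDiff ℝ ∞ lifted := by
  have key : ∀ n : ℕ, ∀ a : (ℝ × ℝ) × ℝ, |a.2| < 2 ^ n → ContDiffAt ℝ ∞ lifted a := by
    intro n
    induction n with
    | zero => intro a ha; exact contDiffAt_lifted_of_abs_lt_one (by simpa using ha)
    | succ n ih =>
      intro a ha
      have heq : lifted = fun b =>
          let w := lifted (b.1, b.2 / 2)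
          let v := lifted (w.1, b.2 / 2)
          (v.1, (w.2.1 + cosh w.2.2.2 * v.2.1 + sinh w.2.2.2 * v.2.2.1,
            w.2.2.1 + sinh w.2.2.2 * v.2.1 + cosh w.2.2.2 * v.2.2.1, w.2.2.2 + v.2.2.2)) := by
        funext b
        have hb : b.2 / 2 + b.2 / 2 = b.2 := by ring
        refine Prod.ext ?_ ?_
        · simp only [lifted]; rw [← pendulumFlow_add, hb]
        · simp only [lifted]; rw [← extremal_add, hb]
      have ha2 : |a.2 / 2| < 2 ^ n := by
        rw [abs_div, abs_two, div_lt_iff₀ two_pos]; rwa [pow_succ] at ha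
      have hw : ContDiffAt ℝ ∞ (fun b : (ℝ × ℝ) × ℝ => lifted (b.1, b.2 / 2)) a :=
        ContDiffAt.comp (g := lifted) (f := fun b : (ℝ × ℝ) × ℝ => (b.1, b.2 / 2)) a
          (ih (a.1, a.2 / 2) ha2) (by fun_prop)
      have hv : ContDiffAt ℝ ∞ (fun b : (ℝ × ℝ) × ℝ =>
          lifted ((lifted (b.1, b.2 / 2)).1, b.2 / 2)) a :=
        ContDiffAt.comp (g := lifted)
          (f := fun b : (ℝ × ℝ) × ℝ => ((lifted (b.1, b.2 / 2)).1, b.2 / 2)) a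
          (ih _ ha2) (hw.fst.prodMk (contDiffAt_snd.div_const 2))
      rw [heq]
      dsimp only
      exact contDiffAt_concat hw hv
  refine contDiff_iff_contDiffAt.2 fun a => ?_
  obtain ⟨n, hn⟩ := pow_unbounded_of_one_lt |a.2| (one_lt_two : (1 : ℝ) < 2)
  exact key n a hn

/-! ### Scalar autonomous equations -/

theorem forall_pos_or_forall_neg {f : ℝ → ℝ} (hf : Continuous f) (h0 : ∀ t, f t ≠ 0) :
    (∀ t, 0 < f t) ∨ ∀ t, f t < 0 := by
  rcases lt_or_gt_of_ne (h0 0) with h | h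
  · right
    intro t
    by_contra hcon
    obtain ⟨r, -, hr⟩ := intermediate_value_uIcc (hf.continuousOn (s := uIcc 0 t))
      (mem_uIcc_of_le h.le (not_lt.1 hcon))
    exact h0 r hr
  · left
    intro t
    by_contra hcon
    obtain ⟨r, -, hr⟩ := intermediate_value_uIcc (hf.continuousOn (s := uIcc 0 t))
      (mem_uIcc_of_ge (not_lt.1 hcon) h.le)
    exact h0 r hr

theorem eq_of_hasDerivAt_eq {f g f' : ℝ → ℝ} (hf : ∀ t, HasDerivAt f (f' t) t)
    (hg : ∀ t, HasDerivAt g (f' t) t) {a : ℝ} (ha : f a = g a) (t : ℝ) : f t = g t := by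
  have hd : ∀ t, HasDerivAt (f - g) 0 t := fun t => by simpa using (hf t).sub (hg t)
  have := is_const_of_deriv_eq_zero (fun t => (hd t).differentiableAt) (fun t => (hd t).deriv) t a
  simp only [Pi.sub_apply, ha, sub_self] at this
  linarith

theorem eq_of_hasDerivAt_zero {f : ℝ → ℝ} (hf : ∀ t, HasDerivAt f 0 t) (t a : ℝ) : f t = f a :=
  is_const_of_deriv_eq_zero (fun t => (hf t).differentiableAt) (fun t => (hf t).deriv) t a

section Phase

variable {g Y : ℝ → ℝ}

theorem strictMono_primitive_inv (hg : Continuous g) (hpos : ∀ u, 0 < g u) :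
    StrictMono fun u => ∫ r in (0 : ℝ)..u, 1 / g r := by
  have hc : Continuous fun r => 1 / g r := continuous_const.div hg fun r => (hpos r).ne'
  refine strictMono_of_hasDerivAt_pos (f' := fun u => 1 / g u) (fun u => ?_)
    fun u => one_div_pos.2 (hpos u)
  exact intervalIntegral.integral_hasDerivAt_right (hc.intervalIntegrable _ _)
    (hc.stronglyMeasurableAtFilter _ _) hc.continuousAt

/-- Separation of variables: the primitive of `1 / g` is a clock that runs at unit speed along every
solution. -/
theorem primitive_inv_phase (hg : Continuous g) (hpos : ∀ u, 0 < g u)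
    (hY : ∀ t, HasDerivAt Y (g (Y t)) t) (t a : ℝ) :
    ∫ r in (0 : ℝ)..(Y t), 1 / g r = (∫ r in (0 : ℝ)..(Y a), 1 / g r) + (t - a) := by
  have hc : Continuous fun r => 1 / g r := continuous_const.div hg fun r => (hpos r).ne'
  have h1 : ∀ t, HasDerivAt (fun t => (∫ r in (0 : ℝ)..(Y t), 1 / g r) - t) 0 t := fun t => by
    have h2 := (intervalIntegral.integral_hasDerivAt_right (hc.intervalIntegrable 0 (Y t))
      (hc.stronglyMeasurableAtFilter _ _) hc.continuousAt).comp t (hY t)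
    have h3 := h2.sub (hasDerivAt_id t)
    rw [one_div_mul_cancel (hpos _).ne', sub_self] at h3
    exact h3
  have := eq_of_hasDerivAt_zero h1 t a
  linarith

/-- The clock is strictly increasing in the phase, so equal clock readings mean equal phases;
continuity of `g` replaces a Lipschitz condition. -/
theorem phase_unique (hg : Continuous g) (hpos : ∀ u, 0 < g u)
    (hY : ∀ t, HasDerivAt Y (g (Y t)) t) {W : ℝ → ℝ} (hW : ∀ t, HasDerivAt W (g (W t)) t)
    {a : ℝ} (ha : Y a = W a) (t : ℝ) : Y t = W t := by
  refine (strictMono_primitive_inv hg hpos).injective ?_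
  rw [primitive_inv_phase hg hpos hY t a, primitive_inv_phase hg hpos hW t a, ha]

theorem phase_add (hg : Continuous g) (hpos : ∀ u, 0 < g u) (hper : Function.Periodic g π)
    (hY : ∀ t, HasDerivAt Y (g (Y t)) t) (t : ℝ) :
    Y (t + ∫ r in (0 : ℝ)..π, 1 / g r) = Y t + π := by
  have hc : Continuous fun r => 1 / g r := continuous_const.div hg fun r => (hpos r).ne'
  have hp : Function.Periodic (fun r => 1 / g r) π := fun r => by simp [hper r]
  refine (strictMono_primitive_inv hg hpos).injective ?_
  rw [primitive_inv_phase hg hpos hY _ t, ← intervalIntegral.integral_add_adjacent_intervals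
    (hc.intervalIntegrable 0 (Y t)) (hc.intervalIntegrable (Y t) (Y t + π)),
    hp.intervalIntegral_add_eq (Y t) 0, zero_add]
  ring

theorem phase_strictMono (hpos : ∀ u, 0 < g u) (hY : ∀ t, HasDerivAt Y (g (Y t)) t) :
    StrictMono Y :=
  strictMono_of_hasDerivAt_pos hY fun _ => hpos _

/-- Since `g` is even and `π`-periodic, reversing time about `τ` and reflecting the phase in an odd
multiple of `π / 2` gives a solution that agrees with `Y` at `τ`. -/
theorem phase_reflect (hg : Continuous g) (hpos : ∀ u, 0 < g u)
    (hper : Function.Periodic g π) (heven : ∀ u, g (-u) = g u)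
    (hY : ∀ t, HasDerivAt Y (g (Y t)) t) {τ : ℝ} {k : ℤ} (hτ : Y τ = π / 2 + k * π) (t : ℝ) :
    Y (2 * τ - t) = π + 2 * k * π - Y t := by
  have hW : ∀ t, HasDerivAt (fun t => π + 2 * k * π - Y (2 * τ - t))
      (g (π + 2 * k * π - Y (2 * τ - t))) t := fun t => by
    have h1 : g (π + 2 * k * π - Y (2 * τ - t)) = g (Y (2 * τ - t)) := by
      have h2 := hper.int_mul (1 + 2 * k) (-Y (2 * τ - t))
      rw [← heven (Y (2 * τ - t)), ← h2]
      congr 1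
      push_cast
      ring
    rw [h1]
    have h3 : HasDerivAt (fun t : ℝ => 2 * τ - t) (-1) t := by
      simpa using (hasDerivAt_id t).const_sub (2 * τ)
    have h4 := ((hY (2 * τ - t)).comp t h3).const_sub (π + 2 * k * π)
    refine h4.congr_deriv ?_
    ring
  have h5 : Y τ = (fun t => π + 2 * k * π - Y (2 * τ - t)) τ := by
    dsimp only
    rw [show 2 * τ - τ = τ by ring, hτ]
    ring
  have := phase_unique hg hpos hY hW h5 t
  linarith

theorem exists_phase_eq (hg : Continuous g) (hpos : ∀ u, 0 < g u) (hper : Function.Periodic g π)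
    (hY : ∀ t, HasDerivAt Y (g (Y t)) t) (v : ℝ) : ∃ τ, Y τ = v := by
  set H := ∫ r in (0 : ℝ)..π, 1 / g r
  have hc : Continuous Y := continuous_iff_continuousAt.2 fun t => (hY t).continuousAt
  have hn : ∀ n : ℕ, Y (n * H) = Y 0 + n * π := fun n => by
    induction n with
    | zero => simp
    | succ n ih =>
      rw [show ((n + 1 : ℕ) : ℝ) * H = n * H + H by push_cast; ring,
        phase_add hg hpos hper hY, ih]
      push_cast
      ring
  have hn' : ∀ n : ℕ, Y (-(n * H)) = Y 0 - n * π := fun n => by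
    induction n with
    | zero => simp
    | succ n ih =>
      have := phase_add hg hpos hper hY (-(((n + 1 : ℕ) : ℝ) * H))
      rw [show -(((n + 1 : ℕ) : ℝ) * H) + ∫ r in (0 : ℝ)..π, 1 / g r = -(n * H) by
        change -(((n + 1 : ℕ) : ℝ) * H) + H = _; push_cast; ring, ih] at this
      push_cast at this ⊢
      linarith
  obtain ⟨n, hn1⟩ := exists_nat_gt (|v - Y 0| / π)
  rw [div_lt_iff₀ pi_pos] at hn1
  have hv := abs_lt.1 hn1
  have h1 : Y (-(n * H)) ≤ v := by rw [hn']; linarith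
  have h2 : v ≤ Y (n * H) := by rw [hn]; linarith
  obtain ⟨τ, -, hτ⟩ := intermediate_value_uIcc (hc.continuousOn (s := uIcc (-(n * H)) (n * H)))
    (mem_uIcc_of_le h1 h2)
  exact ⟨τ, hτ⟩

end Phase

/-! ### The pendulum in the coordinates `θ = γ / 2`, `d = c / 2` -/

/-- `θ' = d`, `d' = - sin θ cos θ` -/
structure IsPend (θ d : ℝ → ℝ) : Prop where
  deriv_angle : ∀ t, HasDerivAt θ (d t) t
  deriv_speed : ∀ t, HasDerivAt d (-(sin (θ t) * cos (θ t))) t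

/-- The half period of `sin θ`, where `κ = sin² θ + d²`. -/
def halfPeriod (κ : ℝ) : ℝ := ∫ r in (0 : ℝ)..π, 1 / √(max 1 κ - min 1 κ * cos r ^ 2)

namespace IsPend

variable {θ d : ℝ → ℝ}

theorem continuous_angle (h : IsPend θ d) : Continuous θ :=
  continuous_iff_continuousAt.2 fun t => (h.deriv_angle t).continuousAt

theorem continuous_speed (h : IsPend θ d) : Continuous d :=
  continuous_iff_continuousAt.2 fun t => (h.deriv_speed t).continuousAt

theorem deriv_sin (h : IsPend θ d) (t : ℝ) :
    HasDerivAt (fun t => sin (θ t)) (cos (θ t) * d t) t := (h.deriv_angle t).sin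

theorem deriv_cos (h : IsPend θ d) (t : ℝ) :
    HasDerivAt (fun t => cos (θ t)) (-sin (θ t) * d t) t := (h.deriv_angle t).cos

theorem energy_eq (h : IsPend θ d) (t a : ℝ) :
    sin (θ t) ^ 2 + d t ^ 2 = sin (θ a) ^ 2 + d a ^ 2 := by
  refine eq_of_hasDerivAt_zero (f := fun t => sin (θ t) ^ 2 + d t ^ 2) (fun t => ?_) t a
  refine (((h.deriv_sin t).pow 2).add ((h.deriv_speed t).pow 2)).congr_deriv ?_
  push_cast
  ring

theorem comp_add (h : IsPend θ d) (a : ℝ) : IsPend (fun t => θ (a + t)) fun t => d (a + t) :=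
  ⟨fun t => (h.deriv_angle (a + t)).comp_const_add a t,
   fun t => (h.deriv_speed (a + t)).comp_const_add a t⟩

/-- The angle `ψ` with `ψ' = cos θ` which is conjugate to `θ`. -/
theorem exists_conjugate_angle (h : IsPend θ d) {k : ℝ} (hk : k ^ 2 = sin (θ 0) ^ 2 + d 0 ^ 2) :
    ∃ ψ : ℝ → ℝ, (∀ t, HasDerivAt ψ (cos (θ t)) t) ∧ (∀ t, sin (θ t) = k * cos (ψ t)) ∧
      ∀ t, d t = -(k * sin (ψ t)) := by
  obtain ⟨a, ha1, ha2⟩ : ∃ a, sin (θ 0) = k * cos a ∧ d 0 = -(k * sin a) := by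
    rcases eq_or_ne k 0 with rfl | hk0
    · refine ⟨0, ?_, ?_⟩ <;> nlinarith [sq_nonneg (sin (θ 0)), sq_nonneg (d 0)]
    · have hz : ‖(⟨sin (θ 0) / k, -d 0 / k⟩ : ℂ)‖ = 1 := by
        rw [← sq_eq_sq₀ (norm_nonneg _) zero_le_one, ← Complex.normSq_eq_norm_sq,
          Complex.normSq_mk]
        field_simp
        linarith
      have h1 := Complex.norm_mul_cos_arg ⟨sin (θ 0) / k, -d 0 / k⟩
      have h2 := Complex.norm_mul_sin_arg ⟨sin (θ 0) / k, -d 0 / k⟩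
      rw [hz, one_mul] at h1 h2
      refine ⟨Complex.arg ⟨sin (θ 0) / k, -d 0 / k⟩, ?_, ?_⟩
      · rw [h1]; field_simp
      · rw [h2]; field_simp
  have hc : Continuous fun t => cos (θ t) := continuous_cos.comp h.continuous_angle
  have hψ : ∀ t, HasDerivAt (fun t => a + ∫ r in (0 : ℝ)..t, cos (θ r)) (cos (θ t)) t := fun t =>
    (intervalIntegral.integral_hasDerivAt_right (hc.intervalIntegrable _ _)
      (hc.stronglyMeasurableAtFilter _ _) hc.continuousAt).const_add a
  set ψ := fun t => a + ∫ r in (0 : ℝ)..t, cos (θ r) with hψdef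
  have hψ0 : ψ 0 = a := by simp [hψdef]
  -- The vector `(sin θ, d)` rotates with angular speed `cos θ`, which is the derivative of `ψ`; in
  -- the frame turned by `ψ` its two components are constant.
  have e1 : ∀ t, sin (θ t) * cos (ψ t) - d t * sin (ψ t) = k := fun t => by
    have h1 : ∀ t, HasDerivAt (fun t => sin (θ t) * cos (ψ t) - d t * sin (ψ t)) 0 t := fun t => by
      refine (((h.deriv_sin t).mul (hψ t).cos).sub
        ((h.deriv_speed t).mul (hψ t).sin)).congr_deriv ?_
      ring
    have := eq_of_hasDerivAt_zero h1 t 0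
    rw [this, hψ0, ha1, ha2]
    linear_combination k * sin_sq_add_cos_sq a
  have e2 : ∀ t, sin (θ t) * sin (ψ t) + d t * cos (ψ t) = 0 := fun t => by
    have h1 : ∀ t, HasDerivAt (fun t => sin (θ t) * sin (ψ t) + d t * cos (ψ t)) 0 t := fun t => by
      refine (((h.deriv_sin t).mul (hψ t).sin).add
        ((h.deriv_speed t).mul (hψ t).cos)).congr_deriv ?_
      ring
    have := eq_of_hasDerivAt_zero h1 t 0
    rw [this, hψ0, ha1, ha2]
    ring
  refine ⟨ψ, hψ, fun t => ?_, fun t => ?_⟩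
  · linear_combination cos (ψ t) * e1 t + sin (ψ t) * e2 t
      - sin (θ t) * sin_sq_add_cos_sq (ψ t)
  · linear_combination -sin (ψ t) * e1 t + cos (ψ t) * e2 t - d t * sin_sq_add_cos_sq (ψ t)

/-- The phase `Y` of the oscillations of `sin θ`. -/
theorem exists_phase (h : IsPend θ d) {κ : ℝ} (hκ : κ = sin (θ 0) ^ 2 + d 0 ^ 2) (hκ0 : 0 < κ)
    (hκ1 : κ ≠ 1) :
    ∃ Y : ℝ → ℝ, (∀ t, HasDerivAt Y (√(max 1 κ - min 1 κ * cos (Y t) ^ 2)) t) ∧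
      ∀ t, sin (θ t) = √(min 1 κ) * cos (Y t) := by
  have hen : ∀ t, sin (θ t) ^ 2 + d t ^ 2 = κ := fun t => by rw [h.energy_eq t 0, hκ]
  rcases lt_or_gt_of_ne hκ1 with h1 | h1
  -- Libration: `cos θ` keeps its sign, and the phase is the conjugate angle up to sign.
  · rw [max_eq_left h1.le, min_eq_right h1.le]
    obtain ⟨ψ, hψ, hs, hd⟩ := h.exists_conjugate_angle (k := √κ) (by rw [sq_sqrt hκ0.le, hκ])
    have hc2 : ∀ t, cos (θ t) ^ 2 = 1 - κ * cos (ψ t) ^ 2 := fun t => by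
      have := sin_sq_add_cos_sq (θ t)
      rw [hs t, mul_pow, sq_sqrt hκ0.le] at this
      linarith
    have hne : ∀ t, cos (θ t) ≠ 0 := fun t hc => by
      have := sin_sq_add_cos_sq (θ t)
      rw [hc] at this
      nlinarith [hen t, sq_nonneg (d t)]
    rcases forall_pos_or_forall_neg (by have := h.continuous_angle; fun_prop :
      Continuous fun t => cos (θ t)) hne with hp | hp
    · refine ⟨ψ, fun t => ?_, hs⟩
      rw [← hc2 t, sqrt_sq (hp t).le]
      exact hψ t
    · refine ⟨fun t => -ψ t, fun t => ?_, fun t => by rw [cos_neg]; exact hs t⟩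
      rw [cos_neg, ← hc2 t, sqrt_sq_eq_abs, abs_of_neg (hp t)]
      exact (hψ t).neg
  -- Rotation: `d` keeps its sign, and the phase is `θ - π / 2` up to sign.
  · rw [max_eq_right h1.le, min_eq_left h1.le]
    have hne : ∀ t, d t ≠ 0 := fun t hc => by
      have := sin_sq_add_cos_sq (θ t)
      have := hen t
      rw [hc] at this
      nlinarith [sq_nonneg (cos (θ t))]
    have hcs : ∀ t, cos (θ t - π / 2) = sin (θ t) := fun t => cos_sub_pi_div_two _
    have hd2 : ∀ t, κ - 1 * sin (θ t) ^ 2 = d t ^ 2 := fun t => by linarith [hen t]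
    rcases forall_pos_or_forall_neg h.continuous_speed hne with hp | hp
    · refine ⟨fun t => θ t - π / 2, fun t => ?_, fun t => by simp [hcs]⟩
      rw [hcs, hd2, sqrt_sq (hp t).le]
      exact (h.deriv_angle t).sub_const _
    · refine ⟨fun t => -(θ t - π / 2), fun t => ?_, fun t => by rw [cos_neg, hcs]; simp⟩
      rw [cos_neg, hcs, hd2, sqrt_sq_eq_abs, abs_of_neg (hp t)]
      exact ((h.deriv_angle t).sub_const _).neg

end IsPend

/-! ### Symmetries of the oscillation -/

/-- What is used of the oscillation of `σ = sin θ` with the half period `H`. -/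
structure IsOscillation (σ : ℝ → ℝ) (H : ℝ) : Prop where
  pos : 0 < H
  add_half : ∀ t, σ (t + H) = -σ t
  exists_zero : ∀ m, 0 < σ m → ∃ τ, τ - H < m ∧ m < τ ∧ σ τ = 0 ∧ (∀ r, τ - H < r → r < τ → 0 < σ r)
    ∧ ∀ r, σ (2 * τ - r) = -σ r
  symm_pos : ∀ m, 0 < σ m → ∀ r, 0 < r → r < H / 2 → 0 < σ (m + r) + σ (m - r)

/-- All properties are read off from the phase, which advances by `π` in time `halfPeriod κ` and is
symmetric about every zero of `cos Y`. -/
theorem IsPend.isOscillation {θ d : ℝ → ℝ} (h : IsPend θ d) {κ : ℝ}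
    (hκ : κ = sin (θ 0) ^ 2 + d 0 ^ 2) (hκ0 : 0 < κ) (hκ1 : κ ≠ 1) :
    IsOscillation (fun t => sin (θ t)) (halfPeriod κ) := by
  obtain ⟨Y, hY, hs⟩ := h.exists_phase hκ hκ0 hκ1
  set A := √(min 1 κ) with hA
  have hA0 : 0 < A := sqrt_pos.2 (lt_min one_pos hκ0)
  set g : ℝ → ℝ := fun u => √(max 1 κ - min 1 κ * cos u ^ 2) with hgdef
  have hg : Continuous g := by fun_prop
  have hlt : min 1 κ < max 1 κ := by
    rcases lt_or_gt_of_ne hκ1 with h1 | h1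
    · rwa [max_eq_left h1.le, min_eq_right h1.le]
    · rwa [max_eq_right h1.le, min_eq_left h1.le]
  have hpos : ∀ u, 0 < g u := fun u => sqrt_pos.2 (by
    have := cos_sq_le_one u
    have : 0 < min 1 κ := lt_min one_pos hκ0
    nlinarith)
  have hper : Function.Periodic g π := fun u => by simp [hgdef, cos_add_pi]
  have heven : ∀ u, g (-u) = g u := fun u => by simp [hgdef]
  have hH : halfPeriod κ = ∫ r in (0 : ℝ)..π, 1 / g r := rfl
  have hH0 : 0 < halfPeriod κ := by
    have := strictMono_primitive_inv hg hpos pi_pos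
    simpa [hH] using this
  have hadd : ∀ t, Y (t + halfPeriod κ) = Y t + π := phase_add hg hpos hper hY
  have hmono : StrictMono Y := phase_strictMono hpos hY
  -- `τ` is the end of the positive arch containing `m`. Evenness of `k` records that `sin θ` falls
  -- through zero there.
  have hzero : ∀ m, 0 < sin (θ m) → ∃ τ, ∃ k : ℤ, Y τ = π / 2 + k * π ∧
      τ - halfPeriod κ < m ∧ m < τ ∧ sin (θ τ) = 0 ∧
      (∀ r, τ - halfPeriod κ < r → r < τ → 0 < sin (θ r)) ∧ Even k := by
    intro m hm
    rw [hs m] at hm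
    have hcm : 0 < cos (Y m) := pos_of_mul_pos_right hm hA0.le
    obtain ⟨j, hj1, hj2⟩ : ∃ j : ℤ, -(π / 2) < Y m - j * (2 * π) ∧ Y m - j * (2 * π) < π / 2 := by
      refine ⟨round (Y m / (2 * π)), ?_⟩
      set j := round (Y m / (2 * π))
      have h2 := abs_sub_round (Y m / (2 * π))
      have h3 : |Y m - j * (2 * π)| ≤ π := by
        have : Y m - j * (2 * π) = (Y m / (2 * π) - j) * (2 * π) := by
          field_simp
        rw [this, abs_mul, abs_of_pos two_pi_pos]
        nlinarith [pi_pos]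
      rw [← cos_sub_int_mul_two_pi _ j] at hcm
      obtain ⟨h4, h5⟩ := abs_le.1 h3
      constructor
      · by_contra hcon
        have := cos_nonpos_of_pi_div_two_le_of_le (x := -(Y m - j * (2 * π)))
          (by linarith) (by linarith)
        rw [cos_neg] at this
        linarith
      · by_contra hcon
        have := cos_nonpos_of_pi_div_two_le_of_le (x := (Y m - j * (2 * π)))
          (by linarith) (by linarith)
        linarith
    obtain ⟨τ, hτ⟩ := exists_phase_eq hg hpos hper hY (π / 2 + (2 * j : ℤ) * π)
    have hτH : Y (τ - halfPeriod κ) = -(π / 2) + (2 * j : ℤ) * π := by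
      have := hadd (τ - halfPeriod κ)
      rw [sub_add_cancel, hτ] at this
      linarith
    have hcosj : ∀ u, cos (u + (2 * j : ℤ) * π) = cos u := fun u => by
      rw [← cos_add_int_mul_two_pi u j]
      congr 1
      push_cast
      ring
    refine ⟨τ, 2 * j, hτ, ?_, ?_, ?_, ?_, even_two_mul j⟩
    · refine hmono.lt_iff_lt.1 ?_
      rw [hτH]
      push_cast
      linarith
    · refine hmono.lt_iff_lt.1 ?_
      rw [hτ]
      push_cast
      linarith
    · rw [hs, hτ, hcosj, cos_pi_div_two, mul_zero]
    · intro r hr1 hr2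
      have h6 := hmono hr1
      have h7 := hmono hr2
      rw [hτH] at h6
      rw [hτ] at h7
      rw [hs, ← sub_add_cancel (Y r) ((2 * j : ℤ) * π), hcosj]
      exact mul_pos hA0 (cos_pos_of_mem_Ioo ⟨by linarith, by linarith⟩)
  have hrefl : ∀ τ, ∀ k : ℤ, Y τ = π / 2 + k * π → ∀ r, Y (2 * τ - r) = π + 2 * k * π - Y r :=
    fun τ k hτ r => phase_reflect hg hpos hper heven hY hτ r
  refine ⟨hH0, fun t => ?_, fun m hm => ?_, fun m hm r hr0 hr1 => ?_⟩
  · simp only [hs, hadd, cos_add_pi]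
    ring
  · obtain ⟨τ, k, hτ, h1, h2, h3, h4, -⟩ := hzero m hm
    refine ⟨τ, h1, h2, h3, h4, fun r => ?_⟩
    have : cos (π + 2 * k * π - Y r) = -cos (Y r) := by
      rw [show π + 2 * k * π - Y r = π - Y r + k * (2 * π) by ring, cos_add_int_mul_two_pi,
        cos_pi_sub]
    simp only [hs, hrefl τ k hτ, this]
    ring
  · obtain ⟨τ, k, hτ, h1, h2, h3, h4, hk⟩ := hzero m hm
    have hτH : Y (τ - halfPeriod κ) = π / 2 + (k - 1 : ℤ) * π := by
      have := hadd (τ - halfPeriod κ)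
      rw [sub_add_cancel, hτ] at this
      push_cast
      linarith
    -- Reflecting in the two ends `τ` and `τ - H` of the arch confines the mean of the phases at `m
    -- ± r` to within `π / 2` of `k π`; as `2 r < H`, their difference is below `π`. Both factors in
    -- `hcos` are therefore positive.
    have h5 : Y (m - r) < Y (2 * τ - (m + r)) := hmono (by linarith)
    have h6 : Y (2 * (τ - halfPeriod κ) - (m - r)) < Y (m + r) := hmono (by linarith)
    rw [hrefl τ k hτ] at h5
    rw [hrefl _ _ hτH] at h6
    push_cast at h6
    have h7 : Y (m - r) < Y (m + r) := hmono (by linarith)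
    have h8 : Y (m + r) < Y (m - r) + π := by
      rw [← hadd]
      exact hmono (by linarith)
    have hcos : cos (Y (m + r)) + cos (Y (m - r))
        = 2 * cos ((Y (m + r) + Y (m - r)) / 2 - k * π) * cos ((Y (m + r) - Y (m - r)) / 2) := by
      obtain ⟨j, rfl⟩ := hk
      rw [cos_add_cos, ← cos_sub_int_mul_two_pi ((Y (m + r) + Y (m - r)) / 2) j]
      congr 3
      push_cast
      ring
    simp only [hs]
    rw [← mul_add, hcos]
    refine mul_pos hA0 (mul_pos (mul_pos two_pos (cos_pos_of_mem_Ioo ⟨?_, ?_⟩))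
      (cos_pos_of_mem_Ioo ⟨?_, ?_⟩)) <;> linarith [pi_pos]

/-! ### Geodesics -/

/-- The horizontal subsystem in the coordinates `θ = γ / 2`, `d = c / 2`. -/
structure IsGeod (θ d x y z : ℝ → ℝ) : Prop extends IsPend θ d where
  deriv_x : ∀ t, HasDerivAt x (cos (θ t) * cosh (z t)) t
  deriv_y : ∀ t, HasDerivAt y (cos (θ t) * sinh (z t)) t
  deriv_z : ∀ t, HasDerivAt z (sin (θ t)) t
  x_zero : x 0 = 0
  y_zero : y 0 = 0
  z_zero : z 0 = 0

/-- `∫₀ᵗ cos² θ` -/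
def cosEnergy (θ : ℝ → ℝ) (t : ℝ) : ℝ := ∫ r in (0 : ℝ)..t, cos (θ r) ^ 2

theorem isGeod_lifted (p : ℝ × ℝ) :
    IsGeod (fun t => (pendulumFlow p t).1 / 2) (fun t => (pendulumFlow p t).2 / 2)
      (fun t => (extremal p t).1) (fun t => (extremal p t).2.1) fun t => (extremal p t).2.2 where
  deriv_angle t := (hasDerivAt_pendulumFlow_fst p t).div_const 2
  deriv_speed t := ((hasDerivAt_pendulumFlow_snd p t).div_const 2).congr_deriv (by
    have := sin_two_mul ((pendulumFlow p t).1 / 2)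
    rw [mul_div_cancel₀ _ two_ne_zero] at this
    rw [this]; ring)
  deriv_x := hasDerivAt_extremal_fst p
  deriv_y := hasDerivAt_extremal_snd p
  deriv_z := hasDerivAt_extremal_trd p
  x_zero := by rw [extremal_zero]
  y_zero := by rw [extremal_zero]
  z_zero := by rw [extremal_zero]

theorem IsPend.hasDerivAt_cosEnergy {θ d : ℝ → ℝ} (h : IsPend θ d) (t : ℝ) :
    HasDerivAt (cosEnergy θ) (cos (θ t) ^ 2) t := by
  have hc : Continuous fun t => cos (θ t) ^ 2 := by have := h.continuous_angle; fun_prop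
  exact intervalIntegral.integral_hasDerivAt_right (hc.intervalIntegrable _ _)
    (hc.stronglyMeasurableAtFilter _ _) hc.continuousAt

theorem cosEnergy_zero (θ : ℝ → ℝ) : cosEnergy θ 0 = 0 := by simp [cosEnergy]

namespace IsGeod

variable {θ d x y z : ℝ → ℝ}

/-- The derivative of `(cos θ, d)` is `-sin θ = -z'` times the swapped pair `(d, cos θ)`: the pair
is boosted by `-z`, and undoing the boost gives two first integrals. -/
theorem cos_and_speed_eq (h : IsGeod θ d x y z) (t : ℝ) :
    cos (θ t) = cos (θ 0) * cosh (z t) - d 0 * sinh (z t) ∧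
      d t = d 0 * cosh (z t) - cos (θ 0) * sinh (z t) := by
  have e1 : ∀ t, cos (θ t) * cosh (z t) + d t * sinh (z t) = cos (θ 0) := fun t => by
    have h1 : ∀ t, HasDerivAt (fun t => cos (θ t) * cosh (z t) + d t * sinh (z t)) 0 t :=
      fun t => by
        refine (((h.deriv_cos t).mul (h.deriv_z t).cosh).add
          ((h.deriv_speed t).mul (h.deriv_z t).sinh)).congr_deriv ?_
        ring
    have := eq_of_hasDerivAt_zero h1 t 0
    simpa [h.z_zero] using this
  have e2 : ∀ t, cos (θ t) * sinh (z t) + d t * cosh (z t) = d 0 := fun t => by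
    have h1 : ∀ t, HasDerivAt (fun t => cos (θ t) * sinh (z t) + d t * cosh (z t)) 0 t :=
      fun t => by
        refine (((h.deriv_cos t).mul (h.deriv_z t).sinh).add
          ((h.deriv_speed t).mul (h.deriv_z t).cosh)).congr_deriv ?_
        ring
    have := eq_of_hasDerivAt_zero h1 t 0
    simpa [h.z_zero] using this
  constructor
  · linear_combination cosh (z t) * e1 t - sinh (z t) * e2 t - cos (θ t) * cosh_sq (z t)
  · linear_combination cosh (z t) * e2 t - sinh (z t) * e1 t - d t * cosh_sq (z t)

theorem cos_eq (h : IsGeod θ d x y z) (t : ℝ) :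
    cos (θ t) = cos (θ 0) * cosh (z t) - d 0 * sinh (z t) := (h.cos_and_speed_eq t).1

theorem speed_eq (h : IsGeod θ d x y z) (t : ℝ) :
    d t = d 0 * cosh (z t) - cos (θ 0) * sinh (z t) := (h.cos_and_speed_eq t).2

/-- By `cos_eq` the left side has velocity `cos² θ`. With `boost_eq` this ties the endpoint to the
trajectory without elliptic functions. -/
theorem momentum_eq (h : IsGeod θ d x y z) (t : ℝ) :
    cos (θ 0) * x t - d 0 * y t = cosEnergy θ t := by
  refine eq_of_hasDerivAt_eq (f := fun t => cos (θ 0) * x t - d 0 * y t) (fun t => ?_)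
    h.hasDerivAt_cosEnergy (a := 0) ?_ t
  · refine (((h.deriv_x t).const_mul _).sub ((h.deriv_y t).const_mul _)).congr_deriv ?_
    rw [sq]
    nth_rw 4 [h.cos_eq t]
    ring
  · simp [h.x_zero, h.y_zero, cosEnergy_zero]

theorem boost_eq (h : IsGeod θ d x y z) (t : ℝ) :
    cos (θ 0) * y t - d 0 * x t = sin (θ 0) - sin (θ t) := by
  refine eq_of_hasDerivAt_eq (f := fun t => cos (θ 0) * y t - d 0 * x t) (fun t => ?_)
    (fun t => (h.deriv_sin t).const_sub (sin (θ 0))) (a := 0) ?_ t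
  · refine (((h.deriv_y t).const_mul _).sub ((h.deriv_x t).const_mul _)).congr_deriv ?_
    rw [h.speed_eq t]
    ring
  · simp [h.x_zero, h.y_zero]

theorem abs_z_le (h : IsGeod θ d x y z) {t : ℝ} (ht : 0 ≤ t) : |z t| ≤ t := by
  have := (convex_univ (𝕜 := ℝ) (E := ℝ)).norm_image_sub_le_of_norm_hasDerivWithin_le
    (f := z) (f' := fun t => sin (θ t)) (C := 1) (fun r _ => (h.deriv_z r).hasDerivWithinAt)
    (fun r _ => abs_sin_le_one _) (mem_univ 0) (mem_univ t)
  simpa [h.z_zero, abs_of_nonneg ht] using this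

/-- The displacement `z (m + r) - z (m - r)` has derivative `sin θ (m + r) + sin θ (m - r)`. -/
theorem hasDerivAt_displacement (h : IsGeod θ d x y z) (m r : ℝ) :
    HasDerivAt (fun r => z (m + r) - z (m - r)) (sin (θ (m + r)) + sin (θ (m - r))) r := by
  have h1 := (h.deriv_z (m + r)).comp_const_add m r
  have h2 := (h.deriv_z (m - r)).comp_const_sub m r
  exact (h1.sub h2).congr_deriv (by ring)

/-- The displacement increases on `[0, H / 2]` by `symm_pos`, and the sign change of `sin θ` after
`H` makes it symmetric about `r = H / 2`. It returns to zero at `r = H` with derivative `-2 sin (θ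
m)`, which is negative. -/
theorem displacement_pos_of_oscillation (h : IsGeod θ d x y z) {H : ℝ}
    (hH : IsOscillation (fun t => sin (θ t)) H) {m : ℝ} (hm : 0 < sin (θ m)) :
    (∀ r, 0 < r → r < H → 0 < z (m + r) - z (m - r)) ∧ z (m + H) - z (m - H) = 0 ∧
      ∃ ε > 0, ∀ r, H < r → r < H + ε → z (m + r) - z (m - r) < 0 := by
  set Δ := fun r => z (m + r) - z (m - r) with hΔ
  have hd := h.hasDerivAt_displacement m
  have hΔc : Continuous Δ := continuous_iff_continuousAt.2 fun t => (hd t).continuousAt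
  have hΔ0 : Δ 0 = 0 := by simp [hΔ]
  have hadd : ∀ t, sin (θ (t + H)) = -sin (θ t) := hH.add_half
  have hsub : ∀ t, sin (θ (t - H)) = -sin (θ t) := fun t => by
    have := hadd (t - H); rw [sub_add_cancel] at this; linarith
  have h1 : ∀ r, 0 < r → r ≤ H / 2 → 0 < Δ r := by
    have : StrictMonoOn Δ (Icc 0 (H / 2)) := by
      refine strictMonoOn_of_deriv_pos (convex_Icc _ _) hΔc.continuousOn fun r hr => ?_
      rw [interior_Icc] at hr
      rw [(hd r).deriv]
      exact hH.symm_pos m hm r hr.1 hr.2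
    intro r hr0 hr1
    rw [← hΔ0]
    exact this ⟨le_rfl, by linarith [hH.pos]⟩ ⟨hr0.le, hr1⟩ hr0
  have hsymm : ∀ r, Δ (H - r) = Δ r := fun r => by
    refine eq_of_hasDerivAt_eq (f := fun r => Δ (H - r)) (fun r => ?_) hd (a := H / 2) ?_ r
    · have h2 := (hd (H - r)).comp_const_sub H r
      refine h2.congr_deriv ?_
      rw [show m + (H - r) = (m - r) + H by ring, show m - (H - r) = (m + r) - H by ring,
        hadd, hsub]
      ring
    · change Δ (H - H / 2) = Δ (H / 2)
      congr 1
      ring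
  refine ⟨fun r hr0 hr1 => ?_, ?_, ?_⟩
  · rcases le_or_gt r (H / 2) with hr | hr
    · exact h1 r hr0 hr
    · change 0 < Δ r
      rw [← hsymm]
      exact h1 _ (by linarith) (by linarith)
  · have := hsymm 0
    rw [sub_zero, hΔ0] at this
    exact this
  · have hneg : sin (θ (m + H)) + sin (θ (m - H)) < 0 := by rw [hadd, hsub]; linarith
    have hcont : Continuous fun r => sin (θ (m + r)) + sin (θ (m - r)) := by
      have := h.continuous_angle
      fun_prop
    obtain ⟨ε, hε, hball⟩ := Metric.eventually_nhds_iff.1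
      (hcont.continuousAt.eventually_lt continuousAt_const hneg)
    refine ⟨ε, hε, fun r hr0 hr1 => ?_⟩
    have hanti : StrictAntiOn Δ (Icc H r) := by
      refine strictAntiOn_of_deriv_neg (convex_Icc _ _) hΔc.continuousOn fun u hu => ?_
      rw [interior_Icc] at hu
      rw [(hd u).deriv]
      refine hball ?_
      rw [Real.dist_eq, abs_of_pos (by linarith [hu.1])]
      linarith [hu.2]
    have h3 := hanti (left_mem_Icc.2 hr0.le) (right_mem_Icc.2 hr0.le) hr0
    have h4 := hsymm 0
    rw [sub_zero, hΔ0] at h4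
    change Δ r < 0
    linarith

end IsGeod

/-! ### The separatrix -/

/-- On the separatrix `sin θ` is a hyperbolic tangent. -/
theorem IsPend.exists_tanh {θ d : ℝ → ℝ} (h : IsPend θ d) (h1 : sin (θ 0) ^ 2 + d 0 ^ 2 = 1)
    (hd0 : d 0 ≠ 0) :
    ∃ ε b : ℝ, ε ^ 2 = 1 ∧ (∀ t, sin (θ t) = tanh (ε * t + b)) ∧ (∀ t, d t = ε * cos (θ t)) ∧
      ∀ t, cos (θ t) ≠ 0 := by
  -- A zero of `cos θ` on this energy level is an equilibrium; by uniqueness the trajectory would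
  -- rest there, contrary to `d 0 ≠ 0`.
  have hne : ∀ t, cos (θ t) ≠ 0 := by
    intro t hc
    have hs : sin (θ t) ^ 2 = 1 := by
      have := sin_sq_add_cos_sq (θ t)
      rw [hc] at this
      linarith
    have hdt : d t = 0 := by
      have := h.energy_eq t 0
      rw [h1, hs] at this
      nlinarith
    have hconst : IsPend (fun _ => θ t) fun _ => 0 :=
      ⟨fun r => hasDerivAt_const r _, fun r => (hasDerivAt_const r _).congr_deriv (by rw [hc]; ring)⟩
    have key : ∀ {θ₁ d₁ : ℝ → ℝ}, IsPend θ₁ d₁ →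
        IsPendulumSolution fun r => (2 * θ₁ r, 2 * d₁ r) := fun {θ₁ d₁} hp r => by
      refine (((hp.deriv_angle r).const_mul 2).prodMk
        ((hp.deriv_speed r).const_mul 2)).congr_deriv ?_
      rw [sin_two_mul]
      refine Prod.ext rfl ?_
      dsimp only
      ring
    have e1 := pendulumFlow_eq (p := (2 * θ t, 2 * d t)) (u := fun r => (2 * θ (t + r), 2 * d (t + r)))
      (by simp) (key (h.comp_add t))
    have e2 := pendulumFlow_eq (p := (2 * θ t, 2 * d t)) (u := fun r => (2 * θ t, 2 * 0))
      (by rw [hdt]) (key hconst)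
    have := congrArg Prod.snd (congrFun (e1.symm.trans e2) (-t))
    simp at this
    exact hd0 this
  have hd2 : ∀ t, d t ^ 2 = cos (θ t) ^ 2 := fun t => by
    have := h.energy_eq t 0
    have := sin_sq_add_cos_sq (θ t)
    linarith
  have hrc : ∀ t, HasDerivAt (fun t => d t / cos (θ t)) 0 t := fun t => by
    refine ((h.deriv_speed t).div (h.deriv_cos t) (hne t)).congr_deriv ?_
    rw [div_eq_zero_iff]
    left
    linear_combination sin (θ t) * hd2 t
  set ε := d 0 / cos (θ 0) with hε
  have hdc : ∀ t, d t = ε * cos (θ t) := fun t => by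
    have := eq_of_hasDerivAt_zero hrc t 0
    rw [hε, ← this, div_mul_cancel₀ _ (hne t)]
  have hε2 : ε ^ 2 = 1 := by
    rw [hε, div_pow, hd2, div_self (pow_ne_zero 2 (hne 0))]
  -- The inverse Gudermannian function straightens the motion: from `d = ε cos θ`, `arsinh (sin θ /
  -- |cos θ|)` moves at constant speed `ε`.
  have hder : ∀ t, HasDerivAt (fun t => arsinh (sin (θ t) / |cos (θ t)|)) ε t := fun t => by
    have hcc : Continuous fun t => cos (θ t) := by have := h.continuous_angle; fun_prop
    have habs : HasDerivAt (fun t => |cos (θ t)|) (|cos (θ t)| / cos (θ t) * (-sin (θ t) * d t)) t := by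
      rcases forall_pos_or_forall_neg hcc hne with hp | hp
      · rw [abs_of_pos (hp t), div_self (hne t), one_mul]
        exact (h.deriv_cos t).congr_of_eventuallyEq (Eventually.of_forall fun r => abs_of_pos (hp r))
      · rw [abs_of_neg (hp t), neg_div, div_self (hne t), neg_one_mul]
        exact (h.deriv_cos t).neg.congr_of_eventuallyEq
          (Eventually.of_forall fun r => abs_of_neg (hp r))
    have ha0 : |cos (θ t)| ≠ 0 := abs_ne_zero.2 (hne t)
    have hapos : 0 < |cos (θ t)| := abs_pos.2 (hne t)
    refine (((h.deriv_sin t).div habs ha0).arsinh).congr_deriv ?_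
    have hsq : √(1 + (sin (θ t) / |cos (θ t)|) ^ 2) = 1 / |cos (θ t)| := by
      rw [sqrt_eq_iff_mul_self_eq (by positivity) (by positivity)]
      field_simp
      rw [sq_abs]
      linarith [sin_sq_add_cos_sq (θ t)]
    simp only [Pi.div_apply]
    have hdt := hdc t
    have hct := hne t
    have hsc := sin_sq_add_cos_sq (θ t)
    clear_value ε
    rw [hsq, hdt, show cos (θ t) * (ε * cos (θ t)) * |cos (θ t)|
        - sin (θ t) * (|cos (θ t)| / cos (θ t) * (-sin (θ t) * (ε * cos (θ t))))
        = |cos (θ t)| * ε * (sin (θ t) ^ 2 + cos (θ t) ^ 2) by field_simp; ring, hsc]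
    rw [smul_eq_mul]
    field_simp
  refine ⟨ε, arsinh (sin (θ 0) / |cos (θ 0)|), hε2, fun t => ?_, hdc, hne⟩
  have hder2 : ∀ t, HasDerivAt (fun t => ε * t + arsinh (sin (θ 0) / |cos (θ 0)|)) ε t := fun t => by
    simpa using ((hasDerivAt_id t).const_mul ε).add_const (arsinh (sin (θ 0) / |cos (θ 0)|))
  have e := eq_of_hasDerivAt_eq hder hder2 (a := 0) (by simp) t
  have hapos : 0 < |cos (θ t)| := abs_pos.2 (hne t)
  rw [← e, tanh_eq_sinh_div_cosh, sinh_arsinh, cosh_arsinh,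
    show √(1 + (sin (θ t) / |cos (θ t)|) ^ 2) = 1 / |cos (θ t)| by
      rw [sqrt_eq_iff_mul_self_eq (by positivity) (by positivity)]
      field_simp
      rw [sq_abs]
      linarith [sin_sq_add_cos_sq (θ t)]]
  field_simp

theorem IsPend.angle_const {θ d : ℝ → ℝ} (h : IsPend θ d) (hc : cos (θ 0) = 0) (hd0 : d 0 = 0)
    (t : ℝ) : θ t = θ 0 ∧ d t = 0 := by
  have hconst : IsPendulumSolution fun _ => (2 * θ 0, 0) := fun r =>
    (hasDerivAt_const r _).congr_deriv (by rw [sin_two_mul, hc]; ext <;> simp)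
  have key : IsPendulumSolution fun r => (2 * θ r, 2 * d r) := fun r => by
    refine (((h.deriv_angle r).const_mul 2).prodMk
      ((h.deriv_speed r).const_mul 2)).congr_deriv ?_
    rw [sin_two_mul]
    refine Prod.ext rfl ?_
    dsimp only
    ring
  have e1 := pendulumFlow_eq (p := (2 * θ 0, 0)) (by simp [hd0]) key
  have e2 := pendulumFlow_eq (p := (2 * θ 0, 0)) (by simp) hconst
  have := congrFun (e1.symm.trans e2) t
  simp only [Prod.mk.injEq] at this
  constructor <;> linarith

/-- The slope of the displacement is constant and positive at an equilibrium. Otherwise it is `tanh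
(u + v) + tanh (u - v)`, whose numerator is `sinh (2 u)`, independent of `r` and positive. Hence no
time bound arises here. -/
theorem IsGeod.displacement_pos_of_separatrix {θ d x y z : ℝ → ℝ} (h : IsGeod θ d x y z)
    (h1 : sin (θ 0) ^ 2 + d 0 ^ 2 = 1) {m : ℝ} (hm : 0 < sin (θ m)) {r : ℝ} (hr : 0 < r) :
    0 < z (m + r) - z (m - r) := by
  have hd := h.hasDerivAt_displacement m
  have hmono : StrictMono fun r => z (m + r) - z (m - r) := by
    refine strictMono_of_hasDerivAt_pos hd fun r => ?_
    by_cases hd0 : d 0 = 0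
    · have hc : cos (θ 0) = 0 := by
        have := sin_sq_add_cos_sq (θ 0)
        rw [hd0] at h1
        nlinarith
      have hθ := fun t => (h.toIsPend.angle_const hc hd0 t).1
      rw [hθ] at hm
      rw [hθ (m + r), hθ (m - r)]
      linarith
    · obtain ⟨ε, b, hε, hs, -, -⟩ := h.exists_tanh h1 hd0
      simp only [hs] at hm ⊢
      rw [show ε * (m + r) + b = (ε * m + b) + ε * r by ring,
        show ε * (m - r) + b = (ε * m + b) - ε * r by ring]
      set u := ε * m + b
      set v := ε * r
      have hu : 0 < sinh u := by
        rw [tanh_eq_sinh_div_cosh] at hm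
        exact (div_pos_iff_of_pos_right (cosh_pos u)).1 hm
      have h2 := cosh_pos (u + v)
      have h3 := cosh_pos (u - v)
      rw [tanh_eq_sinh_div_cosh, tanh_eq_sinh_div_cosh, div_add_div _ _ h2.ne' h3.ne']
      refine div_pos ?_ (mul_pos h2 h3)
      rw [sinh_add u v, sinh_sub u v, cosh_add u v, cosh_sub u v]
      have h4 := cosh_pos u
      have : 0 < 2 * sinh u * cosh u := by positivity
      linear_combination this - 2 * sinh u * cosh u * cosh_sq v
  have := hmono hr
  simpa using this

/-! ### The bound on the cut time and the half period -/

theorem halfPeriod_eq {κ : ℝ} (hκ0 : 0 < κ) (hκ1 : κ ≠ 1) :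
    halfPeriod κ = 2 * ∫ r in (0 : ℝ)..(π / 2), 1 / √(max 1 κ - min 1 κ * sin r ^ 2) := by
  have hlt : min 1 κ < max 1 κ := by
    rcases lt_or_gt_of_ne hκ1 with h1 | h1
    · rwa [max_eq_left h1.le, min_eq_right h1.le]
    · rwa [max_eq_right h1.le, min_eq_left h1.le]
  set f : ℝ → ℝ := fun r => 1 / √(max 1 κ - min 1 κ * cos r ^ 2) with hf
  have hpos : ∀ u, 0 < √(max 1 κ - min 1 κ * cos u ^ 2) := fun u => sqrt_pos.2 (by
    have := cos_sq_le_one u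
    have : 0 < min 1 κ := lt_min one_pos hκ0
    nlinarith)
  have hc : Continuous f := continuous_const.div (by fun_prop) fun r => (hpos r).ne'
  have h1 : ∫ r in (0 : ℝ)..(π / 2), f (π - r) = ∫ r in (π / 2)..π, f r := by
    rw [intervalIntegral.integral_comp_sub_left]
    congr 1 <;> ring
  have h2 : ∫ r in (0 : ℝ)..(π / 2), f (π / 2 - r) = ∫ r in (0 : ℝ)..(π / 2), f r := by
    rw [intervalIntegral.integral_comp_sub_left]
    congr 1 <;> ring
  have h3 : ∀ r, f (π - r) = f r := fun r => by simp [hf, cos_pi_sub]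
  have h4 : ∀ r, f (π / 2 - r) = 1 / √(max 1 κ - min 1 κ * sin r ^ 2) := fun r => by
    simp [hf, cos_pi_div_two_sub]
  simp only [h3] at h1
  simp only [h4] at h2
  rw [h2, two_mul]
  nth_rw 2 [h1]
  exact (intervalIntegral.integral_add_adjacent_intervals (hc.intervalIntegrable _ _)
    (hc.intervalIntegrable _ _)).symm

/-- With `κ = (E + 1) / 2`, this formula on `C₁` and `halfPeriod_of_one_lt` on `C₂` identify the
bound on the cut time with the full period of `sin θ`. -/
theorem halfPeriod_of_lt_one {κ : ℝ} (hκ0 : 0 < κ) (hκ1 : κ < 1) :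
    2 * halfPeriod κ = 4 * ellipticK √κ := by
  rw [halfPeriod_eq hκ0 hκ1.ne, max_eq_left hκ1.le, min_eq_right hκ1.le, ellipticK, sq_sqrt hκ0.le]
  ring

theorem halfPeriod_of_one_lt {κ : ℝ} (hκ1 : 1 < κ) :
    2 * halfPeriod κ = 4 * √(1 / κ) * ellipticK √(1 / κ) := by
  have hκ0 : 0 < κ := by linarith
  rw [halfPeriod_eq hκ0 hκ1.ne', max_eq_right hκ1.le, min_eq_left hκ1.le, ellipticK,
    sq_sqrt (by positivity), mul_assoc 4, ← intervalIntegral.integral_const_mul (√(1 / κ)),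
    ← mul_assoc]
  congr 1
  · norm_num
  refine intervalIntegral.integral_congr fun r _ => ?_
  rw [mul_one_div, ← sqrt_div (by positivity), ← sqrt_one, ← sqrt_div zero_le_one, sqrt_one]
  congr 1
  rw [div_div, mul_sub, one_mul, mul_one, ← mul_assoc, mul_one_div_cancel hκ0.ne', one_mul]

/-- `sin² θ + d²` in terms of the initial covector. -/
def kap (p : ℝ × ℝ) : ℝ := sin (p.1 / 2) ^ 2 + (p.2 / 2) ^ 2

theorem energy_coe (p : ℝ × ℝ) : energy ((p.1 : AddCircle (4 * π)), p.2) = 2 * kap p - 1 := by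
  change p.2 ^ 2 / 2 - cos p.1 = _
  have := cos_two_mul (p.1 / 2)
  rw [mul_div_cancel₀ _ two_ne_zero] at this
  rw [this, kap]
  linear_combination -2 * sin_sq_add_cos_sq (p.1 / 2)

theorem cutBound_of_kap_ne_one {p : ℝ × ℝ} (h0 : 0 < kap p) (h1 : kap p ≠ 1) :
    cutBound ((p.1 : AddCircle (4 * π)), p.2) = ((2 * halfPeriod (kap p) : ℝ) : EReal) := by
  have he := energy_coe p
  rcases lt_or_gt_of_ne h1 with h | h
  · have hC : ((p.1 : AddCircle (4 * π)), p.2) ∈ C₁ :=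
      ⟨by rw [he]; linarith, by rw [he]; linarith⟩
    rw [cutBound, if_pos hC, halfPeriod_of_lt_one h0 h, modulus, if_pos hC.2, he]
    congr 4
    ring
  · have hC : ((p.1 : AddCircle (4 * π)), p.2) ∉ C₁ := fun hC => by
      have := hC.2
      rw [he] at this
      linarith
    have hC2 : ((p.1 : AddCircle (4 * π)), p.2) ∈ C₂ := by
      change 1 < energy _
      rw [he]
      linarith
    rw [cutBound, if_neg hC, if_pos hC2, halfPeriod_of_one_lt h, modulus,
      if_neg (by rw [he]; linarith), he]
    rw [show 2 / (2 * kap p - 1 + 1) = 1 / kap p by field_simp; ring]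

theorem cutBound_of_kap_eq_one {p : ℝ × ℝ} (h1 : kap p = 1) :
    cutBound ((p.1 : AddCircle (4 * π)), p.2) = ⊤ := by
  have he := energy_coe p
  rw [h1] at he
  rw [cutBound, if_neg (fun h => by have := h.2; rw [he] at this; norm_num at this),
    if_neg (fun h : _ ∈ C₂ => by
      have : 1 < energy _ := h
      rw [he] at this; norm_num at this),
    if_neg (fun h => by have := h.1; rw [he] at this; norm_num at this)]

/-! ### The domain in terms of trajectories -/

/-- The half angle `θ = γ / 2` along the extremal with the initial covector `p`. -/
def ang (p : ℝ × ℝ) (t : ℝ) : ℝ := (pendulumFlow p t).1 / 2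

/-- The half speed `d = c / 2` along the extremal. -/
def spd (p : ℝ × ℝ) (t : ℝ) : ℝ := (pendulumFlow p t).2 / 2

/-- The coordinate `x` along the extremal. -/
def ex (p : ℝ × ℝ) (t : ℝ) : ℝ := (extremal p t).1

/-- The coordinate `y` along the extremal. -/
def ey (p : ℝ × ℝ) (t : ℝ) : ℝ := (extremal p t).2.1

/-- The coordinate `z` along the extremal. -/
def ez (p : ℝ × ℝ) (t : ℝ) : ℝ := (extremal p t).2.2

theorem isGeod (p : ℝ × ℝ) : IsGeod (ang p) (spd p) (ex p) (ey p) (ez p) := isGeod_lifted p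

theorem ang_zero (p : ℝ × ℝ) : ang p 0 = p.1 / 2 := by rw [ang, pendulumFlow_zero]

theorem spd_zero (p : ℝ × ℝ) : spd p 0 = p.2 / 2 := by rw [spd, pendulumFlow_zero]

theorem kap_eq (p : ℝ × ℝ) (t : ℝ) : kap p = sin (ang p t) ^ 2 + spd p t ^ 2 := by
  rw [(isGeod p).energy_eq t 0, ang_zero, spd_zero, kap]

theorem isOscillation_ang {p : ℝ × ℝ} (h0 : 0 < kap p) (h1 : kap p ≠ 1) :
    IsOscillation (fun t => sin (ang p t)) (halfPeriod (kap p)) :=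
  (isGeod p).isOscillation (kap_eq p 0) h0 h1

theorem kap_pos_of_sin_ne_zero {p : ℝ × ℝ} {t : ℝ} (h : sin (ang p t) ≠ 0) : 0 < kap p := by
  rw [kap_eq p t]
  positivity

/-- Membership in the union of strata is automatic: `sin θ ≠ 0` at the middle time forces `kap p >
0`, which excludes only `C₄`. -/
theorem coe_mem_D₁_iff {p : ℝ × ℝ} {t : ℝ} :
    (((p.1 : AddCircle (4 * π)), p.2), t) ∈ D₁ ↔
      0 < t ∧ 0 < sin (ang p (t / 2)) ∧ (kap p ≠ 1 → t < 2 * halfPeriod (kap p)) := by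
  change (_ ∧ 0 < t ∧ (t : EReal) < cutBound ((p.1 : AddCircle (4 * π)), p.2) ∧
    0 < sin (ang p (t / 2))) ↔ _
  constructor
  · rintro ⟨-, ht, hcut, hs⟩
    refine ⟨ht, hs, fun h1 => ?_⟩
    rw [cutBound_of_kap_ne_one (kap_pos_of_sin_ne_zero hs.ne') h1] at hcut
    exact_mod_cast hcut
  · rintro ⟨ht, hs, hlt⟩
    have h0 := kap_pos_of_sin_ne_zero hs.ne'
    have he := energy_coe p
    refine ⟨?_, ht, ?_, hs⟩
    · rcases lt_trichotomy (kap p) 1 with h1 | h1 | h1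
      · exact Or.inl (Or.inl (Or.inl ⟨by dsimp only; rw [he]; linarith,
          by dsimp only; rw [he]; linarith⟩))
      · have he1 : energy ((p.1 : AddCircle (4 * π)), p.2) = 1 := by rw [he, h1]; norm_num
        by_cases hp : p.2 = 0
        · exact Or.inr ⟨he1, hp⟩
        · exact Or.inl (Or.inr ⟨he1, hp⟩)
      · refine Or.inl (Or.inl (Or.inr ?_))
        change 1 < energy _
        rw [he]
        linarith
    · by_cases h1 : kap p = 1
      · rw [cutBound_of_kap_eq_one h1]
        exact EReal.coe_lt_top t
      · rw [cutBound_of_kap_ne_one h0 h1]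
        exact_mod_cast hlt h1

/-- The displacement of `z` between the times `m - r` and `m + r`. -/
def disp (p : ℝ × ℝ) (m r : ℝ) : ℝ := ez p (m + r) - ez p (m - r)

/-- Off the separatrix `r = halfPeriod (kap p)` is the first zero of the displacement, so the
absence of zeros up to `t / 2` is the time bound. The period no longer appears, which makes the
separatrix an ordinary level. -/
theorem coe_mem_D₁_iff_disp {p : ℝ × ℝ} {t : ℝ} :
    (((p.1 : AddCircle (4 * π)), p.2), t) ∈ D₁ ↔
      0 < t ∧ 0 < sin (ang p (t / 2)) ∧ ∀ r, 0 < r → r ≤ t / 2 → 0 < disp p (t / 2) r := by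
  rw [coe_mem_D₁_iff]
  refine and_congr_right fun ht => and_congr_right fun hs => ?_
  by_cases h1 : kap p = 1
  · refine ⟨fun _ r hr _ => ?_, fun _ h => absurd h1 h⟩
    exact (isGeod p).displacement_pos_of_separatrix (by rw [← kap_eq, h1]) hs hr
  · have hosc := (isGeod p).displacement_pos_of_oscillation
      (isOscillation_ang (kap_pos_of_sin_ne_zero hs.ne') h1) hs
    refine ⟨fun h r hr0 hr1 => hosc.1 r hr0 (by linarith [h h1]), fun h _ => ?_⟩
    by_contra hcon
    have := h (halfPeriod (kap p))
      (isOscillation_ang (kap_pos_of_sin_ne_zero hs.ne') h1).pos (by linarith)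
    rw [disp, hosc.2.1] at this
    exact lt_irrefl _ this

theorem ez_eq_disp (p : ℝ × ℝ) (t : ℝ) : ez p t = disp p (t / 2) (t / 2) := by
  rw [disp, add_halves, sub_self, (isGeod p).z_zero, sub_zero]

/-- The projection of the lifted coordinates onto `C × ℝ`. -/
def proj (a : (ℝ × ℝ) × ℝ) : PhaseCylinder × ℝ := (((a.1.1 : AddCircle (4 * π)), a.1.2), a.2)

/-- The exponential mapping in the lifted coordinates. -/
def liftedExp (a : (ℝ × ℝ) × ℝ) : M := extremal a.1 a.2

theorem Exp_proj (a : (ℝ × ℝ) × ℝ) : Exp (proj a) = liftedExp a := rfl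

theorem contDiff_liftedExp : ContDiff ℝ ∞ liftedExp := contDiff_snd.comp contDiff_lifted

theorem continuous_proj : Continuous proj :=
  (((AddCircle.continuous_mk' (4 * π)).comp (continuous_fst.comp continuous_fst)).prodMk
    (continuous_snd.comp continuous_fst)).prodMk continuous_snd

theorem isOpenQuotientMap_proj : IsOpenQuotientMap proj :=
  (QuotientAddGroup.isOpenQuotientMap_mk.prodMap IsOpenQuotientMap.id).prodMap
    IsOpenQuotientMap.id

theorem continuous_ang : Continuous fun a : (ℝ × ℝ) × ℝ => ang a.1 a.2 :=
  contDiff_lifted.continuous.fst.fst.div_const 2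

theorem continuous_ex : Continuous fun a : (ℝ × ℝ) × ℝ => ex a.1 a.2 :=
  contDiff_lifted.continuous.snd.fst

theorem continuous_ey : Continuous fun a : (ℝ × ℝ) × ℝ => ey a.1 a.2 :=
  contDiff_lifted.continuous.snd.snd.fst

theorem continuous_ez : Continuous fun a : (ℝ × ℝ) × ℝ => ez a.1 a.2 :=
  contDiff_lifted.continuous.snd.snd.snd

theorem D₁_subset_preimage {ν : PhaseCylinder × ℝ} (hν : ν ∈ D₁) : Exp ν ∈ M₁ := by
  obtain ⟨a, rfl⟩ := isOpenQuotientMap_proj.surjective ν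
  obtain ⟨ht, -, h⟩ := coe_mem_D₁_iff_disp.1 hν
  change 0 < ez a.1 a.2
  rw [ez_eq_disp]
  exact h _ (by linarith) le_rfl

/-! ### Openness of the first domain -/

/-- The mean value of `z'` on the interval `[(1 - q) t / 2, (1 + q) t / 2]`, up to a factor. -/
def meanSlope (w : ((ℝ × ℝ) × ℝ) × ℝ) : ℝ :=
  ∫ u in (0 : ℝ)..1, (sin (ang w.1.1 (w.1.2 / 2 + w.1.2 / 2 * w.2 * u))
    + sin (ang w.1.1 (w.1.2 / 2 - w.1.2 / 2 * w.2 * u)))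

theorem continuous_meanSlope : Continuous meanSlope := by
  refine intervalIntegral.continuous_parametric_intervalIntegral_of_continuous' ?_ 0 1
  have h1 : Continuous fun b : (((ℝ × ℝ) × ℝ) × ℝ) × ℝ =>
      ang b.1.1.1 (b.1.1.2 / 2 + b.1.1.2 / 2 * b.1.2 * b.2) :=
    continuous_ang.comp (f := fun b : (((ℝ × ℝ) × ℝ) × ℝ) × ℝ =>
      (b.1.1.1, b.1.1.2 / 2 + b.1.1.2 / 2 * b.1.2 * b.2)) (by fun_prop)
  have h2 : Continuous fun b : (((ℝ × ℝ) × ℝ) × ℝ) × ℝ =>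
      ang b.1.1.1 (b.1.1.2 / 2 - b.1.1.2 / 2 * b.1.2 * b.2) :=
    continuous_ang.comp (f := fun b : (((ℝ × ℝ) × ℝ) × ℝ) × ℝ =>
      (b.1.1.1, b.1.1.2 / 2 - b.1.1.2 / 2 * b.1.2 * b.2)) (by fun_prop)
  exact (continuous_sin.comp h1).add (continuous_sin.comp h2)

theorem disp_eq_meanSlope (a : (ℝ × ℝ) × ℝ) (q : ℝ) :
    disp a.1 (a.2 / 2) (a.2 / 2 * q) = a.2 / 2 * q * meanSlope (a, q) := by
  have hm : ∀ u : ℝ, HasDerivAt (fun u : ℝ => a.2 / 2 * q * u) (a.2 / 2 * q) u := fun u => by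
    simpa using (hasDerivAt_id u).const_mul (a.2 / 2 * q)
  have hd : ∀ u : ℝ, HasDerivAt (fun u => disp a.1 (a.2 / 2) (a.2 / 2 * q * u))
      (a.2 / 2 * q * (sin (ang a.1 (a.2 / 2 + a.2 / 2 * q * u))
        + sin (ang a.1 (a.2 / 2 - a.2 / 2 * q * u)))) u := fun u =>
    (((isGeod a.1).hasDerivAt_displacement (a.2 / 2) (a.2 / 2 * q * u)).comp u (hm u)).congr_deriv
      (mul_comm _ _)
  have hc := (isGeod a.1).continuous_angle
  have := intervalIntegral.integral_eq_sub_of_hasDerivAt (a := 0) (b := 1) (fun u _ => hd u)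
    (Continuous.intervalIntegrable (by fun_prop) _ _)
  rw [intervalIntegral.integral_const_mul] at this
  rw [meanSlope, this, mul_one, mul_zero]
  simp [disp]

/-- Dividing the displacement by its length turns the condition on `sin θ` at the middle time into
the value at `q = 0`. What remains is positivity of a continuous function on a compact interval,
which is stable under perturbation. -/
theorem proj_mem_D₁_iff_meanSlope {a : (ℝ × ℝ) × ℝ} :
    proj a ∈ D₁ ↔ 0 < a.2 ∧ ∀ q ∈ Icc (0 : ℝ) 1, 0 < meanSlope (a, q) := by
  refine coe_mem_D₁_iff_disp.trans (and_congr_right fun ht => ?_)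
  have h0 : meanSlope (a, 0) = 2 * sin (ang a.1 (a.2 / 2)) := by
    simp [meanSlope]
    ring
  constructor
  · rintro ⟨hs, h⟩ q ⟨hq0, hq1⟩
    rcases hq0.eq_or_lt with rfl | hq
    · rw [h0]; linarith
    · have h1 := h (a.2 / 2 * q) (by positivity) (by nlinarith)
      rw [disp_eq_meanSlope] at h1
      exact pos_of_mul_pos_right h1 (by positivity)
  · intro h
    refine ⟨by linarith [h 0 ⟨le_rfl, zero_le_one⟩], fun r hr0 hr1 => ?_⟩
    have h1 : r = a.2 / 2 * (r / (a.2 / 2)) := by field_simp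
    rw [h1, disp_eq_meanSlope, ← h1]
    exact mul_pos hr0 (h _ ⟨by positivity, by rw [div_le_one (by positivity)]; exact hr1⟩)

theorem isOpen_D₁ : IsOpen D₁ := by
  rw [← isOpenQuotientMap_proj.isQuotientMap.isOpen_preimage, isOpen_iff_mem_nhds]
  intro a ha
  obtain ⟨ht, h⟩ := proj_mem_D₁_iff_meanSlope.1 ha
  have h1 : ∀ᶠ b in 𝓝 a, ∀ q ∈ Icc (0 : ℝ) 1, 0 < meanSlope (b, q) :=
    isCompact_Icc.eventually_forall_of_forall_eventually fun q hq =>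
      continuous_meanSlope.continuousAt.eventually (lt_mem_nhds (h q hq))
  filter_upwards [h1, continuous_snd.continuousAt.eventually (lt_mem_nhds ht)] with b hb1 hb2
  exact proj_mem_D₁_iff_meanSlope.2 ⟨hb2, hb1⟩

/-! ### Properness of the exponential mapping -/

namespace IsPend

variable {θ d : ℝ → ℝ}

theorem cosEnergy_mono (h : IsPend θ d) : Monotone (cosEnergy θ) :=
  monotone_of_hasDerivAt_nonneg h.hasDerivAt_cosEnergy fun _ => sq_nonneg _

/-- Below level one `cos² θ ≥ 1 - κ`; above it the angle rotates with speed bounded below. Either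
way the integral of `cos² θ` diverges. -/
theorem energy_eq_one_of_cosEnergy_le (h : IsPend θ d) {B : ℝ}
    (hB : ∀ t, 0 ≤ t → cosEnergy θ t ≤ B) : sin (θ 0) ^ 2 + d 0 ^ 2 = 1 := by
  set κ := sin (θ 0) ^ 2 + d 0 ^ 2 with hκ
  have hen : ∀ t, sin (θ t) ^ 2 + d t ^ 2 = κ := fun t => h.energy_eq t 0
  rcases lt_trichotomy κ 1 with h1 | h1 | h1
  · exfalso
    have hm : Monotone fun t => cosEnergy θ t - (1 - κ) * t := by
      refine monotone_of_hasDerivAt_nonneg (f' := fun t => cos (θ t) ^ 2 - (1 - κ))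
        (fun t => ?_) fun t => ?_
      · exact (h.hasDerivAt_cosEnergy t).sub (by simpa using (hasDerivAt_id t).const_mul (1 - κ))
      · have := hen t
        have := sin_sq_add_cos_sq (θ t)
        change 0 ≤ cos (θ t) ^ 2 - (1 - κ)
        nlinarith [sq_nonneg (d t)]
    set T := (|B| + 1) / (1 - κ)
    have hT : (1 - κ) * T = |B| + 1 := mul_div_cancel₀ _ (by linarith)
    have hT0 : 0 ≤ T := div_nonneg (by positivity) (by linarith)
    have h2 := hm hT0
    simp only [cosEnergy_zero, hT] at h2
    linarith [hB T hT0, le_abs_self B]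
  · exact h1
  · exfalso
    obtain ⟨σ, hσ, hσd⟩ : ∃ σ : ℝ, σ ^ 2 = 1 ∧ ∀ t, √(κ - 1) ≤ σ * d t := by
      have hd2 : ∀ t, κ - 1 ≤ d t ^ 2 := fun t => by
        have := hen t
        have := sin_sq_le_one (θ t)
        linarith
      have hne : ∀ t, d t ≠ 0 := fun t hc => by
        have := hd2 t
        rw [hc] at this
        linarith
      rcases forall_pos_or_forall_neg h.continuous_speed hne with hp | hp
      · exact ⟨1, by norm_num, fun t => by rw [one_mul]; exact sqrt_le_iff.2 ⟨(hp t).le, hd2 t⟩⟩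
      · exact ⟨-1, by norm_num, fun t => sqrt_le_iff.2 ⟨by linarith [hp t], by nlinarith [hd2 t]⟩⟩
    set w := √(κ - 1)
    have hw : 0 < w := sqrt_pos.2 (by linarith)
    have hdκ : ∀ t, σ * d t ≤ √κ := fun t => by
      refine le_sqrt_of_sq_le ?_
      rw [mul_pow, hσ, one_mul, ← hen t]
      nlinarith [sq_nonneg (sin (θ t))]
    have hθ : Monotone fun t => σ * θ t - w * t := by
      refine monotone_of_hasDerivAt_nonneg (f' := fun t => σ * d t - w) (fun t => ?_) fun t => ?_
      · exact ((h.deriv_angle t).const_mul σ).sub (by simpa using (hasDerivAt_id t).const_mul w)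
      · exact sub_nonneg.2 (hσd t)
    -- `(θ + sin θ cos θ) / 2` is a primitive of `cos² θ` in the angle. Since the speed is at most
    -- `√κ`, its growth is dominated by `√κ` times the time integral.
    have hF : Monotone fun t => √κ * cosEnergy θ t - σ * (θ t + sin (θ t) * cos (θ t)) / 2 := by
      refine monotone_of_hasDerivAt_nonneg (f' := fun t => cos (θ t) ^ 2 * (√κ - σ * d t))
        (fun t => ?_) fun t => ?_
      · refine (((h.hasDerivAt_cosEnergy t).const_mul _).sub
          ((((h.deriv_angle t).add ((h.deriv_sin t).mul (h.deriv_cos t))).const_mul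
            σ).div_const 2)).congr_deriv ?_
        linear_combination (σ * d t / 2) * sin_sq_add_cos_sq (θ t)
      · exact mul_nonneg (sq_nonneg _) (sub_nonneg.2 (hdκ t))
    have hσ1 : |σ| = 1 := by
      rw [← sq_abs] at hσ
      nlinarith [abs_nonneg σ]
    have hsc : ∀ t, |σ * (sin (θ t) * cos (θ t))| ≤ 1 := fun t => by
      rw [abs_mul, hσ1, one_mul, abs_mul]
      exact mul_le_one₀ (abs_sin_le_one _) (abs_nonneg _) (abs_cos_le_one _)
    -- The bound allows `σ θ` to advance by at most `2 √κ |B| + 2`, the last term coming from `sin θ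
    -- cos θ` at the two ends. This time makes it advance by at least `2 √κ |B| + 4`.
    set T := 2 * (√κ * |B| + 2) / w
    have hT : w * T = 2 * (√κ * |B| + 2) := mul_div_cancel₀ _ hw.ne'
    have hT0 : 0 ≤ T := by positivity
    have h2 := hF hT0
    have h3 := hθ hT0
    simp only [cosEnergy_zero, mul_zero, sub_zero, hT] at h2 h3
    have h4 := mul_le_mul_of_nonneg_left ((hB T hT0).trans (le_abs_self B)) (sqrt_nonneg κ)
    have h5 := abs_le.1 (hsc 0)
    have h6 := abs_le.1 (hsc T)
    nlinarith

/-- On the separatrix, `σ sin θ` tends to `1` if it does not start at `-1`. -/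
theorem exists_sin_ge (h : IsPend θ d) {σ : ℝ} (hσ : σ ^ 2 = 1)
    (hd : ∀ t, σ * (cos (θ t) * d t) = cos (θ t) ^ 2) (h0 : -1 < σ * sin (θ 0)) {ε : ℝ}
    (hε : 0 < ε) : ∃ S, 0 ≤ S ∧ 1 - ε ≤ σ * sin (θ S) := by
  by_contra! hcon
  have hf : ∀ t, HasDerivAt (fun t => σ * sin (θ t)) (cos (θ t) ^ 2) t := fun t =>
    ((h.deriv_sin t).const_mul σ).congr_deriv (hd t)
  have hmono : Monotone fun t => σ * sin (θ t) :=
    monotone_of_hasDerivAt_nonneg hf fun t => sq_nonneg _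
  set f0 := σ * sin (θ 0) with hf0
  have hf1 : f0 < 1 - ε := hcon 0 le_rfl
  -- While `σ sin θ` stays below `1 - ε`, the product `(1 + σ sin θ) (1 - σ sin θ) = cos² θ` is at
  -- least `η`. Then `σ sin θ` gains at least `2` by time `2 / η`.
  set η := (1 + f0) * ε with hη
  have hη0 : 0 < η := mul_pos (by linarith) hε
  have hcos : ∀ t, 0 ≤ t → η ≤ cos (θ t) ^ 2 := fun t ht => by
    have h1 := hcon t ht
    have h2 : f0 ≤ σ * sin (θ t) := hmono ht
    have h3 : cos (θ t) ^ 2 = (1 + σ * sin (θ t)) * (1 - σ * sin (θ t)) := by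
      linear_combination sin_sq_add_cos_sq (θ t) + sin (θ t) ^ 2 * hσ
    rw [h3]
    exact mul_le_mul (by linarith) (by linarith) hε.le (by linarith)
  have hlin : MonotoneOn (fun t => σ * sin (θ t) - η * t) (Ici 0) := by
    have hder : ∀ t, HasDerivAt (fun t => σ * sin (θ t) - η * t) (cos (θ t) ^ 2 - η) t := fun t =>
      (hf t).sub (by simpa using (hasDerivAt_id t).const_mul η)
    refine monotoneOn_of_deriv_nonneg (convex_Ici 0)
      (fun t _ => (hder t).continuousAt.continuousWithinAt)
      (fun t _ => (hder t).differentiableAt.differentiableWithinAt) fun t ht => ?_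
    rw [interior_Ici] at ht
    rw [(hder t).deriv]
    exact sub_nonneg.2 (hcos t (le_of_lt ht))
  have hT0 : (0 : ℝ) ≤ 2 / η := by positivity
  have h4 := hlin (self_mem_Ici) (mem_Ici.2 hT0) hT0
  have h5 := hcon _ hT0
  simp only [mul_zero, sub_zero, mul_div_cancel₀ (2 : ℝ) hη0.ne'] at h4
  linarith

end IsPend

/-- If the tail of the integral of `cos² θ` is small, then `z` grows linearly. -/
theorem IsGeod.abs_z_ge {θ d x y z : ℝ → ℝ} (h : IsGeod θ d x y z)
    (hκ : sin (θ 0) ^ 2 + d 0 ^ 2 ≤ 4) {S T : ℝ} (hS : 0 ≤ S) (hST : S ≤ T)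
    (hcS : cos (θ S) ^ 2 ≤ 1 / 50) (hL : cosEnergy θ T - cosEnergy θ S ≤ 1 / 100) :
    (T - S) / 2 - S ≤ |z T| := by
  have hd : ∀ t, |d t| ≤ 2 := fun t => by
    have := h.energy_eq t 0
    exact abs_le_of_sq_le_sq (by nlinarith [sq_nonneg (sin (θ t))]) (by norm_num)
  have hsd : ∀ t, |sin (θ t) * d t| ≤ 2 := fun t => by
    rw [abs_mul]
    nlinarith [abs_sin_le_one (θ t), abs_nonneg (sin (θ t)), abs_nonneg (d t), hd t]
  -- The derivative of `cos³ θ` is at most `6 cos² θ` in size, so a small tail controls `cos θ`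
  -- pointwise: `1 / 50 + 6 / 100 < (1 / 2) ^ 3`. Hence `|sin θ| ≥ 1 / 2` with a fixed sign on `[S,
  -- T]`.
  have hcube : ∀ σ : ℝ, |σ| = 1 →
      Antitone fun t => σ * cos (θ t) ^ 3 - 6 * cosEnergy θ t := fun σ hσ => by
    refine antitone_of_hasDerivAt_nonpos (f' := fun t =>
      cos (θ t) ^ 2 * (3 * (σ * -(sin (θ t) * d t)) - 6)) (fun t => ?_) fun t => ?_
    · refine ((((h.deriv_cos t).pow 3).const_mul σ).sub
        ((h.hasDerivAt_cosEnergy t).const_mul 6)).congr_deriv ?_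
      push_cast
      ring
    · refine mul_nonpos_of_nonneg_of_nonpos (sq_nonneg _) ?_
      have := le_abs_self (σ * -(sin (θ t) * d t))
      rw [abs_mul, hσ, one_mul, abs_neg] at this
      linarith [hsd t]
  have hcS3 : |cos (θ S) ^ 3| ≤ 1 / 50 := by
    rw [abs_pow, pow_succ, sq_abs]
    nlinarith [abs_cos_le_one (θ S), abs_nonneg (cos (θ S)), sq_nonneg (cos (θ S))]
  have hcos : ∀ r ∈ Icc S T, |cos (θ r)| ≤ 1 / 2 := fun r hr => by
    have h1 := hcube 1 (by simp) hr.1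
    have h2 := hcube (-1) (by simp) hr.1
    dsimp only at h1 h2
    have h3 := h.cosEnergy_mono hr.2
    have h4 := abs_le.1 hcS3
    have h5 : |cos (θ r) ^ 3| ≤ (1 / 2) ^ 3 := abs_le.2 ⟨by norm_num; linarith, by norm_num; linarith⟩
    rw [abs_pow] at h5
    exact (pow_le_pow_iff_left₀ (abs_nonneg _) (by norm_num) (by norm_num)).1 h5
  have hsin : ∀ r ∈ Icc S T, 1 / 2 ≤ |sin (θ r)| := fun r hr => by
    have h1 := hcos r hr
    have h2 := sin_sq_add_cos_sq (θ r)
    rw [← sq_abs (sin _), ← sq_abs (cos _)] at h2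
    by_contra hcon
    nlinarith [abs_nonneg (sin (θ r)), abs_nonneg (cos (θ r))]
  have hsc : Continuous fun r => sin (θ r) := by have := h.continuous_angle; fun_prop
  have hne : ∀ r ∈ Icc S T, sin (θ r) ≠ 0 := fun r hr h0 => by
    have := hsin r hr
    rw [h0, abs_zero] at this
    linarith
  have hzS := h.abs_z_le hS
  have hgrow : (T - S) / 2 ≤ |z T - z S| := by
    obtain ⟨σ, hσ, hpos⟩ : ∃ σ : ℝ, |σ| = 1 ∧ ∀ r ∈ Icc S T, 1 / 2 ≤ σ * sin (θ r) := by
      rcases lt_or_gt_of_ne (hne S ⟨le_rfl, hST⟩) with h0 | h0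
      · refine ⟨-1, by simp, fun r hr => ?_⟩
        have : sin (θ r) < 0 := by
          by_contra hcon
          obtain ⟨u, hu, hu0⟩ := intermediate_value_Icc hr.1 hsc.continuousOn
            ⟨h0.le, not_lt.1 hcon⟩
          exact hne u ⟨hu.1, hu.2.trans hr.2⟩ hu0
        have h3 := hsin r hr
        rw [abs_of_neg this] at h3
        linarith
      · refine ⟨1, by simp, fun r hr => ?_⟩
        have : 0 < sin (θ r) := by
          by_contra hcon
          obtain ⟨u, hu, hu0⟩ := intermediate_value_Icc' hr.1 hsc.continuousOn
            ⟨not_lt.1 hcon, h0.le⟩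
          exact hne u ⟨hu.1, hu.2.trans hr.2⟩ hu0
        have h3 := hsin r hr
        rw [abs_of_pos this] at h3
        linarith
    have hder : ∀ r, HasDerivAt (fun r => σ * z r - 1 / 2 * r) (σ * sin (θ r) - 1 / 2) r :=
      fun r => ((h.deriv_z r).const_mul σ).sub
        (((hasDerivAt_id r).const_mul (1 / 2 : ℝ)).congr_deriv (mul_one _))
    have hm : MonotoneOn (fun r => σ * z r - 1 / 2 * r) (Icc S T) := by
      refine monotoneOn_of_deriv_nonneg (convex_Icc _ _)
        (fun t _ => (hder t).continuousAt.continuousWithinAt)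
        (fun t _ => (hder t).differentiableAt.differentiableWithinAt) fun t ht => ?_
      rw [(hder t).deriv]
      exact sub_nonneg.2 (hpos t (interior_subset ht))
    have h1 := hm (left_mem_Icc.2 hST) (right_mem_Icc.2 hST) hST
    dsimp only at h1
    have h2 := le_abs_self (σ * (z T - z S))
    rw [abs_mul, hσ, one_mul] at h2
    linarith
  have := abs_sub (z T) (z S)
  linarith

theorem cosEnergy_ang_eq (p : ℝ × ℝ) (t : ℝ) :
    cosEnergy (ang p) t = cos (p.1 / 2) * ex p t - p.2 / 2 * ey p t := by
  rw [← (isGeod p).momentum_eq, ang_zero, spd_zero]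

theorem continuous_cosEnergy_ang (t : ℝ) : Continuous fun p : ℝ × ℝ => cosEnergy (ang p) t := by
  simp only [cosEnergy_ang_eq]
  have h1 : Continuous fun p : ℝ × ℝ => ex p t :=
    continuous_ex.comp (f := fun p : ℝ × ℝ => (p, t)) (by fun_prop)
  have h2 : Continuous fun p : ℝ × ℝ => ey p t :=
    continuous_ey.comp (f := fun p : ℝ × ℝ => (p, t)) (by fun_prop)
  fun_prop

/-- Bounded endpoints bound the integral of `cos² θ` through `momentum_eq`, so the limit covector
lies on the separatrix level. Near it a combination of the momenta makes the tail of that integral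
small along the approximating trajectories, and `abs_z_ge` forces `z` out of its bound. -/
theorem time_not_tendsto_atTop {p : ℕ → ℝ × ℝ} {p₀ : ℝ × ℝ} (hp : Tendsto p atTop (𝓝 p₀))
    {t : ℕ → ℝ} (ht : Tendsto t atTop atTop) {R : ℝ} (hx : ∀ k, |ex (p k) (t k)| ≤ R)
    (hy : ∀ k, |ey (p k) (t k)| ≤ R) (hz : ∀ k, |ez (p k) (t k)| ≤ R) : False := by
  have hR : 0 ≤ R := (abs_nonneg _).trans (hx 0)
  have hLlim : ∀ S, Tendsto (fun k => cosEnergy (ang (p k)) S) atTop (𝓝 (cosEnergy (ang p₀) S)) :=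
    fun S => ((continuous_cosEnergy_ang S).tendsto p₀).comp hp
  have hp2 : Tendsto (fun k => (p k).2) atTop (𝓝 p₀.2) := (continuous_snd.tendsto p₀).comp hp
  have hp1 : Tendsto (fun k => (p k).1) atTop (𝓝 p₀.1) := (continuous_fst.tendsto p₀).comp hp
  have hκlim : Tendsto (fun k => kap (p k)) atTop (𝓝 (kap p₀)) := by
    have : Continuous kap := by unfold kap; fun_prop
    exact (this.tendsto p₀).comp hp
  have hone : kap p₀ = 1 := by
    rw [kap_eq p₀ 0]
    refine (isGeod p₀).energy_eq_one_of_cosEnergy_le (B := R + (|p₀.2| + 1) / 2 * R) fun S hS => ?_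
    refine le_of_tendsto (hLlim S) ?_
    filter_upwards [ht.eventually_ge_atTop S,
      hp2.abs.eventually (gt_mem_nhds (lt_add_one |p₀.2|))] with k hk1 hk2
    refine ((isGeod (p k)).cosEnergy_mono hk1).trans ?_
    rw [cosEnergy_ang_eq]
    have h1 : |cos ((p k).1 / 2) * ex (p k) (t k)| ≤ 1 * R := by
      rw [abs_mul]
      exact mul_le_mul (abs_cos_le_one _) (hx k) (abs_nonneg _) zero_le_one
    have h2 : |(p k).2 / 2 * ey (p k) (t k)| ≤ (|p₀.2| + 1) / 2 * R := by
      rw [abs_mul, abs_div, abs_two]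
      exact mul_le_mul (by linarith) (hy k) (abs_nonneg _) (by positivity)
    have h3 := le_abs_self (cos ((p k).1 / 2) * ex (p k) (t k))
    have h4 := neg_abs_le ((p k).2 / 2 * ey (p k) (t k))
    linarith
  have hg := isGeod p₀
  -- At an equilibrium both signs satisfy the second condition, and `σ = sin θ` is chosen to satisfy
  -- the third.
  obtain ⟨σ, hσ, hPd, hs0⟩ : ∃ σ : ℝ, σ ^ 2 = 1 ∧ cos (ang p₀ 0) = σ * spd p₀ 0 ∧
      -1 < σ * sin (ang p₀ 0) := by
    have h1 := kap_eq p₀ 0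
    rw [hone] at h1
    have h2 := sin_sq_add_cos_sq (ang p₀ 0)
    have h3 : cos (ang p₀ 0) ^ 2 = spd p₀ 0 ^ 2 := by linarith
    by_cases h4 : cos (ang p₀ 0) = 0
    · have h5 : spd p₀ 0 = 0 := by rw [h4] at h3; nlinarith
      rw [h4] at h2
      exact ⟨sin (ang p₀ 0), by linarith, by rw [h4, h5, mul_zero], by nlinarith⟩
    · have h6 : ∀ σ : ℝ, σ ^ 2 = 1 → -1 < σ * sin (ang p₀ 0) := fun σ hσ => by
        have h7 : 0 < cos (ang p₀ 0) ^ 2 := by positivity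
        have h8 : (σ * sin (ang p₀ 0)) ^ 2 < 1 := by rw [mul_pow, hσ]; linarith
        exact (abs_lt.1 (sq_lt_one_iff_abs_lt_one _ |>.1 h8)).1
      rcases sq_eq_sq_iff_eq_or_eq_neg.1 h3 with h5 | h5
      · exact ⟨1, by norm_num, by rw [one_mul, h5], h6 1 (by norm_num)⟩
      · exact ⟨-1, by norm_num, by rw [h5]; ring, h6 (-1) (by norm_num)⟩
  -- The factor `cos (ang q 0) - σ * spd q 0` vanishes at `p₀`. With `x` and `y` bounded, the right
  -- side tends to zero along the sequence, however large the times.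
  have hboost : ∀ (q : ℝ × ℝ) (r : ℝ), cosEnergy (ang q) r + σ * (sin (ang q 0) - sin (ang q r))
      = (cos (ang q 0) - σ * spd q 0) * (ex q r + σ * ey q r) := fun q r => by
    have h1 := (isGeod q).momentum_eq r
    have h2 := (isGeod q).boost_eq r
    linear_combination -h1 - σ * h2 + spd q 0 * ey q r * hσ
  have hlimid : ∀ r, cosEnergy (ang p₀) r = σ * (sin (ang p₀ r) - sin (ang p₀ 0)) := fun r => by
    have := hboost p₀ r
    rw [hPd] at this
    linarith
  have hcd : ∀ r, σ * (cos (ang p₀ r) * spd p₀ r) = cos (ang p₀ r) ^ 2 := fun r => by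
    have h1 := hg.cos_eq r
    have h2 := hg.speed_eq r
    have : cos (ang p₀ r) = σ * spd p₀ r := by
      rw [h1, h2, hPd]
      linear_combination (spd p₀ 0 * sinh (ez p₀ r)) * hσ
    rw [sq, this]
    ring
  -- The accuracy `1 / 200` makes both `cos² θ < 1 / 50` at `S` and the tail after `S` less than `1
  -- / 100`, as `abs_z_ge` requires.
  obtain ⟨S, hS0, hS⟩ := hg.exists_sin_ge hσ hcd hs0 (ε := 1 / 200) (by norm_num)
  have hσabs : |σ| = 1 := by
    rw [← sq_abs] at hσ
    nlinarith [abs_nonneg σ]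
  have hcSlim : cos (ang p₀ S) ^ 2 < 1 / 50 := by
    have h1 : cos (ang p₀ S) ^ 2 = 1 - (σ * sin (ang p₀ S)) ^ 2 := by
      rw [mul_pow, hσ]
      linarith [sin_sq_add_cos_sq (ang p₀ S)]
    rw [h1]
    nlinarith
  have hcontS : Continuous fun q : ℝ × ℝ => ang q S :=
    continuous_ang.comp (f := fun q : ℝ × ℝ => (q, S)) (by fun_prop)
  have hangS : Tendsto (fun k => cos (ang (p k) S) ^ 2) atTop (𝓝 (cos (ang p₀ S) ^ 2)) :=
    ((by fun_prop : Continuous fun q : ℝ × ℝ => cos (ang q S) ^ 2).tendsto p₀).comp hp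
  have hcoef : Tendsto (fun k => cos (ang (p k) 0) - σ * spd (p k) 0) atTop (𝓝 0) := by
    have hc : Continuous fun q : ℝ × ℝ => cos (ang q 0) - σ * spd q 0 := by
      simp only [ang_zero, spd_zero]
      fun_prop
    have := (hc.tendsto p₀).comp hp
    rwa [hPd, sub_self] at this
  have hrem : Tendsto (fun k => (cos (ang (p k) 0) - σ * spd (p k) 0) *
      (ex (p k) (t k) + σ * ey (p k) (t k))) atTop (𝓝 0) := by
    have hb : ∀ k, |(cos (ang (p k) 0) - σ * spd (p k) 0) * (ex (p k) (t k) + σ * ey (p k) (t k))|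
        ≤ |cos (ang (p k) 0) - σ * spd (p k) 0| * (2 * R) := fun k => by
      rw [abs_mul]
      refine mul_le_mul_of_nonneg_left ?_ (abs_nonneg _)
      have h1 := abs_add_le (ex (p k) (t k)) (σ * ey (p k) (t k))
      rw [abs_mul, hσabs, one_mul] at h1
      linarith [hx k, hy k]
    have h0 := hcoef.abs.mul_const (2 * R)
    rw [abs_zero, zero_mul] at h0
    exact squeeze_zero_norm hb h0
  have hsin0 : Tendsto (fun k => sin (ang (p k) 0)) atTop (𝓝 (sin (ang p₀ 0))) := by
    simp only [ang_zero]
    exact ((by fun_prop : Continuous fun q : ℝ × ℝ => sin (q.1 / 2)).tendsto p₀).comp hp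
  have htail : Tendsto (fun k => (cos (ang (p k) 0) - σ * spd (p k) 0) *
      (ex (p k) (t k) + σ * ey (p k) (t k)) - σ * sin (ang (p k) 0) - cosEnergy (ang (p k)) S)
      atTop (𝓝 (0 - σ * sin (ang p₀ 0) - cosEnergy (ang p₀) S)) :=
    (hrem.sub (hsin0.const_mul σ)).sub (hLlim S)
  have hlim2 : 0 - σ * sin (ang p₀ 0) - cosEnergy (ang p₀) S < -1 + 1 / 100 := by
    rw [hlimid]
    linarith
  obtain ⟨k, hk1, hk2, hk3, hk4, hk5⟩ := ((ht.eventually_ge_atTop (2 * (R + S) + S + 1)).and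
    ((hangS.eventually (gt_mem_nhds hcSlim)).and ((htail.eventually (gt_mem_nhds hlim2)).and
      ((hκlim.eventually (gt_mem_nhds (show kap p₀ < 4 by rw [hone]; norm_num))).and
        (ht.eventually_ge_atTop S))))).exists
  have hfin := (isGeod (p k)).abs_z_ge (by rw [← kap_eq]; exact hk4.le) hS0 hk5 hk2.le (by
    have h1 := hboost (p k) (t k)
    have h2 : σ * sin (ang (p k) (t k)) ≤ 1 := by
      have := le_abs_self (σ * sin (ang (p k) (t k)))
      rw [abs_mul, hσabs, one_mul] at this
      exact this.trans (abs_sin_le_one _)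
    linarith)
  linarith [hz k]

/-- Reflection of a trajectory in a top or bottom point of the oscillation. -/
theorem disp_eq_zero {p : ℝ × ℝ} {m : ℝ} (hm : sin (ang p m) = 0) (r : ℝ) : disp p m r = 0 := by
  have hg := isGeod p
  have key : ∀ {θ d : ℝ → ℝ}, IsPend θ d →
      IsPendulumSolution fun r => (2 * θ r, 2 * d r) := fun {θ d} hp r => by
    refine (((hp.deriv_angle r).const_mul 2).prodMk
      ((hp.deriv_speed r).const_mul 2)).congr_deriv ?_
    rw [sin_two_mul]
    refine Prod.ext rfl ?_
    dsimp only
    ring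
  have hs2 : ∀ u, sin (2 * ang p m - u) = -(cos (2 * ang p m) * sin u) := fun u => by
    rw [sin_sub, sin_two_mul, hm]; ring
  have hc2 : cos (2 * ang p m) = 1 := by
    rw [cos_two_mul]
    have := sin_sq_add_cos_sq (ang p m)
    rw [hm] at this
    linarith
  -- The point reflection of the trajectory about time `m` solves the same equation with the same
  -- data at `m`, so `sin θ` is odd about `m`.
  have hrefl : IsPend (fun r => 2 * ang p m - ang p (m - r)) fun r => spd p (m - r) := by
    refine ⟨fun r => ?_, fun r => ?_⟩
    · exact (((hg.deriv_angle (m - r)).comp_const_sub m r).const_sub _).congr_deriv (neg_neg _)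
    · refine ((hg.deriv_speed (m - r)).comp_const_sub m r).congr_deriv ?_
      rw [hs2, cos_sub, hc2, sin_two_mul, hm]
      ring
  have e1 := pendulumFlow_eq (p := (2 * ang p m, 2 * spd p m)) (by simp) (key (hg.comp_add m))
  have e2 := pendulumFlow_eq (p := (2 * ang p m, 2 * spd p m))
    (by simp; ring) (key hrefl)
  have hθ : ∀ r, ang p (m + r) = 2 * ang p m - ang p (m - r) := fun r => by
    have := congrArg Prod.fst (congrFun (e1.symm.trans e2) r)
    simp only at this
    linarith
  refine (eq_of_hasDerivAt_zero (f := disp p m) (fun r => ?_) r 0).trans (by simp [disp])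
  refine (hg.hasDerivAt_displacement m r).congr_deriv ?_
  rw [hθ, hs2, hc2]
  ring

theorem continuous_disp : Continuous fun a : ((ℝ × ℝ) × ℝ) × ℝ => disp a.1.1 a.1.2 a.2 := by
  have h1 : Continuous fun a : ((ℝ × ℝ) × ℝ) × ℝ => ez a.1.1 (a.1.2 + a.2) :=
    continuous_ez.comp (f := fun a : ((ℝ × ℝ) × ℝ) × ℝ => (a.1.1, a.1.2 + a.2)) (by fun_prop)
  have h2 : Continuous fun a : ((ℝ × ℝ) × ℝ) × ℝ => ez a.1.1 (a.1.2 - a.2) :=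
    continuous_ez.comp (f := fun a : ((ℝ × ℝ) × ℝ) × ℝ => (a.1.1, a.1.2 - a.2)) (by fun_prop)
  exact h1.sub h2

/-- Each way of leaving the domain contradicts `z > 0` or the limit of the displacement
inequalities: `z` vanishes at time zero, when `sin θ` vanishes at the middle time, and at the full
period; beyond that period some shorter displacement is negative. -/
theorem proj_mem_D₁_of_tendsto {a : ℕ → (ℝ × ℝ) × ℝ} {b : (ℝ × ℝ) × ℝ}
    (ha : Tendsto a atTop (𝓝 b)) (hD : ∀ n, proj (a n) ∈ D₁) (hz : 0 < ez b.1 b.2) :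
    proj b ∈ D₁ := by
  have h2 : Tendsto (fun n => (a n).2) atTop (𝓝 b.2) := (continuous_snd.tendsto b).comp ha
  have hmem := fun n => coe_mem_D₁_iff_disp.1 (hD n)
  have ht : 0 < b.2 := by
    refine lt_of_le_of_ne (ge_of_tendsto' h2 fun n => (hmem n).1.le) fun h0 => ?_
    rw [← h0, (isGeod b.1).z_zero] at hz
    exact lt_irrefl _ hz
  have hs : 0 < sin (ang b.1 (b.2 / 2)) := by
    have hc : Continuous fun a : (ℝ × ℝ) × ℝ => sin (ang a.1 (a.2 / 2)) :=
      continuous_sin.comp (continuous_ang.comp (f := fun a : (ℝ × ℝ) × ℝ => (a.1, a.2 / 2))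
        (by fun_prop))
    refine lt_of_le_of_ne (ge_of_tendsto' ((hc.tendsto b).comp ha) fun n => (hmem n).2.1.le)
      fun h0 => ?_
    rw [ez_eq_disp, disp_eq_zero h0.symm] at hz
    exact lt_irrefl _ hz
  have hdisp : ∀ r, 0 < r → r < b.2 / 2 → 0 ≤ disp b.1 (b.2 / 2) r := fun r hr0 hr1 => by
    have hc : Continuous fun a : (ℝ × ℝ) × ℝ => disp a.1 (a.2 / 2) r :=
      continuous_disp.comp (f := fun a : (ℝ × ℝ) × ℝ => ((a.1, a.2 / 2), r)) (by fun_prop)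
    refine ge_of_tendsto ((hc.tendsto b).comp ha) ?_
    filter_upwards [h2.eventually (lt_mem_nhds (show 2 * r < b.2 by linarith))] with n hn
    exact ((hmem n).2.2 r hr0 (by linarith)).le
  refine coe_mem_D₁_iff.2 ⟨ht, hs, fun h1 => ?_⟩
  have hosc := isOscillation_ang (kap_pos_of_sin_ne_zero hs.ne') h1
  obtain ⟨-, hH, ε, hε, hneg⟩ := (isGeod b.1).displacement_pos_of_oscillation hosc hs
  by_contra! hcon
  rcases hcon.eq_or_lt with heq | hlt
  · rw [ez_eq_disp, ← heq, mul_div_cancel_left₀ _ two_ne_zero, disp] at hz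
    rw [← heq, mul_div_cancel_left₀ _ two_ne_zero] at hH
    linarith
  · obtain ⟨r, hr1, hr2⟩ := exists_between (lt_min (lt_add_of_pos_right (halfPeriod (kap b.1)) hε)
      (show halfPeriod (kap b.1) < b.2 / 2 by linarith))
    have := hneg r hr1 (hr2.trans_le (min_le_left _ _))
    have := hdisp r (hosc.pos.trans hr1) (hr2.trans_le (min_le_right _ _))
    rw [disp] at this
    linarith

/-- This bounds the initial speed when `z` is bounded and bounded away from zero; it is `cos_eq`
with both cosines at most one in size. -/
theorem abs_spd_mul_sinh_le (p : ℝ × ℝ) (t : ℝ) :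
    |p.2 / 2 * sinh (ez p t)| ≤ 1 + cosh (ez p t) := by
  have h1 := (isGeod p).cos_eq t
  rw [ang_zero, spd_zero] at h1
  have h2 : p.2 / 2 * sinh (ez p t) = cos (p.1 / 2) * cosh (ez p t) - cos (ang p t) := by linarith
  rw [h2]
  refine (abs_sub _ _).trans ?_
  rw [abs_mul, abs_of_pos (cosh_pos _)]
  nlinarith [abs_cos_le_one (p.1 / 2), abs_cos_le_one (ang p t), cosh_pos (ez p t)]

/-- A preimage under `proj` whose angle lies in `[0, 4π)`. -/
theorem exists_proj_eq (ν : PhaseCylinder × ℝ) :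
    ∃ a : (ℝ × ℝ) × ℝ, proj a = ν ∧ a.1.1 ∈ Icc 0 (4 * π) := by
  have h := (AddCircle.equivIco (4 * π) 0 ν.1.1).2
  refine ⟨(((AddCircle.equivIco (4 * π) 0 ν.1.1 : ℝ), ν.1.2), ν.2), ?_, h.1, ?_⟩
  · exact Prod.ext (Prod.ext ((AddCircle.equivIco (4 * π) 0).symm_apply_apply ν.1.1) rfl) rfl
  · exact h.2.le.trans_eq (zero_add _)

/-- Sequential properness over `M₁`: the angle ranges over a compact interval, `abs_spd_mul_sinh_le`
bounds `c`, `time_not_tendsto_atTop` excludes infinite times, and `proj_mem_D₁_of_tendsto` keeps the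
limit inside. -/
theorem exists_tendsto_subseq {ν : ℕ → PhaseCylinder × ℝ} (hν : ∀ n, ν n ∈ D₁) {q : M}
    (hq : q ∈ M₁) (hlim : Tendsto (fun n => Exp (ν n)) atTop (𝓝 q)) :
    ∃ μ ∈ D₁, ∃ φ : ℕ → ℕ, StrictMono φ ∧ Tendsto (fun n => ν (φ n)) atTop (𝓝 μ) := by
  choose a ha hγ using fun n => exists_proj_eq (ν n)
  have hlim' : Tendsto (fun n => liftedExp (a n)) atTop (𝓝 q) := by
    simp only [← Exp_proj, ha]
    exact hlim
  obtain ⟨R, hR⟩ := (Metric.isBounded_range_of_tendsto _ hlim').exists_norm_le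
  have hb : ∀ n, |ex (a n).1 (a n).2| ≤ R ∧ |ey (a n).1 (a n).2| ≤ R ∧
      |ez (a n).1 (a n).2| ≤ R := fun n => by
    have h1 := hR _ (mem_range_self n)
    exact ⟨(norm_fst_le (liftedExp (a n))).trans h1,
      ((norm_fst_le (liftedExp (a n)).2).trans (norm_snd_le (liftedExp (a n)))).trans h1,
      ((norm_snd_le (liftedExp (a n)).2).trans (norm_snd_le (liftedExp (a n)))).trans h1⟩
  have hR0 : 0 ≤ R := (abs_nonneg _).trans (hb 0).1
  have hq0 : 0 < q.2.2 := hq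
  have hzlim : Tendsto (fun n => ez (a n).1 (a n).2) atTop (𝓝 q.2.2) :=
    ((continuous_snd.comp continuous_snd).tendsto q).comp hlim'
  set W := (1 + cosh R) / sinh (q.2.2 / 2) with hW
  have hsinh : 0 < sinh (q.2.2 / 2) := sinh_pos_iff.2 (by linarith)
  have hc : ∀ᶠ n in atTop, |(a n).1.2| ≤ 2 * W := by
    filter_upwards [hzlim.eventually (lt_mem_nhds (show q.2.2 / 2 < q.2.2 by linarith))] with n hn
    have h1 := abs_spd_mul_sinh_le (a n).1 (a n).2
    have h2 : cosh (ez (a n).1 (a n).2) ≤ cosh R := by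
      rw [cosh_le_cosh, abs_of_nonneg hR0]
      exact (hb n).2.2
    have h3 : sinh (q.2.2 / 2) ≤ sinh (ez (a n).1 (a n).2) := sinh_le_sinh.2 hn.le
    rw [abs_mul, abs_div, abs_two, abs_of_pos (hsinh.trans_le h3)] at h1
    have h4 : |(a n).1.2| / 2 * sinh (q.2.2 / 2) ≤ 1 + cosh R := by
      have := mul_le_mul_of_nonneg_left h3 (show 0 ≤ |(a n).1.2| / 2 by positivity)
      linarith
    have h5 := (le_div_iff₀ hsinh).2 h4
    linarith
  have hbox : ∀ᶠ n in atTop, (a n).1 ∈ Icc (0 : ℝ) (4 * π) ×ˢ Icc (-(2 * W)) (2 * W) := by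
    filter_upwards [hc] with n hn
    exact ⟨hγ n, abs_le.1 hn⟩
  have hcomp : IsCompact (Icc (0 : ℝ) (4 * π) ×ˢ Icc (-(2 * W)) (2 * W)) :=
    isCompact_Icc.prod isCompact_Icc
  by_cases hT : ∃ T, ∃ᶠ n in atTop, (a n).2 ≤ T
  · obtain ⟨T, hT⟩ := hT
    have hfreq : ∃ᶠ n in atTop,
        a n ∈ (Icc (0 : ℝ) (4 * π) ×ˢ Icc (-(2 * W)) (2 * W)) ×ˢ Icc 0 T := by
      refine (hT.and_eventually hbox).mono fun n hn => ⟨hn.2, ?_, hn.1⟩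
      have := hν n
      rw [← ha n] at this
      exact (coe_mem_D₁_iff.1 this).1.le
    obtain ⟨b, -, φ, hφ, hb⟩ := (hcomp.prod isCompact_Icc).tendsto_subseq' hfreq
    have hbq : liftedExp b = q :=
      tendsto_nhds_unique ((contDiff_liftedExp.continuous.tendsto b).comp hb)
        (hlim'.comp hφ.tendsto_atTop)
    refine ⟨proj b, proj_mem_D₁_of_tendsto hb (fun n => ?_) ?_, φ, hφ, ?_⟩
    · rw [Function.comp_apply, ha]
      exact hν _
    · change 0 < (liftedExp b).2.2
      rw [hbq]
      exact hq0
    · have := (continuous_proj.tendsto b).comp hb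
      simpa only [Function.comp_def, ha] using this
  · exfalso
    push Not at hT
    have hatTop : Tendsto (fun n => (a n).2) atTop atTop := tendsto_atTop.2 fun T =>
      (hT T).mono fun n hn => hn.le
    obtain ⟨p, -, φ, hφ, hp⟩ := hcomp.tendsto_subseq' hbox.frequently
    exact time_not_tendsto_atTop hp (hatTop.comp hφ.tendsto_atTop) (fun k => (hb (φ k)).1)
      (fun k => (hb (φ k)).2.1) fun k => (hb (φ k)).2.2

/-! ### Positivity of the Jacobian off the separatrix -/

namespace IsPend

variable {θ d : ℝ → ℝ} {k : ℝ}

/-- The derivative `cos θ * d` of `sin θ`. -/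
def slope (θ d : ℝ → ℝ) (r : ℝ) : ℝ := cos (θ r) * d r

theorem speed_sq (h : IsPend θ d) (hk : k ^ 2 = sin (θ 0) ^ 2 + d 0 ^ 2) (r : ℝ) :
    d r ^ 2 = k ^ 2 - sin (θ r) ^ 2 := by
  rw [hk, ← h.energy_eq r 0]
  ring

theorem slope_sq (h : IsPend θ d) (hk : k ^ 2 = sin (θ 0) ^ 2 + d 0 ^ 2) (r : ℝ) :
    slope θ d r ^ 2 = k ^ 2 - sin (θ r) ^ 2 * (1 + k ^ 2 - sin (θ r) ^ 2) := by
  rw [slope, mul_pow, h.speed_sq hk, cos_sq']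
  ring

theorem hasDerivAt_slope (h : IsPend θ d) (hk : k ^ 2 = sin (θ 0) ^ 2 + d 0 ^ 2) (r : ℝ) :
    HasDerivAt (slope θ d) (-(sin (θ r) * (1 + k ^ 2 - 2 * sin (θ r) ^ 2))) r := by
  refine ((h.deriv_cos r).mul (h.deriv_speed r)).congr_deriv ?_
  linear_combination -sin (θ r) * h.speed_sq hk r - sin (θ r) * sin_sq_add_cos_sq (θ r)

theorem abs_slope_lt (h : IsPend θ d) (hk : k ^ 2 = sin (θ 0) ^ 2 + d 0 ^ 2)
    (hk0 : 0 < k) {r : ℝ} (hr : sin (θ r) ≠ 0) : |slope θ d r| < k := by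
  refine abs_lt_of_sq_lt_sq ?_ hk0.le
  have h1 := h.slope_sq hk r
  have h2 := sin_sq_le_one (θ r)
  have h3 : 0 < sin (θ r) ^ 2 := by positivity
  nlinarith [mul_pos h3 (show 0 < 1 + k ^ 2 - sin (θ r) ^ 2 by nlinarith [pow_pos hk0 2])]

/-- `(slope + k) / sin θ`, continued to the zeros of `sin θ` with `slope = - k`, plus the half of
the integral of `cos² θ + d²`. -/
def barrier (θ d : ℝ → ℝ) (k r : ℝ) : ℝ :=
  sin (θ r) * (1 + k ^ 2 - sin (θ r) ^ 2) / (k - slope θ d r)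
    + (cosEnergy θ r - (1 - k ^ 2) * r / 2)

/-- The derivative is minus half a square, and the formula stays valid through zeros of `sin θ`
where the slope is `-k`. The parameter `k` may have either sign; both barriers are used. -/
theorem hasDerivAt_barrier (h : IsPend θ d) (hk : k ^ 2 = sin (θ 0) ^ 2 + d 0 ^ 2)
    (hk1 : k ^ 2 ≠ 1) {r : ℝ} (hr : slope θ d r ≠ k) :
    HasDerivAt (barrier θ d k)
      (-(((1 - k ^ 2) * sin (θ r) / (k * cos (θ r) - d r)) ^ 2 / 2)) r := by
  have hg : k - slope θ d r ≠ 0 := sub_ne_zero.2 hr.symm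
  have he := h.slope_sq hk r
  -- This removes `cos θ` and `d` from the denominator, leaving an identity in `sin θ`, the slope
  -- and `k`, valid modulo `he`.
  have hG : (k * cos (θ r) - d r) ^ 2
      = 2 * k * (k - slope θ d r) - sin (θ r) ^ 2 * (1 + k ^ 2) := by
    rw [slope]
    linear_combination h.speed_sq hk r + k ^ 2 * sin_sq_add_cos_sq (θ r)
  have hG0 : k * cos (θ r) - d r ≠ 0 := by
    intro h0
    have hd : d r = k * cos (θ r) := by linarith
    have h1 := h.speed_sq hk r
    rw [hd] at h1
    have h2 : sin (θ r) ^ 2 * (1 - k ^ 2) = 0 := by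
      linear_combination h1 - k ^ 2 * sin_sq_add_cos_sq (θ r)
    have h3 : sin (θ r) ^ 2 = 0 :=
      (mul_eq_zero.1 h2).resolve_right (sub_ne_zero.2 (Ne.symm hk1))
    refine hr ?_
    rw [slope, hd]
    linear_combination k * sin_sq_add_cos_sq (θ r) - k * h3
  have hn : HasDerivAt (fun r => sin (θ r) * (1 + k ^ 2 - sin (θ r) ^ 2))
      (slope θ d r * (1 + k ^ 2 - 3 * sin (θ r) ^ 2)) r := by
    refine ((h.deriv_sin r).mul (((h.deriv_sin r).pow 2).const_sub (1 + k ^ 2))).congr_deriv ?_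
    simp only [Pi.pow_apply, slope]
    push_cast
    ring
  have hlin : HasDerivAt (fun r : ℝ => (1 - k ^ 2) * r / 2) ((1 - k ^ 2) / 2) r := by
    simpa using ((hasDerivAt_id r).const_mul (1 - k ^ 2)).div_const 2
  refine ((hn.div ((h.hasDerivAt_slope hk r).const_sub k) hg).add
    ((h.hasDerivAt_cosEnergy r).sub hlin)).congr_deriv ?_
  have hG0' := pow_ne_zero 2 hG0
  rw [div_pow, cos_sq', hG]
  rw [hG] at hG0'
  clear hn hlin hG
  generalize slope θ d r = e at *
  generalize sin (θ r) = s at *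
  have key : (2 * (e * (1 + k ^ 2 - 3 * s ^ 2) * (k - e)
      - s ^ 2 * (1 + k ^ 2 - s ^ 2) * (1 + k ^ 2 - 2 * s ^ 2))
      + (k - e) ^ 2 * (2 * (1 - s ^ 2) - (1 - k ^ 2))) * (2 * k * (k - e) - s ^ 2 * (1 + k ^ 2))
      = -((k - e) ^ 2 * ((1 - k ^ 2) * s) ^ 2) := by
    linear_combination (2 * e * k ^ 3 + 2 * e * k - 8 * e * k * s ^ 2 - 2 * k ^ 4 + 2 * k ^ 4 * s ^ 2
      + 12 * k ^ 2 * s ^ 2 - 2 * k ^ 2 + 2 * s ^ 2 - 4 * k ^ 2 * s ^ 4 - 4 * s ^ 4) * he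
  generalize 2 * k * (k - e) - s ^ 2 * (1 + k ^ 2) = G at *
  field_simp
  linear_combination key

/-- The product `(k + slope) (k - slope)` equals `sin² θ (1 + k² - sin² θ)`, so the quotient in the
barrier is `(slope + k) / sin θ` in a form without poles at falling zeros when `k > 0`, or at rising
zeros when `k < 0`. -/
theorem sin_mul_barrier (h : IsPend θ d) (hk : k ^ 2 = sin (θ 0) ^ 2 + d 0 ^ 2) {r : ℝ}
    (hr : slope θ d r ≠ k) : sin (θ r) * barrier θ d k r
      = slope θ d r + k + sin (θ r) * (cosEnergy θ r - (1 - k ^ 2) * r / 2) := by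
  have hg : k - slope θ d r ≠ 0 := sub_ne_zero.2 hr.symm
  have he := h.slope_sq hk r
  rw [barrier, mul_add, ← mul_div_assoc,
    show sin (θ r) * (sin (θ r) * (1 + k ^ 2 - sin (θ r) ^ 2))
      = (slope θ d r + k) * (k - slope θ d r) by linear_combination he,
    mul_div_cancel_right₀ _ hg]

/-- The barrier decreases. -/
theorem strictAntiOn_barrier (h : IsPend θ d) (hk : k ^ 2 = sin (θ 0) ^ 2 + d 0 ^ 2)
    (hk1 : k ^ 2 ≠ 1) {a b : ℝ} (hr : ∀ r ∈ Icc a b, slope θ d r ≠ k)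
    (hs : ∀ r ∈ Ioo a b, sin (θ r) ≠ 0) : StrictAntiOn (barrier θ d k) (Icc a b) := by
  refine strictAntiOn_of_deriv_neg (convex_Icc _ _) (fun r hrm =>
    (h.hasDerivAt_barrier hk hk1 (hr r hrm)).continuousAt.continuousWithinAt) fun r hrm => ?_
  rw [interior_Icc] at hrm
  rw [(h.hasDerivAt_barrier hk hk1 (hr r (Ioo_subset_Icc_self hrm))).deriv]
  have h1 : k * cos (θ r) - d r ≠ 0 := by
    intro h0
    have hd : d r = k * cos (θ r) := by linarith
    have h1 := h.speed_sq hk r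
    rw [hd] at h1
    have h2 : sin (θ r) ^ 2 * (1 - k ^ 2) = 0 := by
      linear_combination h1 - k ^ 2 * sin_sq_add_cos_sq (θ r)
    exact mul_ne_zero (pow_ne_zero 2 (hs r hrm)) (sub_ne_zero.2 (Ne.symm hk1)) h2
  have h2 := hs r hrm
  have h3 := sub_ne_zero.2 (Ne.symm hk1)
  have : 0 < ((1 - k ^ 2) * sin (θ r) / (k * cos (θ r) - d r)) ^ 2 := by positivity
  linarith

end IsPend

/-- Strict Cauchy–Schwarz inequality for the derivatives `p ^ 2` and `q ^ 2` of `A` and `B`. -/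
theorem sq_lt_mul_of_hasDerivAt {A B p q : ℝ → ℝ} {c t : ℝ} (ht : 0 < t)
    (hA : ∀ r ∈ Icc 0 t, HasDerivAt A (p r ^ 2) r) (hB : ∀ r ∈ Icc 0 t, HasDerivAt B (q r ^ 2) r)
    (hpq : ∀ r ∈ Icc 0 t, p r * q r = c) (hBpos : 0 < B t - B 0)
    (hq : ∀ l, ∃ r ∈ Ioo 0 t, p r ≠ l * q r) :
    (c * t) ^ 2 < (A t - A 0) * (B t - B 0) := by
  by_contra! hcon
  -- This `l` minimizes the integral of `(p - l q)²`, which is the increment of `h` below. Failure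
  -- of strict inequality makes it nonpositive, hence `p = l q` throughout.
  set l := c * t / (B t - B 0) with hl
  have hlB : l * (B t - B 0) = c * t := div_mul_cancel₀ _ hBpos.ne'
  set h := fun r => A r - 2 * l * c * r + l ^ 2 * B r with hh
  have hder : ∀ r ∈ Icc 0 t, HasDerivAt h ((p r - l * q r) ^ 2) r := fun r hr => by
    refine (((hA r hr).sub ((hasDerivAt_id r).const_mul (2 * l * c))).add
      ((hB r hr).const_mul (l ^ 2))).congr_deriv ?_
    rw [← hpq r hr]
    ring
  have hmono : MonotoneOn h (Icc 0 t) := by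
    refine monotoneOn_of_deriv_nonneg (convex_Icc _ _)
      (fun r hr => (hder r hr).continuousAt.continuousWithinAt)
      (fun r hr => (hder r (interior_subset hr)).differentiableAt.differentiableWithinAt)
      fun r hr => ?_
    rw [(hder r (interior_subset hr)).deriv]
    exact sq_nonneg _
  have h0 : h t ≤ h 0 := by
    have h1 : (A t - A 0) * (B t - B 0) - 2 * l * (B t - B 0) * (c * t)
        + l ^ 2 * (B t - B 0) ^ 2 ≤ 0 := by
      rw [show l ^ 2 * (B t - B 0) ^ 2 = (l * (B t - B 0)) ^ 2 by ring,
        show 2 * l * (B t - B 0) * (c * t) = 2 * (l * (B t - B 0)) * (c * t) by ring, hlB]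
      linarith
    have h2 : (h t - h 0) * (B t - B 0) ≤ 0 := by
      refine le_of_eq_of_le ?_ h1
      simp only [hh]
      ring
    by_contra! hcon
    exact absurd (mul_pos (sub_pos.2 hcon) hBpos) (not_lt.2 h2)
  obtain ⟨r, hr, hne⟩ := hq l
  have hconst : ∀ u ∈ Icc 0 t, h u = h 0 := fun u hu =>
    le_antisymm ((hmono hu (right_mem_Icc.2 ht.le) hu.2).trans h0)
      (hmono (left_mem_Icc.2 ht.le) hu hu.1)
  have hev : h =ᶠ[𝓝 r] fun _ => h 0 := by
    filter_upwards [Icc_mem_nhds hr.1 hr.2] with u hu using hconst u hu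
  have h3 := (hder r (Ioo_subset_Icc_self hr)).unique
    ((hasDerivAt_const r (h 0)).congr_of_eventuallyEq hev)
  exact hne (sub_eq_zero.1 (pow_eq_zero_iff two_ne_zero |>.1 h3))

namespace IsPend

variable {θ d : ℝ → ℝ} {κ : ℝ}

/-- Both `cos² θ` and `d² = cos² θ - (1 - κ²)` have nonnegative integrals. -/
theorem half_energy_ge (h : IsPend θ d) (hk : κ ^ 2 = sin (θ 0) ^ 2 + d 0 ^ 2) {r : ℝ}
    (hr : 0 ≤ r) : |(1 - κ ^ 2) * r / 2| ≤ cosEnergy θ r - (1 - κ ^ 2) * r / 2 := by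
  have h1 := h.cosEnergy_mono hr
  have h2 : Monotone fun r => cosEnergy θ r - (1 - κ ^ 2) * r := by
    refine monotone_of_hasDerivAt_nonneg (f' := fun r => d r ^ 2) (fun r => ?_)
      fun r => sq_nonneg _
    refine ((h.hasDerivAt_cosEnergy r).sub
      ((hasDerivAt_id r).const_mul (1 - κ ^ 2))).congr_deriv ?_
    rw [h.speed_sq hk, cos_sq']
    ring
  have h3 := h2 hr
  simp only [cosEnergy_zero, mul_zero, sub_zero] at h1 h3
  exact abs_le.2 ⟨by linarith, by linarith⟩

/-- The Jacobian of the exponential mapping, up to a factor. -/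
def jac (θ d : ℝ → ℝ) (κ t : ℝ) : ℝ :=
  sin (θ 0) * sin (θ t) * (cosEnergy θ t * (cosEnergy θ t - (1 - κ ^ 2) * t)
      + sin (θ 0) ^ 2 + sin (θ t) ^ 2 - 2 * (1 + κ ^ 2))
    + (2 * cosEnergy θ t - (1 - κ ^ 2) * t)
      * (sin (θ 0) * slope θ d t - sin (θ t) * slope θ d 0)
    - 2 * slope θ d 0 * slope θ d t + 2 * κ ^ 2

/-- By `sin_mul_barrier` the two factors are `sin (θ 0) * sin (θ t)` times the increments of the
barriers for `κ` and `-κ`. The sign of `jac` thus becomes a comparison of their product with the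
square of `(1 - κ²) t / 2`. -/
theorem sin_mul_jac (h : IsPend θ d) (hk : κ ^ 2 = sin (θ 0) ^ 2 + d 0 ^ 2) (t : ℝ) :
    sin (θ 0) * sin (θ t) * jac θ d κ t =
      (sin (θ 0) * (slope θ d t + κ) - sin (θ t) * (slope θ d 0 + κ)
        + (cosEnergy θ t - (1 - κ ^ 2) * t / 2) * (sin (θ 0) * sin (θ t)))
      * (sin (θ 0) * (slope θ d t - κ) - sin (θ t) * (slope θ d 0 - κ)
        + (cosEnergy θ t - (1 - κ ^ 2) * t / 2) * (sin (θ 0) * sin (θ t)))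
      - (sin (θ 0) * sin (θ t) * ((1 - κ ^ 2) * t / 2)) ^ 2 := by
  have h0 := h.slope_sq hk 0
  have h1 := h.slope_sq hk t
  rw [jac]
  linear_combination -sin (θ t) ^ 2 * h0 - sin (θ 0) ^ 2 * h1

theorem mul_cos_sub_speed_ne_zero (h : IsPend θ d) (hk : κ ^ 2 = sin (θ 0) ^ 2 + d 0 ^ 2)
    (hk1 : κ ^ 2 ≠ 1) {r : ℝ} (hs : sin (θ r) ≠ 0) : κ * cos (θ r) - d r ≠ 0 := by
  intro h0
  have hd : d r = κ * cos (θ r) := by linarith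
  have h1 := h.speed_sq hk r
  rw [hd] at h1
  have h2 : sin (θ r) ^ 2 * (1 - κ ^ 2) = 0 := by
    linear_combination h1 - κ ^ 2 * sin_sq_add_cos_sq (θ r)
  exact mul_ne_zero (pow_ne_zero 2 hs) (sub_ne_zero.2 (Ne.symm hk1)) h2

/-- This supplies strictness in Cauchy–Schwarz. Proportionality would give a linear relation between
`cos θ` and `d`; together with its derivative it forces the separatrix level. -/
theorem exists_ne_mul (h : IsPend θ d) (hk : κ ^ 2 = sin (θ 0) ^ 2 + d 0 ^ 2) (hκ : κ ≠ 0)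
    (hk1 : κ ^ 2 ≠ 1) {t : ℝ} (ht : 0 < t) (hs : ∀ r ∈ Icc 0 t, sin (θ r) ≠ 0) (l : ℝ) :
    ∃ r ∈ Ioo 0 t, (1 - κ ^ 2) * sin (θ r) / (κ * cos (θ r) - d r)
      ≠ l * ((1 - (-κ) ^ 2) * sin (θ r) / (-κ * cos (θ r) - d r)) := by
  by_contra! hcon
  have hn := sub_ne_zero.2 (Ne.symm hk1)
  have hlin : ∀ r ∈ Ioo 0 t, κ * (1 + l) * cos (θ r) - (l - 1) * d r = 0 := fun r hr => by
    have h1 := hcon r hr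
    have h2 := h.mul_cos_sub_speed_ne_zero hk hk1 (hs r (Ioo_subset_Icc_self hr))
    have h3 := h.mul_cos_sub_speed_ne_zero (κ := -κ) (by rw [neg_sq, hk]) (by rwa [neg_sq])
      (hs r (Ioo_subset_Icc_self hr))
    rw [neg_sq, ← mul_div_assoc, div_eq_div_iff h2 h3] at h1
    refine (mul_eq_zero.1 (?_ : (1 - κ ^ 2) * sin (θ r) * _ = 0)).resolve_left
      (mul_ne_zero hn (hs r (Ioo_subset_Icc_self hr)))
    linear_combination -h1
  have hmid : t / 2 ∈ Ioo 0 t := ⟨by linarith, by linarith⟩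
  have hev : (fun r => κ * (1 + l) * cos (θ r) - (l - 1) * d r) =ᶠ[𝓝 (t / 2)] fun _ => 0 := by
    filter_upwards [Ioo_mem_nhds hmid.1 hmid.2] with r hr using hlin r hr
  have h1 := ((((h.deriv_cos (t / 2)).const_mul (κ * (1 + l))).sub
    ((h.deriv_speed (t / 2)).const_mul (l - 1)))).unique
    ((hasDerivAt_const (t / 2) (0 : ℝ)).congr_of_eventuallyEq hev)
  have h2 := hlin _ hmid
  have h3 := hs _ (Ioo_subset_Icc_self hmid)
  have h4 : κ * (1 + l) * d (t / 2) - (l - 1) * cos (θ (t / 2)) = 0 :=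
    (mul_eq_zero.1 (by linear_combination -h1 : sin (θ (t / 2)) * _ = 0)).resolve_left h3
  have h5 := h.speed_sq hk (t / 2)
  have h6 := sin_sq_add_cos_sq (θ (t / 2))
  have h7 : (l - 1) * (1 - κ ^ 2) = 0 := by
    linear_combination d (t / 2) * h2 - cos (θ (t / 2)) * h4 + (l - 1) * h5 - (l - 1) * h6
  have h8 : l = 1 := by
    have := (mul_eq_zero.1 h7).resolve_right hn
    linarith
  rw [h8] at h2 h4
  have hκ2 : κ * (1 + 1) ≠ 0 := by positivity
  have hc : cos (θ (t / 2)) = 0 := (mul_eq_zero.1 (by linarith : κ * (1 + 1) * _ = 0)).resolve_left hκ2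
  have hd : d (t / 2) = 0 := (mul_eq_zero.1 (by linarith : κ * (1 + 1) * _ = 0)).resolve_left hκ2
  rw [hc] at h6
  rw [hd] at h5
  exact hk1 (by linarith)

/-- The square roots of minus twice the barrier derivatives have the constant product `-(1 - κ²)`,
so strict Cauchy–Schwarz bounds the product of the increments below by `((1 - κ²) t / 2)²`. -/
theorem jac_pos_of_sin_pos (h : IsPend θ d) (hk : κ ^ 2 = sin (θ 0) ^ 2 + d 0 ^ 2) (hκ : 0 < κ)
    (hk1 : κ ^ 2 ≠ 1) {t : ℝ} (ht : 0 < t) (hs : ∀ r ∈ Icc 0 t, 0 < sin (θ r)) :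
    0 < jac θ d κ t := by
  have hk' : (-κ) ^ 2 = sin (θ 0) ^ 2 + d 0 ^ 2 := by rw [neg_sq, hk]
  have hk1' : (-κ) ^ 2 ≠ 1 := by rwa [neg_sq]
  have hsl : ∀ r ∈ Icc 0 t, |slope θ d r| < κ := fun r hr => h.abs_slope_lt hk hκ (hs r hr).ne'
  have hne : ∀ r ∈ Icc 0 t, slope θ d r ≠ κ := fun r hr => (abs_lt.1 (hsl r hr)).2.ne
  have hne' : ∀ r ∈ Icc 0 t, slope θ d r ≠ -κ := fun r hr => (abs_lt.1 (hsl r hr)).1.ne'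
  have h0 : (0 : ℝ) ∈ Icc 0 t := left_mem_Icc.2 ht.le
  have h1 : t ∈ Icc 0 t := right_mem_Icc.2 ht.le
  have hcs := sq_lt_mul_of_hasDerivAt (A := fun r => -2 * barrier θ d κ r)
    (B := fun r => -2 * barrier θ d (-κ) r) (c := -(1 - κ ^ 2)) ht
    (fun r hr => ((h.hasDerivAt_barrier hk hk1 (hne r hr)).const_mul (-2)).congr_deriv (by ring))
    (fun r hr => ((h.hasDerivAt_barrier hk' hk1' (hne' r hr)).const_mul (-2)).congr_deriv (by ring))
    (fun r hr => by
      have h2 := h.mul_cos_sub_speed_ne_zero hk hk1 (hs r hr).ne'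
      have h3 := h.mul_cos_sub_speed_ne_zero hk' hk1' (hs r hr).ne'
      rw [div_mul_div_comm, div_eq_iff (mul_ne_zero h2 h3)]
      linear_combination (1 - κ ^ 2) * h.speed_sq hk r
        - (1 - κ ^ 2) * κ ^ 2 * sin_sq_add_cos_sq (θ r))
    (by
      have := h.strictAntiOn_barrier hk' hk1' hne' (fun r hr => (hs r (Ioo_subset_Icc_self hr)).ne')
        h0 h1 ht
      linarith)
    (fun l => h.exists_ne_mul hk hκ.ne' hk1 ht (fun r hr => (hs r hr).ne') l)
  have hss : 0 < sin (θ 0) * sin (θ t) := mul_pos (hs 0 h0) (hs t h1)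
  refine pos_of_mul_pos_right (b := jac θ d κ t) (a := sin (θ 0) * sin (θ t)) ?_ hss.le
  rw [h.sin_mul_jac hk]
  have e1 := h.sin_mul_barrier hk (hne 0 h0)
  have e2 := h.sin_mul_barrier hk (hne t h1)
  have e3 := h.sin_mul_barrier hk' (hne' 0 h0)
  have e4 := h.sin_mul_barrier hk' (hne' t h1)
  rw [cosEnergy_zero] at e1 e3
  rw [neg_sq] at e3 e4
  have hX : sin (θ 0) * (slope θ d t + κ) - sin (θ t) * (slope θ d 0 + κ)
      + (cosEnergy θ t - (1 - κ ^ 2) * t / 2) * (sin (θ 0) * sin (θ t))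
      = sin (θ 0) * sin (θ t) * (barrier θ d κ t - barrier θ d κ 0) := by
    linear_combination sin (θ t) * e1 - sin (θ 0) * e2
  have hY : sin (θ 0) * (slope θ d t - κ) - sin (θ t) * (slope θ d 0 - κ)
      + (cosEnergy θ t - (1 - κ ^ 2) * t / 2) * (sin (θ 0) * sin (θ t))
      = sin (θ 0) * sin (θ t) * (barrier θ d (-κ) t - barrier θ d (-κ) 0) := by
    linear_combination sin (θ t) * e3 - sin (θ 0) * e4
  rw [hX, hY]
  have := mul_pos (pow_pos hss 2) (sub_pos.2 hcs)
  nlinarith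

theorem slope_eq_of_sin_pos_left (h : IsPend θ d) (hk : κ ^ 2 = sin (θ 0) ^ 2 + d 0 ^ 2)
    (hκ : 0 < κ) {a τ : ℝ} (ha : a < τ) (hτ : sin (θ τ) = 0)
    (hs : ∀ r, a < r → r < τ → 0 < sin (θ r)) : slope θ d τ = -κ := by
  have h1 := (hasDerivWithinAt_iff_tendsto_slope' (s := Iio τ) (by simp)).1
    (h.deriv_sin τ).hasDerivWithinAt
  have h2 : slope θ d τ ≤ 0 := by
    refine le_of_tendsto h1 ?_
    filter_upwards [Ioo_mem_nhdsLT ha] with r hr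
    rw [slope_def_field, hτ, sub_zero]
    exact (div_neg_of_pos_of_neg (hs r hr.1 hr.2) (by linarith [hr.2])).le
  have h3 := h.slope_sq hk τ
  rw [hτ] at h3
  rcases sq_eq_sq_iff_eq_or_eq_neg.1 (by linarith : slope θ d τ ^ 2 = κ ^ 2) with h4 | h4
  · linarith
  · exact h4

theorem slope_add_half (h : IsPend θ d) {H : ℝ} (hH : IsOscillation (fun t => sin (θ t)) H) (r : ℝ) :
    slope θ d (r + H) = -slope θ d r := by
  have h1 := (h.deriv_sin (r + H)).comp_add_const r H
  have h2 : (fun x => sin (θ (x + H))) = fun x => -sin (θ x) := funext hH.add_half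
  rw [h2] at h1
  exact h1.unique (h.deriv_sin r).neg

/-- Over a full period each barrier increases by exactly `E`, since `sin θ` and the slope return.
Each decreases from `t` to `2 H`, so its increment up to `t` is at least `E`, and `E² ≥ ((1 - κ²)
H)²` exceeds the square to be beaten. -/
theorem jac_pos_of_sin_neg (h : IsPend θ d) (hk : κ ^ 2 = sin (θ 0) ^ 2 + d 0 ^ 2) (hκ : 0 < κ)
    (hk1 : κ ^ 2 ≠ 1) {H : ℝ} (hH : IsOscillation (fun t => sin (θ t)) H) {t : ℝ} (ht : 0 < t)
    (htH : t < 2 * H) (hs0 : sin (θ 0) < 0) (hneg : ∀ r ∈ Icc t (2 * H), sin (θ r) < 0) :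
    0 < jac θ d κ t := by
  have hk' : (-κ) ^ 2 = sin (θ 0) ^ 2 + d 0 ^ 2 := by rw [neg_sq, hk]
  have hadd : ∀ r, sin (θ (r + H)) = -sin (θ r) := hH.add_half
  have hsl : ∀ r, sin (θ r) ≠ 0 → |slope θ d r| < κ := fun r hr => h.abs_slope_lt hk hκ hr
  set m := cosEnergy θ t - (1 - κ ^ 2) * t / 2 with hm
  have hsJ := h.sin_mul_jac hk t
  rw [← hm] at hsJ
  have hst : sin (θ t) < 0 := hneg t (left_mem_Icc.2 htH.le)
  have hss : 0 < sin (θ 0) * sin (θ t) := mul_pos_of_neg_of_neg hs0 hst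
  have hper : sin (θ (2 * H)) = sin (θ 0) := by
    have h1 := hadd 0
    have h2 := hadd (0 + H)
    rw [h1, show (0 : ℝ) + H + H = 2 * H by ring] at h2
    linarith
  have hperd : slope θ d (2 * H) = slope θ d 0 := by
    have h1 := h.slope_add_half hH 0
    have h2 := h.slope_add_half hH (0 + H)
    rw [h1, show (0 : ℝ) + H + H = 2 * H by ring] at h2
    linarith
  set E := cosEnergy θ (2 * H) - (1 - κ ^ 2) * (2 * H) / 2 with hE
  have hEn : |(1 - κ ^ 2) * (2 * H) / 2| ≤ E := h.half_energy_ge hk (by linarith)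
  have key : ∀ k : ℝ, k ^ 2 = κ ^ 2 → (∀ r, sin (θ r) ≠ 0 → slope θ d r ≠ k) →
      E ≤ barrier θ d k t - barrier θ d k 0 := fun k hkk hr => by
    have h1 := (h.strictAntiOn_barrier (hkk.trans hk) (hkk.trans_ne hk1)
      (fun r hrm => hr r (hneg r hrm).ne)
      (fun r hrm => (hneg r (Ioo_subset_Icc_self hrm)).ne)).antitoneOn
      (left_mem_Icc.2 htH.le) (right_mem_Icc.2 htH.le) htH.le
    have h2 := h.sin_mul_barrier (hkk.trans hk) (hr _ (hneg _ (right_mem_Icc.2 htH.le)).ne)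
    have h3 := h.sin_mul_barrier (hkk.trans hk) (hr _ hs0.ne)
    rw [hper, hperd, hkk, ← hE] at h2
    rw [cosEnergy_zero] at h3
    have h4 : sin (θ 0) * (barrier θ d k (2 * H) - barrier θ d k 0 - E) = 0 := by linarith
    have := (mul_eq_zero.1 h4).resolve_left hs0.ne
    linarith
  have hU := key κ rfl fun r hr => (abs_lt.1 (hsl r hr)).2.ne
  have hV := key (-κ) (neg_sq κ) fun r hr => (abs_lt.1 (hsl r hr)).1.ne'
  have e0 := h.sin_mul_barrier hk (abs_lt.1 (hsl 0 hs0.ne)).2.ne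
  have et := h.sin_mul_barrier hk (abs_lt.1 (hsl t hst.ne)).2.ne
  have e0' := h.sin_mul_barrier hk' (abs_lt.1 (hsl 0 hs0.ne)).1.ne'
  have et' := h.sin_mul_barrier hk' (abs_lt.1 (hsl t hst.ne)).1.ne'
  rw [cosEnergy_zero] at e0
  rw [neg_sq, cosEnergy_zero] at e0'
  rw [← hm] at et
  rw [neg_sq, ← hm] at et'
  have hX : sin (θ 0) * (slope θ d t + κ) - sin (θ t) * (slope θ d 0 + κ)
      + m * (sin (θ 0) * sin (θ t))
      = sin (θ 0) * sin (θ t) * (barrier θ d κ t - barrier θ d κ 0) := by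
    linear_combination sin (θ t) * e0 - sin (θ 0) * et
  have hY : sin (θ 0) * (slope θ d t - κ) - sin (θ t) * (slope θ d 0 - κ)
      + m * (sin (θ 0) * sin (θ t))
      = sin (θ 0) * sin (θ t) * (barrier θ d (-κ) t - barrier θ d (-κ) 0) := by
    linear_combination sin (θ t) * e0' - sin (θ 0) * et'
  rw [hX, hY] at hsJ
  set U := barrier θ d κ t - barrier θ d κ 0
  set V := barrier θ d (-κ) t - barrier θ d (-κ) 0
  have hE0 : 0 ≤ E := (abs_nonneg _).trans hEn
  have hUV : E ^ 2 ≤ U * V := by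
    rw [sq]
    exact mul_le_mul hU hV hE0 (hE0.trans hU)
  have hE2 : ((1 - κ ^ 2) * (2 * H) / 2) ^ 2 ≤ E ^ 2 := sq_le_sq' (by
    have := neg_abs_le ((1 - κ ^ 2) * (2 * H) / 2); linarith)
    ((le_abs_self _).trans hEn)
  have hn : 0 < (1 - κ ^ 2) ^ 2 := by
    have := sub_ne_zero.2 (Ne.symm hk1)
    positivity
  have hlt : ((1 - κ ^ 2) * t / 2) ^ 2 < ((1 - κ ^ 2) * (2 * H) / 2) ^ 2 := by
    have h1 : t ^ 2 < (2 * H) ^ 2 := pow_lt_pow_left₀ htH ht.le two_ne_zero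
    have := mul_lt_mul_of_pos_left h1 hn
    nlinarith
  refine pos_of_mul_pos_right (a := sin (θ 0) * sin (θ t)) ?_ hss.le
  rw [hsJ]
  have := mul_pos (pow_pos hss 2) (show 0 < U * V - ((1 - κ ^ 2) * t / 2) ^ 2 by linarith)
  linarith

/-- The middle time lies in a positive arch `(τ - H, τ)`, so each end lies in that arch, at one of
its ends, or in the adjacent negative arch. Equal signs use the two preceding lemmas, opposite signs
the monotonicity of one barrier, and zeros a direct evaluation. -/
theorem jac_pos (h : IsPend θ d) (hk : κ ^ 2 = sin (θ 0) ^ 2 + d 0 ^ 2) (hκ : 0 < κ)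
    (hk1 : κ ^ 2 ≠ 1) {H : ℝ} (hH : IsOscillation (fun t => sin (θ t)) H) {t : ℝ} (ht : 0 < t)
    (htH : t < 2 * H) (hmid : 0 < sin (θ (t / 2))) : 0 < jac θ d κ t := by
  have hk' : (-κ) ^ 2 = sin (θ 0) ^ 2 + d 0 ^ 2 := by rw [neg_sq, hk]
  have hk1' : (-κ) ^ 2 ≠ 1 := by rwa [neg_sq]
  obtain ⟨τ, hτ1, hτ2, hτ0, hpos, -⟩ := hH.exists_zero _ hmid
  have hHp := hH.pos
  have hadd : ∀ r, sin (θ (r + H)) = -sin (θ r) := hH.add_half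
  have hneg1 : ∀ r, τ < r → r < τ + H → sin (θ r) < 0 := fun r h1 h2 => by
    have h3 := hadd (r - H)
    rw [sub_add_cancel] at h3
    have := hpos (r - H) (by linarith) (by linarith)
    linarith
  have hneg2 : ∀ r, τ - 2 * H < r → r < τ - H → sin (θ r) < 0 := fun r h1 h2 => by
    have h3 := hadd r
    have := hpos (r + H) (by linarith) (by linarith)
    linarith
  have heτ : slope θ d τ = -κ := h.slope_eq_of_sin_pos_left hk hκ (by linarith) hτ0 hpos
  have heτH : slope θ d (τ - H) = κ := by
    have := h.slope_add_half hH (τ - H)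
    rw [sub_add_cancel, heτ] at this
    linarith
  have hsτH : sin (θ (τ - H)) = 0 := by
    have := hadd (τ - H)
    rw [sub_add_cancel, hτ0] at this
    linarith
  have hsl : ∀ r, sin (θ r) ≠ 0 → |slope θ d r| < κ := fun r hr => h.abs_slope_lt hk hκ hr
  set m := cosEnergy θ t - (1 - κ ^ 2) * t / 2 with hm
  have hm0 : 0 ≤ m := (abs_nonneg _).trans (h.half_energy_ge hk ht.le)
  -- The slope is `κ` at the rising zero `τ - H` and `-κ` at the falling zero `τ`. Each barrier is
  -- thus regular across one end of the positive arch.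
  have hreg : ∀ r, τ - H < r → r < τ + H → slope θ d r ≠ κ := fun r h1 h2 => by
    rcases lt_trichotomy r τ with h3 | h3 | h3
    · exact (abs_lt.1 (hsl r (hpos r h1 h3).ne')).2.ne
    · rw [h3, heτ]; linarith
    · exact (abs_lt.1 (hsl r (hneg1 r h3 h2).ne)).2.ne
  have hreg' : ∀ r, τ - 2 * H < r → r < τ → slope θ d r ≠ -κ := fun r h1 h2 => by
    rcases lt_trichotomy r (τ - H) with h3 | h3 | h3
    · exact (abs_lt.1 (hsl r (hneg2 r h1 h3).ne)).1.ne'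
    · rw [h3, heτH]; linarith
    · exact (abs_lt.1 (hsl r (hpos r h3 h2).ne')).1.ne'
  have hsJ := h.sin_mul_jac hk t
  have hjac : jac θ d κ t = sin (θ 0) * sin (θ t) * (cosEnergy θ t * (cosEnergy θ t - (1 - κ ^ 2) * t)
      + sin (θ 0) ^ 2 + sin (θ t) ^ 2 - 2 * (1 + κ ^ 2))
    + 2 * m * (sin (θ 0) * slope θ d t - sin (θ t) * slope θ d 0)
    - 2 * slope θ d 0 * slope θ d t + 2 * κ ^ 2 := by
    rw [jac, hm]
    ring
  have h0b : barrier θ d κ 0 * sin (θ 0) = slope θ d 0 + κ ∨ slope θ d 0 = κ := by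
    by_cases hc : slope θ d 0 = κ
    · exact Or.inr hc
    · left
      have := h.sin_mul_barrier hk hc
      rw [cosEnergy_zero] at this
      linarith
  rw [← hm] at hsJ
  rcases lt_trichotomy (τ - H) 0 with hc0 | hc0 | hc0
  · have hs0 : 0 < sin (θ 0) := hpos 0 hc0 (by linarith)
    rcases lt_or_ge t τ with hct | hct
    · exact h.jac_pos_of_sin_pos hk hκ hk1 ht fun r hr =>
        hpos r (by linarith [hr.1]) (by linarith [hr.2])
    have hb1 : barrier θ d κ τ < barrier θ d κ 0 :=
      h.strictAntiOn_barrier hk hk1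
        (fun r hr => hreg r (by linarith [hr.1]) (by linarith [hr.2]))
        (fun r hr => (hpos r (by linarith [hr.1]) hr.2).ne')
        (left_mem_Icc.2 (by linarith)) (right_mem_Icc.2 (by linarith)) (by linarith)
    have hb2 : barrier θ d κ t ≤ barrier θ d κ τ :=
      (h.strictAntiOn_barrier hk hk1
        (fun r hr => hreg r (by linarith [hr.1]) (by linarith [hr.2]))
        (fun r hr => (hneg1 r hr.1 (by linarith [hr.2])).ne)).antitoneOn
        (left_mem_Icc.2 hct) (right_mem_Icc.2 hct) hct
    have e0 := h0b.resolve_right (hreg 0 hc0 (by linarith))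
    have hsl0 := abs_lt.1 (hsl 0 hs0.ne')
    rcases hct.eq_or_lt with rfl | hct
    · have hbτ : barrier θ d κ τ = m := by rw [barrier, hτ0, zero_mul, zero_div, zero_add]
      rw [hjac, hτ0, heτ]
      rw [hbτ] at hb1
      have := mul_lt_mul_of_pos_right hb1 hs0
      nlinarith
    · have hst := hneg1 t hct (by linarith)
      have hslt := abs_lt.1 (hsl t hst.ne)
      have et := h.sin_mul_barrier hk (hreg t (by linarith) (by linarith))
      rw [← hm] at et
      have hss : sin (θ 0) * sin (θ t) < 0 := mul_neg_of_pos_of_neg hs0 hst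
      -- The barrier for `κ` decreases through the falling zero, making the first factor positive;
      -- the second is negative term by term. Their product and `sin (θ 0) * sin (θ t)` are both
      -- negative.
      have hX : 0 < sin (θ 0) * (slope θ d t + κ) - sin (θ t) * (slope θ d 0 + κ)
          + m * (sin (θ 0) * sin (θ t)) := by
        have : sin (θ 0) * (slope θ d t + κ) - sin (θ t) * (slope θ d 0 + κ)
          + m * (sin (θ 0) * sin (θ t)) = sin (θ 0) * sin (θ t)
            * (barrier θ d κ t - barrier θ d κ 0) := by
          linear_combination sin (θ t) * e0 - sin (θ 0) * et
        rw [this]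
        exact mul_pos_of_neg_of_neg hss (by linarith)
      have hY : sin (θ 0) * (slope θ d t - κ) - sin (θ t) * (slope θ d 0 - κ)
          + m * (sin (θ 0) * sin (θ t)) < 0 := by
        have h1 : sin (θ 0) * (slope θ d t - κ) < 0 :=
          mul_neg_of_pos_of_neg hs0 (by linarith)
        have h2 : 0 < sin (θ t) * (slope θ d 0 - κ) :=
          mul_pos_of_neg_of_neg hst (by linarith)
        have h3 : m * (sin (θ 0) * sin (θ t)) ≤ 0 := mul_nonpos_of_nonneg_of_nonpos hm0 hss.le
        linarith
      have h4 := mul_neg_of_pos_of_neg hX hY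
      have h5 := sq_nonneg (sin (θ 0) * sin (θ t) * ((1 - κ ^ 2) * t / 2))
      exact pos_of_mul_neg_right (by linarith) hss.le
  · have hs0 : sin (θ 0) = 0 := (congrArg (fun r => sin (θ r)) hc0.symm).trans hsτH
    have he0 : slope θ d 0 = κ := (congrArg (slope θ d) hc0.symm).trans heτH
    have hJ : jac θ d κ t = 2 * κ * (κ - slope θ d t - m * sin (θ t)) := by
      rw [hjac, hs0, he0]
      ring
    rw [hJ]
    refine mul_pos (by linarith) ?_
    rcases lt_or_ge t τ with hct | hct
    · have hst := hpos t (by linarith) hct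
      have hb : barrier θ d (-κ) t < barrier θ d (-κ) 0 :=
        h.strictAntiOn_barrier hk' hk1'
          (fun r hr => hreg' r (by linarith [hr.1]) (by linarith [hr.2]))
          (fun r hr => (hpos r (by linarith [hr.1]) (by linarith [hr.2])).ne')
          (left_mem_Icc.2 ht.le) (right_mem_Icc.2 ht.le) ht
      have hb0 : barrier θ d (-κ) 0 = 0 := by
        rw [barrier, hs0, cosEnergy_zero]
        ring
      have et := h.sin_mul_barrier hk' (hreg' t (by linarith) hct)
      rw [neg_sq, ← hm] at et
      rw [hb0] at hb
      have := mul_neg_of_pos_of_neg hst hb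
      linarith
    · have hst : sin (θ t) ≤ 0 := by
        rcases hct.eq_or_lt with rfl | hct
        · exact hτ0.le
        · exact (hneg1 t hct (by linarith)).le
      have := hreg t (by linarith) (by linarith)
      have h2 : slope θ d t < κ := by
        rcases hct.eq_or_lt with rfl | hct
        · rw [heτ]; linarith
        · exact (abs_lt.1 (hsl t (hneg1 t hct (by linarith)).ne)).2
      have := mul_nonpos_of_nonneg_of_nonpos hm0 hst
      linarith
  · have hs0 : sin (θ 0) < 0 := hneg2 0 (by linarith) hc0
    have hsl0 := abs_lt.1 (hsl 0 hs0.ne)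
    rcases lt_trichotomy t τ with hct | hct | hct
    · have hst := hpos t (by linarith) hct
      have hslt := abs_lt.1 (hsl t hst.ne')
      have hss : sin (θ 0) * sin (θ t) < 0 := mul_neg_of_neg_of_pos hs0 hst
      have hb1 : barrier θ d (-κ) (τ - H) < barrier θ d (-κ) 0 :=
        h.strictAntiOn_barrier hk' hk1'
          (fun r hr => hreg' r (by linarith [hr.1]) (by linarith [hr.2]))
          (fun r hr => (hneg2 r (by linarith [hr.1]) hr.2).ne)
          (left_mem_Icc.2 hc0.le) (right_mem_Icc.2 hc0.le) hc0
      have hb2 : barrier θ d (-κ) t < barrier θ d (-κ) (τ - H) :=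
        h.strictAntiOn_barrier hk' hk1'
          (fun r hr => hreg' r (by linarith [hr.1]) (by linarith [hr.2]))
          (fun r hr => (hpos r hr.1 (by linarith [hr.2])).ne')
          (left_mem_Icc.2 (by linarith)) (right_mem_Icc.2 (by linarith)) (by linarith)
      have e0 := h.sin_mul_barrier hk' (hreg' 0 (by linarith) (by linarith))
      have et := h.sin_mul_barrier hk' (hreg' t (by linarith) hct)
      rw [neg_sq, cosEnergy_zero] at e0
      rw [neg_sq, ← hm] at et
      -- The mirror case: the barrier for `-κ` decreases through the rising zero, and the signs of
      -- the two factors are exchanged.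
      have hY : 0 < sin (θ 0) * (slope θ d t - κ) - sin (θ t) * (slope θ d 0 - κ)
          + m * (sin (θ 0) * sin (θ t)) := by
        have : sin (θ 0) * (slope θ d t - κ) - sin (θ t) * (slope θ d 0 - κ)
          + m * (sin (θ 0) * sin (θ t)) = sin (θ 0) * sin (θ t)
            * (barrier θ d (-κ) t - barrier θ d (-κ) 0) := by
          linear_combination sin (θ t) * e0 - sin (θ 0) * et
        rw [this]
        exact mul_pos_of_neg_of_neg hss (by linarith)
      have hX : sin (θ 0) * (slope θ d t + κ) - sin (θ t) * (slope θ d 0 + κ)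
          + m * (sin (θ 0) * sin (θ t)) < 0 := by
        have h1 : sin (θ 0) * (slope θ d t + κ) < 0 :=
          mul_neg_of_neg_of_pos hs0 (by linarith)
        have h2 : 0 < sin (θ t) * (slope θ d 0 + κ) := mul_pos hst (by linarith)
        have h3 : m * (sin (θ 0) * sin (θ t)) ≤ 0 := mul_nonpos_of_nonneg_of_nonpos hm0 hss.le
        linarith
      have h4 := mul_neg_of_neg_of_pos hX hY
      have h5 := sq_nonneg (sin (θ 0) * sin (θ t) * ((1 - κ ^ 2) * t / 2))
      exact pos_of_mul_neg_right (by linarith) hss.le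
    · rw [hjac, hct, hτ0, heτ]
      have := mul_nonpos_of_nonneg_of_nonpos hm0 hs0.le
      have : 0 < 2 * κ * (slope θ d 0 + κ - m * sin (θ 0)) :=
        mul_pos (by linarith) (by linarith)
      linarith
    · exact h.jac_pos_of_sin_neg hk hκ hk1 hH ht htH hs0 fun r hr =>
        hneg1 r (by linarith [hr.1]) (by linarith [hr.2])

end IsPend

/-! ### Jacobi fields -/

/-- The equation in variations of the horizontal subsystem. -/
structure IsVariation (θ d z η ν ξ υ ζ : ℝ → ℝ) : Prop where
  deriv_angle : ∀ t, HasDerivAt η (ν t) t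
  deriv_speed : ∀ t, HasDerivAt ν (-((cos (θ t) ^ 2 - sin (θ t) ^ 2) * η t)) t
  deriv_x : ∀ t, HasDerivAt ξ (-sin (θ t) * η t * cosh (z t) + cos (θ t) * (sinh (z t) * ζ t)) t
  deriv_y : ∀ t, HasDerivAt υ (-sin (θ t) * η t * sinh (z t) + cos (θ t) * (cosh (z t) * ζ t)) t
  deriv_z : ∀ t, HasDerivAt ζ (cos (θ t) * η t) t
  x_zero : ξ 0 = 0
  y_zero : υ 0 = 0
  z_zero : ζ 0 = 0

namespace IsVariation

variable {θ d x y z η ν ξ υ ζ : ℝ → ℝ}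

/-- The linearization of `IsGeod.cos_and_speed_eq`, from the two first integrals differentiated with
respect to the covector. -/
theorem variation_cos_and_speed (h : IsVariation θ d z η ν ξ υ ζ) (hg : IsGeod θ d x y z) (t : ℝ) :
    -sin (θ t) * η t + d t * ζ t = -sin (θ 0) * η 0 * cosh (z t) - ν 0 * sinh (z t) ∧
      ν t + cos (θ t) * ζ t = ν 0 * cosh (z t) + sin (θ 0) * η 0 * sinh (z t) := by
  have e1 : ∀ t, -sin (θ t) * η t * cosh (z t) + cos (θ t) * (sinh (z t) * ζ t)
      + ν t * sinh (z t) + d t * (cosh (z t) * ζ t) = -sin (θ 0) * η 0 := fun t => by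
    refine (eq_of_hasDerivAt_zero (f := fun t => -sin (θ t) * η t * cosh (z t)
      + cos (θ t) * (sinh (z t) * ζ t) + ν t * sinh (z t) + d t * (cosh (z t) * ζ t))
      (fun t => ?_) t 0).trans (by simp [hg.z_zero, h.z_zero])
    refine ((((((hg.deriv_sin t).neg.mul (h.deriv_angle t)).mul (hg.deriv_z t).cosh).add
      ((hg.deriv_cos t).mul ((hg.deriv_z t).sinh.mul (h.deriv_z t)))).add
      ((h.deriv_speed t).mul (hg.deriv_z t).sinh)).add
      ((hg.deriv_speed t).mul ((hg.deriv_z t).cosh.mul (h.deriv_z t)))).congr_deriv ?_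
    simp only [Pi.mul_apply, Pi.neg_apply]
    ring
  have e2 : ∀ t, -sin (θ t) * η t * sinh (z t) + cos (θ t) * (cosh (z t) * ζ t)
      + ν t * cosh (z t) + d t * (sinh (z t) * ζ t) = ν 0 := fun t => by
    refine (eq_of_hasDerivAt_zero (f := fun t => -sin (θ t) * η t * sinh (z t)
      + cos (θ t) * (cosh (z t) * ζ t) + ν t * cosh (z t) + d t * (sinh (z t) * ζ t))
      (fun t => ?_) t 0).trans (by simp [hg.z_zero, h.z_zero])
    refine ((((((hg.deriv_sin t).neg.mul (h.deriv_angle t)).mul (hg.deriv_z t).sinh).add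
      ((hg.deriv_cos t).mul ((hg.deriv_z t).cosh.mul (h.deriv_z t)))).add
      ((h.deriv_speed t).mul (hg.deriv_z t).cosh)).add
      ((hg.deriv_speed t).mul ((hg.deriv_z t).sinh.mul (h.deriv_z t)))).congr_deriv ?_
    simp only [Pi.mul_apply, Pi.neg_apply]
    ring
  have hcs := cosh_sq (z t)
  constructor
  · linear_combination cosh (z t) * e1 t - sinh (z t) * e2 t
      - (-sin (θ t) * η t + d t * ζ t) * hcs
  · linear_combination cosh (z t) * e2 t - sinh (z t) * e1 t
      - (ν t + cos (θ t) * ζ t) * hcs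

/-- The Gauss lemma. -/
theorem gauss (h : IsVariation θ d z η ν ξ υ ζ) (hg : IsGeod θ d x y z) (t : ℝ) :
    cos (θ 0) * ξ t - d 0 * υ t + sin (θ t) * ζ t = 0 := by
  refine (eq_of_hasDerivAt_zero (f := fun t => cos (θ 0) * ξ t - d 0 * υ t + sin (θ t) * ζ t)
    (fun t => ?_) t 0).trans (by simp [h.x_zero, h.y_zero, h.z_zero])
  refine ((((h.deriv_x t).const_mul _).sub ((h.deriv_y t).const_mul _)).add
    ((hg.deriv_sin t).mul (h.deriv_z t))).congr_deriv ?_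
  linear_combination sin (θ t) * η t * hg.cos_eq t + cos (θ t) * ζ t * hg.speed_eq t

theorem variation_boost (h : IsVariation θ d z η ν ξ υ ζ) (hg : IsGeod θ d x y z) (t : ℝ) :
    -sin (θ 0) * η 0 * y t + cos (θ 0) * υ t - ν 0 * x t - d 0 * ξ t + cos (θ t) * η t
      = cos (θ 0) * η 0 := by
  refine (eq_of_hasDerivAt_zero (f := fun t => -sin (θ 0) * η 0 * y t + cos (θ 0) * υ t - ν 0 * x t
    - d 0 * ξ t + cos (θ t) * η t) (fun t => ?_) t 0).trans
    (by simp [h.x_zero, h.y_zero, hg.x_zero, hg.y_zero])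
  refine ((((((hg.deriv_y t).const_mul _).add ((h.deriv_y t).const_mul _)).sub
    ((hg.deriv_x t).const_mul _)).sub ((h.deriv_x t).const_mul _)).add
    ((hg.deriv_cos t).mul (h.deriv_angle t))).congr_deriv ?_
  linear_combination -cos (θ t) * ζ t * hg.cos_eq t - sin (θ t) * η t * hg.speed_eq t
    + cos (θ t) * (h.variation_cos_and_speed hg t).2

/-- Away from the separatrices the exponential mapping is degenerate only where the Jacobian
vanishes. -/
theorem eq_zero_of_jac_ne_zero (h : IsVariation θ d z η ν ξ υ ζ) (hg : IsGeod θ d x y z) {κ t : ℝ}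
    (hk : κ ^ 2 = sin (θ 0) ^ 2 + d 0 ^ 2) (hκ : κ ≠ 0) (hk1 : κ ^ 2 ≠ 1)
    (hJ : IsPend.jac θ d κ t ≠ 0) (hx : ξ t = 0) (hy : υ t = 0) (hz : ζ t = 0) :
    η 0 = 0 ∧ ν 0 = 0 := by
  set n := 1 - κ ^ 2 with hn
  have hn0 : n ≠ 0 := sub_ne_zero.2 (Ne.symm hk1)
  -- `A` is half the variation of `n = cos² θ - d²` at time zero, and `-B / n` is the variation of
  -- the hyperbolic angle of `(cos θ, d)`.
  set A := cos (θ 0) * (-sin (θ 0) * η 0) - d 0 * ν 0 with hA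
  set B := d 0 * (-sin (θ 0) * η 0) - cos (θ 0) * ν 0 with hB
  have hPD : cos (θ 0) ^ 2 - d 0 ^ 2 = n := by
    rw [hn, hk, cos_sq']
    ring
  have hch : ∀ r, n * cosh (z r) = cos (θ 0) * cos (θ r) - d 0 * d r := fun r => by
    rw [hg.cos_eq r, hg.speed_eq r, ← hPD]; ring
  have hsh : ∀ r, n * sinh (z r) = d 0 * cos (θ r) - cos (θ 0) * d r := fun r => by
    rw [hg.cos_eq r, hg.speed_eq r, ← hPD]; ring
  have h1 : ∀ r, -sin (θ r) * (n * η r) + d r * (n * ζ r + B) = cos (θ r) * A := fun r => by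
    rw [hA, hB]
    linear_combination n * (h.variation_cos_and_speed hg r).1
      + (-sin (θ 0) * η 0) * hch r - ν 0 * hsh r
  have h2 : ∀ r, n * ν r + cos (θ r) * (n * ζ r + B) = d r * A := fun r => by
    rw [hA, hB]
    linear_combination n * (h.variation_cos_and_speed hg r).2
      + ν 0 * hch r + sin (θ 0) * η 0 * hsh r
  have hen : ∀ r, sin (θ r) ^ 2 + d r ^ 2 = κ ^ 2 := fun r => by rw [hg.energy_eq r 0, hk]
  set w := d 0 * (n * η 0) + sin (θ 0) * (n * ζ 0 + B) with hw
  -- This combination has derivative `d² A`, so it integrates explicitly. With `h1` it determines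
  -- `η` and `ζ` in terms of `w`, `A` and `B`.
  have hW : ∀ r, d r * (n * η r) + sin (θ r) * (n * ζ r + B) = w + A * (cosEnergy θ r - n * r) :=
    fun r => by
    refine eq_of_hasDerivAt_eq (f := fun r => d r * (n * η r) + sin (θ r) * (n * ζ r + B))
      (g := fun r => w + A * (cosEnergy θ r - n * r)) (f' := fun r => d r ^ 2 * A)
      (fun r => ?_) (fun r => ?_)
      (a := 0) ?_ r
    · refine (((hg.deriv_speed r).mul ((h.deriv_angle r).const_mul n)).add
        ((hg.deriv_sin r).mul (((h.deriv_z r).const_mul n).add_const B))).congr_deriv ?_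
      linear_combination d r * h2 r
    · refine ((((hg.hasDerivAt_cosEnergy r).sub ((hasDerivAt_id r).const_mul n)).const_mul
        A).const_add w).congr_deriv ?_
      rw [hn]
      linear_combination A * sin_sq_add_cos_sq (θ r) - A * hen r
    · simp [hw, cosEnergy_zero]
  have hη : ∀ r, κ ^ 2 * (n * η r)
      = d r * (w + A * (cosEnergy θ r - n * r)) - sin (θ r) * cos (θ r) * A := fun r => by
    linear_combination -(n * η r) * hen r + d r * hW r - sin (θ r) * h1 r
  have hζ : ∀ r, κ ^ 2 * (n * ζ r + B)
      = sin (θ r) * (w + A * (cosEnergy θ r - n * r)) + cos (θ r) * d r * A := fun r => by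
    linear_combination -(n * ζ r + B) * hen r + sin (θ r) * hW r + d r * h1 r
  have e0 := hζ 0
  have et := hζ t
  have f0 := hη 0
  have ft := hη t
  rw [h.z_zero, cosEnergy_zero] at e0
  rw [cosEnergy_zero] at f0
  rw [hz] at et
  have hb := h.variation_boost hg t
  rw [hx, hy] at hb
  have hmom := hg.momentum_eq t
  have hbo := hg.boost_eq t
  have hbn : cosEnergy θ t * B + (sin (θ 0) - sin (θ t)) * A + cos (θ t) * (n * η t)
      = cos (θ 0) * (n * η 0) := by
    rw [hB, hA]
    linear_combination n * hb - (d 0 * (-sin (θ 0) * η 0) - cos (θ 0) * ν 0) * hmom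
      - (cos (θ 0) * (-sin (θ 0) * η 0) - d 0 * ν 0) * hbo
      + (-sin (θ 0) * η 0 * y t - ν 0 * x t) * hPD
  set s0 := sin (θ 0)
  set s1 := sin (θ t)
  set L := cosEnergy θ t
  -- Vanishing at the endpoint gives two linear equations in `w` and `A`, after `B` is eliminated;
  -- their determinant is `jac`.
  have q1 : (s1 - s0) * w + (s1 * (L - n * t) + cos (θ t) * d t - cos (θ 0) * d 0) * A = 0 := by
    linear_combination e0 - et
  have q2 : (s0 * L + cos (θ t) * d t - cos (θ 0) * d 0) * w
      + (κ ^ 2 * (s0 - s1) + cos (θ 0) * d 0 * L + cos (θ t) * d t * (L - n * t)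
        + s0 * cos (θ 0) ^ 2 - s1 * cos (θ t) ^ 2) * A = 0 := by
    linear_combination κ ^ 2 * hbn - L * e0 - cos (θ t) * ft + cos (θ 0) * f0
  have hdet : IsPend.jac θ d κ t = -((s1 - s0) * (κ ^ 2 * (s0 - s1) + cos (θ 0) * d 0 * L
      + cos (θ t) * d t * (L - n * t) + s0 * cos (θ 0) ^ 2 - s1 * cos (θ t) ^ 2)
      - (s1 * (L - n * t) + cos (θ t) * d t - cos (θ 0) * d 0)
        * (s0 * L + cos (θ t) * d t - cos (θ 0) * d 0)) := by
    have g0 := hg.slope_sq hk 0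
    have gt := hg.slope_sq hk t
    have c0 := cos_sq' (θ 0)
    have c1 := cos_sq' (θ t)
    rw [IsPend.slope] at g0 gt
    rw [IsPend.jac, IsPend.slope, IsPend.slope, c0, c1]
    linear_combination -g0 - gt
  have hA0 : A = 0 := by
    refine (mul_eq_zero.1 (?_ : IsPend.jac θ d κ t * A = 0)).resolve_left hJ
    rw [hdet]
    linear_combination (s0 * L + cos (θ t) * d t - cos (θ 0) * d 0) * q1 - (s1 - s0) * q2
  have hw0 : w = 0 := by
    refine (mul_eq_zero.1 (?_ : IsPend.jac θ d κ t * w = 0)).resolve_left hJ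
    rw [hdet]
    linear_combination -(κ ^ 2 * (s0 - s1) + cos (θ 0) * d 0 * L
      + cos (θ t) * d t * (L - n * t) + s0 * cos (θ 0) ^ 2 - s1 * cos (θ t) ^ 2) * q1
      + (s1 * (L - n * t) + cos (θ t) * d t - cos (θ 0) * d 0) * q2
  rw [hA0, hw0] at e0 f0
  have hκ2 : κ ^ 2 ≠ 0 := pow_ne_zero 2 hκ
  have hB0 : B = 0 := (mul_eq_zero.1 (by linarith : κ ^ 2 * B = 0)).resolve_left hκ2
  have hη0 : η 0 = 0 := (mul_eq_zero.1 ((mul_eq_zero.1 (by linarith : κ ^ 2 * (n * η 0) = 0)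
    ).resolve_left hκ2)).resolve_left hn0
  refine ⟨hη0, (mul_eq_zero.1 (?_ : n * ν 0 = 0)).resolve_left hn0⟩
  rw [← hPD]
  linear_combination d 0 * hA0 - cos (θ 0) * hB0 - d 0 * hA + cos (θ 0) * hB

/-- The case of the unstable equilibria. -/
theorem eq_zero_of_equilibrium (h : IsVariation θ d z η ν ξ υ ζ) (hg : IsGeod θ d x y z)
    (hc : cos (θ 0) = 0) (hd : d 0 = 0) {t : ℝ} (ht : 0 < t) (hx : ξ t = 0) (hy : υ t = 0) :
    η 0 = 0 ∧ ν 0 = 0 := by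
  have hθ := fun r => (hg.angle_const hc hd r).1
  have hs1 : sin (θ 0) ^ 2 = 1 := by
    have := sin_sq_add_cos_sq (θ 0)
    rw [hc] at this
    linarith
  have hζ : ∀ r, ζ r = 0 := fun r => by
    refine (eq_of_hasDerivAt_zero (fun r => ?_) r 0).trans h.z_zero
    refine (h.deriv_z r).congr_deriv ?_
    rw [hθ, hc, zero_mul]
  set g := fun r => -sin (θ 0) * η 0 * cosh (z r) - ν 0 * sinh (z r) with hgdef
  have hη : ∀ r, -sin (θ 0) * η r = g r := fun r => by
    have := (h.variation_cos_and_speed hg r).1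
    rw [hζ, mul_zero, add_zero, hθ] at this
    exact this
  -- This combination of `ξ` and `υ` grows at the rate of a square and vanishes at both ends, so `g`
  -- vanishes in between. The values of `g` and of its derivative at one time then determine both
  -- initial variations.
  have hf : ∀ r, HasDerivAt (fun r => -sin (θ 0) * η 0 * ξ r - ν 0 * υ r) (g r ^ 2) r := fun r => by
    refine (((h.deriv_x r).const_mul _).sub ((h.deriv_y r).const_mul _)).congr_deriv ?_
    rw [hθ r, hc, hη r]
    simp only [hgdef]
    ring
  have hmono := monotone_of_hasDerivAt_nonneg hf fun r => sq_nonneg (g r)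
  have hg0 : ∀ r ∈ Ioo 0 t, g r = 0 := fun r hr => by
    have hev : (fun r => -sin (θ 0) * η 0 * ξ r - ν 0 * υ r) =ᶠ[𝓝 r] fun _ => 0 := by
      filter_upwards [Ioo_mem_nhds hr.1 hr.2] with u hu
      have h1 := hmono hu.1.le
      have h2 := hmono hu.2.le
      simp only [hx, hy, h.x_zero, h.y_zero, mul_zero, sub_zero] at h1 h2
      exact le_antisymm h2 h1
    exact pow_eq_zero_iff two_ne_zero |>.1
      ((hf r).unique ((hasDerivAt_const r (0 : ℝ)).congr_of_eventuallyEq hev))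
  have hmid : t / 2 ∈ Ioo 0 t := ⟨by linarith, by linarith⟩
  have hev : g =ᶠ[𝓝 (t / 2)] fun _ => 0 := by
    filter_upwards [Ioo_mem_nhds hmid.1 hmid.2] with r hr using hg0 r hr
  have h1 := ((((hg.deriv_z (t / 2)).cosh.const_mul (-sin (θ 0) * η 0)).sub
    ((hg.deriv_z (t / 2)).sinh.const_mul (ν 0)))).unique
    ((hasDerivAt_const (t / 2) (0 : ℝ)).congr_of_eventuallyEq hev)
  have h2 := hg0 _ hmid
  have h3 := cosh_sq (z (t / 2))
  simp only [hgdef] at h2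
  rw [hθ (t / 2)] at h1
  constructor
  · linear_combination (-η 0) * hs1 - sin (θ 0) * cosh (z (t / 2)) * h2 + sinh (z (t / 2)) * h1
      - sin (θ 0) ^ 2 * η 0 * h3
  · linear_combination (-ν 0) * hs1 - sin (θ 0) * cosh (z (t / 2)) * h1
      + sin (θ 0) ^ 2 * sinh (z (t / 2)) * h2 - sin (θ 0) ^ 2 * ν 0 * h3

/-- This is the coefficient left after elimination on the separatrix. Both parts are positive
because `t < sinh t < t cosh t`. -/
theorem separatrix_pos {t S : ℝ} (ht : 0 < t) (hS : 1 ≤ S) :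
    0 < S * (sinh t ^ 2 - t ^ 2) + t ^ 2 * cosh t - t * sinh t := by
  have h1 : t < sinh t := self_lt_sinh_iff.2 ht
  have h2 : sinh t < t * cosh t := by
    have hm : StrictMonoOn (fun t => t * cosh t - sinh t) (Ici 0) := by
      have hder : ∀ t : ℝ, HasDerivAt (fun t => t * cosh t - sinh t) (t * sinh t) t := fun t => by
        refine (((hasDerivAt_id t).mul (hasDerivAt_cosh t)).sub (hasDerivAt_sinh t)).congr_deriv ?_
        simp
      refine strictMonoOn_of_deriv_pos (convex_Ici 0)
        (fun t _ => (hder t).continuousAt.continuousWithinAt) fun t ht => ?_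
      rw [interior_Ici] at ht
      rw [(hder t).deriv]
      exact mul_pos ht (sinh_pos_iff.2 ht)
    have := hm self_mem_Ici ht.le ht
    simpa using this
  have h3 : 0 < sinh t ^ 2 - t ^ 2 := by nlinarith
  nlinarith

/-- The case of the separatrices. -/
theorem eq_zero_of_separatrix (h : IsVariation θ d z η ν ξ υ ζ) (hg : IsGeod θ d x y z)
    (hk : sin (θ 0) ^ 2 + d 0 ^ 2 = 1) (hd : d 0 ≠ 0) {t : ℝ} (ht : 0 < t) (hx : ξ t = 0)
    (hy : υ t = 0) (hz : ζ t = 0) : η 0 = 0 ∧ ν 0 = 0 := by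
  obtain ⟨ε, b, hε, hs, hdc, hne⟩ := hg.exists_tanh hk hd
  set P := cos (θ 0) with hP
  have hP0 : P ≠ 0 := hne 0
  have hD : d 0 = ε * P := hdc 0
  have hm : ∀ r, P * (cosh (z r) - ε * sinh (z r)) = cos (θ r) := fun r => by
    rw [hg.cos_eq r, hD]; ring
  have hp : ∀ r, cos (θ r) * (cosh (z r) + ε * sinh (z r)) = P := fun r => by
    rw [← hm]
    linear_combination P * cosh_sq (z r) - P * sinh (z r) ^ 2 * hε
  -- On the separatrix `(cos θ, d)` is a null vector, so `n = 0` and the previous reduction fails.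
  -- Instead the variation of the momentum is split into its components along the null directions
  -- `(1, ε)` and `(1, -ε)`.
  set σ := (-sin (θ 0) * η 0 + ε * ν 0) / 2 with hσ
  set ρ := (-sin (θ 0) * η 0 - ε * ν 0) / 2 with hρ
  have hv1 : ∀ r, P * cos (θ r) * (-sin (θ r) * η r + ε * cos (θ r) * ζ r)
      = σ * cos (θ r) ^ 2 + ρ * P ^ 2 := fun r => by
    have h1 := (h.variation_cos_and_speed hg r).1
    rw [hdc r] at h1
    rw [hσ, hρ]
    linear_combination P * cos (θ r) * h1
      + ((-sin (θ 0) * η 0 + ε * ν 0) / 2) * cos (θ r) * hm r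
      + ((-sin (θ 0) * η 0 - ε * ν 0) / 2) * P * hp r
      + P * cos (θ r) * ν 0 * sinh (z r) * hε
  have hv2 : ∀ r, P * cos (θ r) * (ν r + cos (θ r) * ζ r)
      = ε * (σ * cos (θ r) ^ 2 - ρ * P ^ 2) := fun r => by
    have h1 := (h.variation_cos_and_speed hg r).2
    rw [hσ, hρ]
    linear_combination P * cos (θ r) * h1
      + ε * ((-sin (θ 0) * η 0 + ε * ν 0) / 2) * cos (θ r) * hm r
      - ε * ((-sin (θ 0) * η 0 - ε * ν 0) / 2) * P * hp r
      - P * cos (θ r) * (sin (θ 0) * η 0 * sinh (z r) + ν 0 * cosh (z r)) * hε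
  set W := fun r => P * (d r * η r + sin (θ r) * ζ r) - ε * σ * sin (θ r) with hWdef
  have hW : ∀ r, W r = W 0 - ρ * P ^ 2 * r := fun r => by
    refine eq_of_hasDerivAt_eq (f := W) (g := fun r => W 0 - ρ * P ^ 2 * r)
      (f' := fun r => -(ρ * P ^ 2)) (fun r => ?_) (fun r => ?_) (a := 0) (by simp) r
    · refine (((((hg.deriv_speed r).mul (h.deriv_angle r)).add
        ((hg.deriv_sin r).mul (h.deriv_z r))).const_mul P).sub
        ((hg.deriv_sin r).const_mul (ε * σ))).congr_deriv ?_
      rw [hdc r]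
      linear_combination ε * hv2 r - ρ * P ^ 2 * hε
    · exact (((hasDerivAt_id r).const_mul (ρ * P ^ 2)).const_sub (W 0)).congr_deriv (by ring)
  have hζ : ∀ r, P * ζ r = sin (θ r) * (W 0 - ρ * P ^ 2 * r) + ε * σ + ε * (ρ * P ^ 2) :=
    fun r => by
    rw [← hW, hWdef]
    dsimp only
    rw [hdc r]
    linear_combination ε * hv1 r + (-P * ζ r + ε * σ) * sin_sq_add_cos_sq (θ r)
      - P * cos (θ r) ^ 2 * ζ r * hε
  have hξ : ∀ r, ξ r + ε * υ r = σ * r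
      + ρ * P ^ 2 * (r / 2 + ε / 2 * (sin (θ r) / cos (θ r) ^ 2 - sin (θ 0) / cos (θ 0) ^ 2)) :=
    fun r => by
    refine eq_of_hasDerivAt_eq (f := fun r => ξ r + ε * υ r) (g := fun r => σ * r
      + ρ * P ^ 2 * (r / 2 + ε / 2 * (sin (θ r) / cos (θ r) ^ 2 - sin (θ 0) / cos (θ 0) ^ 2)))
      (f' := fun r => σ + ρ * P ^ 2 / cos (θ r) ^ 2) (fun r => ?_) (fun r => ?_) (a := 0)
      (by simp [h.x_zero, h.y_zero]) r
    · refine ((h.deriv_x r).add ((h.deriv_y r).const_mul ε)).congr_deriv ?_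
      have hc := hne r
      rw [← mul_left_inj' (pow_ne_zero 2 hc), add_mul σ, div_mul_cancel₀ _ (pow_ne_zero 2 hc),
        ← hv1 r]
      linear_combination cos (θ r) * (-sin (θ r) * η r + ε * cos (θ r) * ζ r) * hp r
        - cos (θ r) ^ 3 * ζ r * sinh (z r) * hε
    · have hc := hne r
      refine (((hasDerivAt_id r).const_mul σ).add ((((hasDerivAt_id r).div_const 2).add
        ((((hg.deriv_sin r).div ((hg.deriv_cos r).pow 2) (pow_ne_zero 2 hc)).sub_const
          _).const_mul (ε / 2))).const_mul (ρ * P ^ 2))).congr_deriv ?_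
      simp only [Pi.pow_apply]
      rw [hdc r]
      have hsc := sin_sq_add_cos_sq (θ r)
      field_simp
      push_cast
      linear_combination ρ * P ^ 2 * (cos (θ r) ^ 3 + 2 * sin (θ r) ^ 2 * cos (θ r)) * hε
        + 2 * ρ * P ^ 2 * cos (θ r) * hsc
  have e0 := hζ 0
  have et := hζ t
  have ex := hξ t
  rw [h.z_zero] at e0
  rw [hz] at et
  rw [hx, hy] at ex
  set A := ρ * P ^ 2 with hA
  set w := W 0 with hw
  have hsig : ε * σ + ε * A + sin (θ 0) * w = 0 := by linear_combination -e0
  have hdiff : (sin (θ t) - sin (θ 0)) * w = sin (θ t) * (A * t) := by linear_combination e0 - et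
  have hcs : ∀ r, cos (θ r) ^ 2 = 1 / cosh (ε * r + b) ^ 2 := fun r => by
    have h1 := sin_sq_add_cos_sq (θ r)
    rw [hs r, tanh_eq_sinh_div_cosh] at h1
    have h2 := cosh_sq (ε * r + b)
    have h3 := (cosh_pos (ε * r + b)).ne'
    field_simp at h1 ⊢
    linarith
  have hsc : ∀ r, sin (θ r) / cos (θ r) ^ 2 = sinh (ε * r + b) * cosh (ε * r + b) := fun r => by
    rw [hcs, hs, tanh_eq_sinh_div_cosh]
    have h3 := (cosh_pos (ε * r + b)).ne'
    field_simp
  have hsC : ∀ r, sin (θ r) * cosh (ε * r + b) = sinh (ε * r + b) := fun r => by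
    rw [hs, tanh_eq_sinh_div_cosh, div_mul_cancel₀ _ (cosh_pos _).ne']
  rw [hsc, hsc] at ex
  have hεt : sinh (ε * t) = ε * sinh t ∧ cosh (ε * t) = cosh t := by
    rcases sq_eq_sq_iff_eq_or_eq_neg.1 (hε.trans (one_pow 2).symm) with h1 | h1 <;> simp [h1]
  have hsub : sinh (ε * t + b) * cosh (ε * 0 + b) - sinh (ε * 0 + b) * cosh (ε * t + b)
      = ε * sinh t := by
    rw [← hεt.1, show ε * t = (ε * t + b) - (ε * 0 + b) by ring, sinh_sub]
    ring_nf
  have hcsub : cosh (ε * t + b) * cosh (ε * 0 + b) - sinh (ε * t + b) * sinh (ε * 0 + b)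
      = cosh t := by
    rw [← hεt.2, show ε * t = (ε * t + b) - (ε * 0 + b) by ring, cosh_sub]
    ring_nf
  have hSig := one_le_cosh ((ε * t + b) + (ε * 0 + b))
  rw [cosh_add] at hSig
  have g0 := hsC 0
  have gt := hsC t
  have k0 := cosh_sq (ε * 0 + b)
  have kt := cosh_sq (ε * t + b)
  set C0 := cosh (ε * 0 + b)
  set C1 := cosh (ε * t + b)
  set S0 := sinh (ε * 0 + b)
  set S1 := sinh (ε * t + b)
  have hpos := separatrix_pos ht hSig
  have hdiff' : ε * sinh t * w = S1 * C0 * (A * t) := by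
    rw [← hsub]
    linear_combination C0 * C1 * hdiff - w * C0 * gt + w * C1 * g0 + C0 * (A * t) * gt
  have hprod : S1 * C1 - S0 * C0 = ε * sinh t * (C1 * C0 + S1 * S0) := by
    rw [← hsub]
    linear_combination S0 * C0 * kt - S1 * C1 * k0
  -- Eliminating `σ` and then `w` from the endpoint conditions leaves `A` times the expression of
  -- `separatrix_pos`, with `S = cosh (ε t + 2 b)`.
  have hA0 : A = 0 := by
    refine (mul_eq_zero.1 (?_ : ((C1 * C0 + S1 * S0) * (sinh t ^ 2 - t ^ 2) + t ^ 2 * cosh t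
      - t * sinh t) * A = 0)).resolve_left hpos.ne'
    have hσ' : σ = -(ε * (sin (θ 0) * w)) - A := by
      linear_combination ε * hsig - (σ + A) * hε
    rw [hσ', hprod] at ex
    have hC0 : C0 ≠ 0 := (cosh_pos _).ne'
    refine (mul_eq_zero.1 (?_ : C0 * _ = 0)).resolve_left hC0
    linear_combination -2 * C0 * sinh t * ex - C0 * A * (C1 * C0 + S1 * S0) * sinh t ^ 2 * hε
      + 2 * sinh t * ε * w * t * g0 + 2 * S0 * t * hdiff' - C0 * A * t ^ 2 * hcsub
  have hε0 : ε ≠ 0 := fun h0 => by rw [h0] at hε; norm_num at hε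
  have hw0 : w = 0 := by
    rw [hA0] at hdiff'
    exact (mul_eq_zero.1 (by linarith : ε * sinh t * w = 0)).resolve_left
      (mul_ne_zero hε0 (sinh_pos_iff.2 ht).ne')
  have hρ0 : ρ = 0 := (mul_eq_zero.1 hA0).resolve_right (pow_ne_zero 2 hP0)
  have hσ0 : σ = 0 := by
    rw [hA0, hw0] at hsig
    exact (mul_eq_zero.1 (by linarith : ε * σ = 0)).resolve_left hε0
  constructor
  · rw [hw, hWdef] at hw0
    simp only [h.z_zero, hσ0, mul_zero, add_zero, zero_mul, sub_zero] at hw0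
    exact (mul_eq_zero.1 ((mul_eq_zero.1 hw0).resolve_left hP0)).resolve_left hd
  · refine (mul_eq_zero.1 (?_ : ε * ν 0 = 0)).resolve_left hε0
    linarith

end IsVariation

/-! ### The variations of the extremals -/

/-- By symmetry of the second derivative, the time derivative of the variation is the variation of
the velocity. This yields the equation in variations from smoothness alone. -/
theorem hasDerivAt_variation {E : Type*} [NormedAddCommGroup E] [NormedSpace ℝ E] {φ F : E × ℝ → ℝ}
    (hφ : ContDiff ℝ ∞ φ) (hF : ∀ p r, HasDerivAt (fun r => φ (p, r)) (F (p, r)) r) (p w : E)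
    (r : ℝ) {F' : ℝ} (hF' : HasDerivAt (fun s : ℝ => F (p + s • w, r)) F' 0) :
    HasDerivAt (fun r => fderiv ℝ φ (p, r) (w, 0)) F' r := by
  have hd : Differentiable ℝ φ := hφ.differentiable (by simp)
  have hd2 : Differentiable ℝ (fderiv ℝ φ) :=
    (hφ.fderiv_right (m := 1) (by norm_cast)).differentiable (by simp)
  have hFeq : ∀ q : E × ℝ, F q = fderiv ℝ φ q (0, 1) := fun q => by
    have h1 : HasDerivAt (fun r : ℝ => (q.1, r)) ((0 : E), (1 : ℝ)) q.2 :=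
      (hasDerivAt_const q.2 q.1).prodMk (hasDerivAt_id q.2)
    exact (hF q.1 q.2).unique ((hd q).hasFDerivAt.comp_hasDerivAt q.2 h1)
  have hline : HasDerivAt (fun s : ℝ => (p + s • w, r)) (w, (0 : ℝ)) 0 := by
    have : HasDerivAt (fun s : ℝ => p + s • w) w 0 := by
      simpa using ((hasDerivAt_id (0 : ℝ)).smul_const w).const_add p
    exact this.prodMk (hasDerivAt_const 0 r)
  have hq : HasFDerivAt (fderiv ℝ φ) (fderiv ℝ (fderiv ℝ φ) (p, r)) (p + (0 : ℝ) • w, r) := by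
    rw [zero_smul, add_zero]
    exact (hd2 (p, r)).hasFDerivAt
  have h2 : HasDerivAt (fun s : ℝ => F (p + s • w, r))
      (fderiv ℝ (fderiv ℝ φ) (p, r) (w, 0) (0, 1)) 0 := by
    simp only [hFeq]
    exact (ContinuousLinearMap.apply ℝ ℝ ((0 : E), (1 : ℝ))).hasFDerivAt.comp_hasDerivAt (0 : ℝ)
      (hq.comp_hasDerivAt (0 : ℝ) hline)
  have hsymm : IsSymmSndFDerivAt ℝ φ (p, r) :=
    hφ.contDiffAt.isSymmSndFDerivAt (by
      rw [minSmoothness_of_isRCLikeNormedField]; exact WithTop.coe_le_coe.2 le_top)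
  rw [hF'.unique h2, hsymm (w, 0) (0, 1)]
  have h3 : HasDerivAt (fun r : ℝ => (p, r)) ((0 : E), (1 : ℝ)) r :=
    (hasDerivAt_const r p).prodMk (hasDerivAt_id r)
  exact (ContinuousLinearMap.apply ℝ ℝ (w, (0 : ℝ))).hasFDerivAt.comp_hasDerivAt r
    ((hd2 (p, r)).hasFDerivAt.comp_hasDerivAt r h3)

theorem hasDerivAt_line {E : Type*} [NormedAddCommGroup E] [NormedSpace ℝ E] {φ : E × ℝ → ℝ}
    (hφ : ContDiff ℝ ∞ φ) (p w : E) (r : ℝ) :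
    HasDerivAt (fun s : ℝ => φ (p + s • w, r)) (fderiv ℝ φ (p, r) (w, 0)) 0 := by
  have hline : HasDerivAt (fun s : ℝ => (p + s • w, r)) (w, (0 : ℝ)) 0 := by
    have : HasDerivAt (fun s : ℝ => p + s • w) w 0 := by
      simpa using ((hasDerivAt_id (0 : ℝ)).smul_const w).const_add p
    exact this.prodMk (hasDerivAt_const 0 r)
  have hq : HasFDerivAt φ (fderiv ℝ φ (p, r)) (p + (0 : ℝ) • w, r) := by
    rw [zero_smul, add_zero]
    exact (hφ.differentiable (by simp) (p, r)).hasFDerivAt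
  exact hq.comp_hasDerivAt (0 : ℝ) hline

theorem contDiff_ang : ContDiff ℝ ∞ fun a : (ℝ × ℝ) × ℝ => ang a.1 a.2 :=
  contDiff_lifted.fst.fst.div_const 2

theorem contDiff_spd : ContDiff ℝ ∞ fun a : (ℝ × ℝ) × ℝ => spd a.1 a.2 :=
  contDiff_lifted.fst.snd.div_const 2

theorem contDiff_ex : ContDiff ℝ ∞ fun a : (ℝ × ℝ) × ℝ => ex a.1 a.2 := contDiff_lifted.snd.fst

theorem contDiff_ey : ContDiff ℝ ∞ fun a : (ℝ × ℝ) × ℝ => ey a.1 a.2 := contDiff_lifted.snd.snd.fst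

theorem contDiff_ez : ContDiff ℝ ∞ fun a : (ℝ × ℝ) × ℝ => ez a.1 a.2 := contDiff_lifted.snd.snd.snd

/-- The derivative of `φ` in the direction `w` of the initial covector. -/
def covDeriv (φ : (ℝ × ℝ) × ℝ → ℝ) (p w : ℝ × ℝ) (r : ℝ) : ℝ := fderiv ℝ φ (p, r) (w, 0)

theorem covDeriv_eq_of_const {φ : (ℝ × ℝ) × ℝ → ℝ} (hφ : ContDiff ℝ ∞ φ) {p w : ℝ × ℝ} {r c : ℝ}
    (h : HasDerivAt (fun s : ℝ => φ (p + s • w, r)) c 0) : covDeriv φ p w r = c :=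
  (hasDerivAt_line hφ p w r).unique h

theorem isVariation (p w : ℝ × ℝ) :
    IsVariation (ang p) (spd p) (ez p) (covDeriv (fun a => ang a.1 a.2) p w)
      (covDeriv (fun a => spd a.1 a.2) p w) (covDeriv (fun a => ex a.1 a.2) p w)
      (covDeriv (fun a => ey a.1 a.2) p w) (covDeriv (fun a => ez a.1 a.2) p w) := by
  have hθ := fun r => hasDerivAt_line contDiff_ang p w r
  have hd := fun r => hasDerivAt_line contDiff_spd p w r
  have hz := fun r => hasDerivAt_line contDiff_ez p w r
  have hp : p + (0 : ℝ) • w = p := by simp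
  refine ⟨fun t => ?_, fun t => ?_, fun t => ?_, fun t => ?_, fun t => ?_, ?_, ?_, ?_⟩
  · exact hasDerivAt_variation contDiff_ang (F := fun a => spd a.1 a.2)
      (fun p r => (isGeod p).deriv_angle r) p w t (hd t)
  · refine hasDerivAt_variation contDiff_spd (F := fun a => -(sin (ang a.1 a.2) * cos (ang a.1 a.2)))
      (fun p r => (isGeod p).deriv_speed r) p w t ?_
    refine ((hθ t).sin.mul (hθ t).cos).neg.congr_deriv ?_
    simp only [hp, covDeriv]
    ring
  · refine hasDerivAt_variation contDiff_ex (F := fun a => cos (ang a.1 a.2) * cosh (ez a.1 a.2))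
      (fun p r => (isGeod p).deriv_x r) p w t ?_
    refine ((hθ t).cos.mul (hz t).cosh).congr_deriv ?_
    simp only [hp, covDeriv]
  · refine hasDerivAt_variation contDiff_ey (F := fun a => cos (ang a.1 a.2) * sinh (ez a.1 a.2))
      (fun p r => (isGeod p).deriv_y r) p w t ?_
    refine ((hθ t).cos.mul (hz t).sinh).congr_deriv ?_
    simp only [hp, covDeriv]
  · refine hasDerivAt_variation contDiff_ez (F := fun a => sin (ang a.1 a.2))
      (fun p r => (isGeod p).deriv_z r) p w t ?_
    refine (hθ t).sin.congr_deriv ?_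
    simp only [hp, covDeriv]
  · refine covDeriv_eq_of_const contDiff_ex ?_
    simp only [(isGeod _).x_zero]
    exact hasDerivAt_const _ _
  · refine covDeriv_eq_of_const contDiff_ey ?_
    simp only [(isGeod _).y_zero]
    exact hasDerivAt_const _ _
  · refine covDeriv_eq_of_const contDiff_ez ?_
    simp only [(isGeod _).z_zero]
    exact hasDerivAt_const _ _

theorem covDeriv_ang_zero (p w : ℝ × ℝ) : covDeriv (fun a => ang a.1 a.2) p w 0 = w.1 / 2 := by
  refine covDeriv_eq_of_const contDiff_ang ?_
  simp only [ang_zero, Prod.fst_add, Prod.smul_fst, smul_eq_mul]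
  simpa using (((hasDerivAt_id (0 : ℝ)).mul_const w.1).const_add p.1).div_const 2

theorem covDeriv_spd_zero (p w : ℝ × ℝ) : covDeriv (fun a => spd a.1 a.2) p w 0 = w.2 / 2 := by
  refine covDeriv_eq_of_const contDiff_spd ?_
  simp only [spd_zero, Prod.snd_add, Prod.smul_snd, smul_eq_mul]
  simpa using (((hasDerivAt_id (0 : ℝ)).mul_const w.2).const_add p.2).div_const 2

/-- The exponential mapping is an immersion on `D₁`. -/
theorem fderiv_liftedExp_injective {a : (ℝ × ℝ) × ℝ} (ha : proj a ∈ D₁) :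
    Function.Injective (fderiv ℝ liftedExp a) := by
  refine (injective_iff_map_eq_zero _).2 fun v hv => ?_
  obtain ⟨p, t⟩ := a
  obtain ⟨w, τ⟩ := v
  obtain ⟨ht, hmid, hcut⟩ := coe_mem_D₁_iff.1 ha
  have hdec : ∀ {φ : (ℝ × ℝ) × ℝ → ℝ} {φ' : ℝ}, ContDiff ℝ ∞ φ →
      HasDerivAt (fun r => φ (p, r)) φ' t →
      fderiv ℝ φ (p, t) (w, τ) = covDeriv φ p w t + φ' * τ := fun {φ φ'} hφ h => by
    have h1 : HasDerivAt (fun r : ℝ => (p, r)) ((0 : ℝ × ℝ), (1 : ℝ)) t :=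
      (hasDerivAt_const t p).prodMk (hasDerivAt_id t)
    have h2 := h.unique
      ((hφ.differentiable (by simp) (p, t)).hasFDerivAt.comp_hasDerivAt t h1)
    have h3 : ((w, τ) : (ℝ × ℝ) × ℝ) = (w, 0) + τ • ((0 : ℝ × ℝ), (1 : ℝ)) := by simp
    rw [h3, map_add, map_smul, ← h2, covDeriv, smul_eq_mul, mul_comm]
  have hcomp : ∀ (ℓ : M →L[ℝ] ℝ) , fderiv ℝ (fun b => ℓ (liftedExp b)) (p, t) (w, τ) = 0 :=
    fun ℓ => by
    have h1 := ℓ.hasFDerivAt.comp (p, t)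
      (contDiff_liftedExp.differentiable (by simp) (p, t)).hasFDerivAt
    change fderiv ℝ (ℓ ∘ liftedExp) (p, t) (w, τ) = 0
    rw [h1.fderiv, ContinuousLinearMap.comp_apply, hv, map_zero]
  have hg := isGeod p
  have hvar := isVariation p w
  have ex0 := hcomp (.fst ℝ ℝ (ℝ × ℝ))
  have ey0 := hcomp ((ContinuousLinearMap.fst ℝ ℝ ℝ).comp (.snd ℝ ℝ (ℝ × ℝ)))
  have ez0 := hcomp ((ContinuousLinearMap.snd ℝ ℝ ℝ).comp (.snd ℝ ℝ (ℝ × ℝ)))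
  replace ex0 := (hdec contDiff_ex (hg.deriv_x t)).symm.trans ex0
  replace ey0 := (hdec contDiff_ey (hg.deriv_y t)).symm.trans ey0
  replace ez0 := (hdec contDiff_ez (hg.deriv_z t)).symm.trans ez0
  -- The covector annihilates the variations by the Gauss lemma and takes the value `cos² θ + sin² θ
  -- = 1` on the velocity.
  have hτ : τ = 0 := by
    have h1 := hvar.gauss hg t
    have h2 := hg.cos_eq t
    have h3 := sin_sq_add_cos_sq (ang p t)
    linear_combination cos (ang p 0) * ex0 - spd p 0 * ey0 + sin (ang p t) * ez0 - h1
      + τ * cos (ang p t) * h2 - τ * h3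
  rw [hτ, mul_zero, add_zero] at ex0 ey0 ez0
  have hκ0 := kap_pos_of_sin_ne_zero hmid.ne'
  have key : covDeriv (fun a => ang a.1 a.2) p w 0 = 0 ∧
      covDeriv (fun a => spd a.1 a.2) p w 0 = 0 := by
    by_cases h1 : kap p = 1
    · have hk : sin (ang p 0) ^ 2 + spd p 0 ^ 2 = 1 := by rw [← kap_eq, h1]
      by_cases hd : spd p 0 = 0
      · refine hvar.eq_zero_of_equilibrium hg ?_ hd ht ex0 ey0
        have h2 := sin_sq_add_cos_sq (ang p 0)
        rw [hd] at hk
        nlinarith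
      · exact hvar.eq_zero_of_separatrix hg hk hd ht ex0 ey0 ez0
    · have hk : √(kap p) ^ 2 = sin (ang p 0) ^ 2 + spd p 0 ^ 2 := by
        rw [sq_sqrt hκ0.le, kap_eq p 0]
      have hk1 : √(kap p) ^ 2 ≠ 1 := by rwa [sq_sqrt hκ0.le]
      exact hvar.eq_zero_of_jac_ne_zero hg hk (sqrt_pos.2 hκ0).ne' hk1
        (hg.jac_pos hk (sqrt_pos.2 hκ0) hk1 (isOscillation_ang hκ0 h1) ht (hcut h1) hmid).ne'
        ex0 ey0 ez0
  rw [covDeriv_ang_zero, covDeriv_spd_zero] at key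
  rw [hτ]
  refine Prod.ext (Prod.ext ?_ ?_) rfl
  · change w.1 = 0
    linarith [key.1]
  · change w.2 = 0
    linarith [key.2]

/-! ### The exponential mapping is a bijection -/

theorem exists_hasStrictFDerivAt_equiv {a : (ℝ × ℝ) × ℝ}
    (ha : Function.Injective (fderiv ℝ liftedExp a)) :
    ∃ e : ((ℝ × ℝ) × ℝ) ≃L[ℝ] M,
      HasStrictFDerivAt liftedExp (e : ((ℝ × ℝ) × ℝ) →L[ℝ] M) a := by
  have hd : Module.finrank ℝ ((ℝ × ℝ) × ℝ) = Module.finrank ℝ M := by simp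
  set e := ((fderiv ℝ liftedExp a).toLinearMap.linearEquivOfInjective ha hd).toContinuousLinearEquiv
    with he
  have h : (e : ((ℝ × ℝ) × ℝ) →L[ℝ] M) = fderiv ℝ liftedExp a := ContinuousLinearMap.ext fun _ => rfl
  exact ⟨e, h ▸ contDiff_liftedExp.contDiffAt.hasStrictFDerivAt (by simp)⟩

theorem continuous_Exp : Continuous Exp :=
  isOpenQuotientMap_proj.isQuotientMap.continuous_iff.2 contDiff_liftedExp.continuous

theorem map_nhds_Exp {a : (ℝ × ℝ) × ℝ} (ha : Function.Injective (fderiv ℝ liftedExp a)) :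
    map Exp (𝓝 (proj a)) = 𝓝 (Exp (proj a)) := by
  obtain ⟨e, he⟩ := exists_hasStrictFDerivAt_equiv ha
  rw [← isOpenQuotientMap_proj.map_nhds_eq, map_map]
  exact he.map_nhds_eq_of_equiv

theorem exists_injOn_Exp {a : (ℝ × ℝ) × ℝ} (ha : Function.Injective (fderiv ℝ liftedExp a)) :
    ∃ U ∈ 𝓝 (proj a), InjOn Exp U := by
  obtain ⟨e, he⟩ := exists_hasStrictFDerivAt_equiv ha
  set Φ := he.toOpenPartialHomeomorph with hΦ
  refine ⟨proj '' Φ.source, isOpenQuotientMap_proj.isOpenMap.image_mem_nhds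
    (Φ.open_source.mem_nhds he.mem_toOpenPartialHomeomorph_source), ?_⟩
  rintro _ ⟨v, hv, rfl⟩ _ ⟨w, hw, rfl⟩ h
  exact congrArg proj (Φ.injOn hv hw h)

theorem image_mem_nhds_Exp {ν : PhaseCylinder × ℝ} (hν : ν ∈ D₁) {U : Set (PhaseCylinder × ℝ)}
    (hU : U ∈ 𝓝 ν) : Exp '' U ∈ 𝓝 (Exp ν) := by
  obtain ⟨a, rfl⟩ := isOpenQuotientMap_proj.surjective ν
  rw [← map_nhds_Exp (fderiv_liftedExp_injective hν)]
  exact image_mem_map hU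

theorem isPreconnected_M₁ : IsPreconnected (M₁ : Set M) :=
  (convex_halfSpace_gt (IsLinearMap.mk (by simp) (by simp) :
    IsLinearMap ℝ fun q : M => q.2.2) 0).isPreconnected

/-- The preimage of `(0, 0, 1)`. -/
theorem eq_of_Exp_eq {ν : PhaseCylinder × ℝ} (hν : ν ∈ D₁) (h : Exp ν = (0, 0, 1)) :
    ν = proj ((π, 0), 1) := by
  obtain ⟨⟨p, t⟩, rfl⟩ := isOpenQuotientMap_proj.surjective ν
  obtain ⟨ht, -, hdisp⟩ := coe_mem_D₁_iff_disp.1 hν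
  have hg := isGeod p
  have hx : ex p t = 0 := congrArg Prod.fst h
  have hy : ey p t = 0 := congrArg (fun q : M => q.2.1) h
  have hz : ez p t = 1 := congrArg (fun q : M => q.2.2) h
  have hE := hg.momentum_eq t
  rw [hx, hy, mul_zero, mul_zero, sub_zero] at hE
  -- With `x = y = 0` the integral of `cos² θ` is zero, so the trajectory can only be an
  -- equilibrium.
  have hcos : ∀ r ∈ Icc 0 t, cos (ang p r) = 0 := by
    intro r hr
    by_contra hne
    refine (intervalIntegral.integral_pos ht ?_ (fun s _ => sq_nonneg (cos (ang p s)))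
      ⟨r, hr, by positivity⟩).ne hE
    have := hg.continuous_angle
    exact Continuous.continuousOn (by fun_prop)
  have hc0 := hcos 0 ⟨le_rfl, ht.le⟩
  have hd0 : spd p 0 = 0 := by
    have h1 := hg.cos_eq t
    rw [hcos t ⟨ht.le, le_rfl⟩, hc0, hz] at h1
    have : sinh 1 ≠ 0 := (sinh_pos_iff.2 one_pos).ne'
    have h2 : spd p 0 * sinh 1 = 0 := by linarith
    exact (mul_eq_zero.1 h2).resolve_right this
  have hzr : ∀ r, ez p r = sin (ang p 0) * r := fun r => by
    refine eq_of_hasDerivAt_eq (f := ez p) hg.deriv_z (fun r => ?_) (a := 0) ?_ r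
    · rw [(hg.toIsPend.angle_const hc0 hd0 r).1]
      simpa using (hasDerivAt_id r).const_mul (sin (ang p 0))
    · rw [hg.z_zero, mul_zero]
  have hs : sin (ang p 0) = 1 := by
    have h1 := sin_sq_add_cos_sq (ang p 0)
    rw [hc0] at h1
    have h2 := hzr t
    rw [hz] at h2
    have h3 : 0 < sin (ang p 0) := by
      by_contra hcon
      nlinarith
    nlinarith
  have ht1 : t = 1 := by
    have := hzr t
    rw [hz, hs] at this
    linarith
  rw [ang_zero] at hs
  rw [spd_zero] at hd0
  obtain ⟨n, hn⟩ := sin_eq_one_iff.1 hs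
  have hγ : (p.1 : AddCircle (4 * π)) = (π : AddCircle (4 * π)) := by
    rw [show p.1 = π + n • (4 * π) by rw [zsmul_eq_mul]; linarith, AddCircle.coe_add,
      AddCircle.coe_zsmul, AddCircle.coe_period, smul_zero, add_zero]
  refine Prod.ext (Prod.ext hγ ?_) ht1
  change p.2 = 0
  linarith

theorem proj_mem_D₁ : proj ((π, 0), 1) ∈ D₁ := by
  have hk : kap (π, 0) = 1 := by simp [kap]
  have hg := isGeod (π, 0)
  refine coe_mem_D₁_iff.2 ⟨one_pos, ?_, fun h => absurd hk h⟩
  rw [(hg.toIsPend.angle_const (by simp [ang_zero]) (by simp [spd_zero]) _).1, ang_zero]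
  simp

theorem Exp_proj_pi : Exp (proj ((π, 0), 1)) = (0, 0, 1) := by
  have hg := isGeod (π, 0)
  have hc : ∀ r, ang (π, 0) r = π / 2 := fun r => by
    rw [(hg.toIsPend.angle_const (by simp [ang_zero]) (by simp [spd_zero]) r).1, ang_zero]
  refine congrFun (extremal_eq (p := (π, 0)) (q := fun t => (0, 0, t)) ⟨rfl, fun t => ?_⟩) 1
  have h1 : (pendulumFlow (π, 0) t).1 / 2 = π / 2 := hc t
  rw [h1, cos_pi_div_two, sin_pi_div_two, zero_mul, zero_mul]
  exact (hasDerivAt_const t 0).prodMk ((hasDerivAt_const t 0).prodMk (hasDerivAt_id t))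

/-- The image is nonempty, open because the differential is invertible, and closed in the connected
half-space by properness. -/
theorem surjOn_Exp : SurjOn Exp D₁ M₁ := by
  refine isPreconnected_M₁.subset_of_closure_inter_subset ?_
    ⟨(0, 0, 1), one_pos (α := ℝ), _, proj_mem_D₁, Exp_proj_pi⟩ ?_
  · rw [isOpen_iff_mem_nhds]
    rintro _ ⟨ν, hν, rfl⟩
    exact image_mem_nhds_Exp hν (isOpen_D₁.mem_nhds hν)
  · rintro q ⟨hq, hqM⟩
    obtain ⟨u, hu, hlim⟩ := mem_closure_iff_seq_limit.1 hq
    choose ν hν hνu using hu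
    obtain rfl : (fun n => Exp (ν n)) = u := funext hνu
    obtain ⟨μ, hμ, φ, hφ, hφlim⟩ := exists_tendsto_subseq hν hqM hlim
    exact ⟨μ, hμ, tendsto_nhds_unique ((continuous_Exp.tendsto μ).comp hφlim)
      (hlim.comp hφ.tendsto_atTop)⟩

/-! ### Injectivity by connectedness -/

/-- The points of the image with at least two preimages. -/
def doublePoints : Set M := {q | ∃ ν ∈ D₁, ∃ μ ∈ D₁, ν ≠ μ ∧ Exp ν = q ∧ Exp μ = q}

theorem isOpen_doublePoints : IsOpen doublePoints := by
  rw [isOpen_iff_mem_nhds]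
  rintro q ⟨ν, hν, μ, hμ, hne, hq, hq'⟩
  obtain ⟨U, V, hU, hV, hνU, hμV, hdisj⟩ := t2_separation hne
  have h1 := image_mem_nhds_Exp hν ((hU.inter isOpen_D₁).mem_nhds ⟨hνU, hν⟩)
  have h2 := image_mem_nhds_Exp hμ ((hV.inter isOpen_D₁).mem_nhds ⟨hμV, hμ⟩)
  rw [hq] at h1
  rw [hq'] at h2
  filter_upwards [h1, h2]
  rintro r ⟨ν', hν', h⟩ ⟨μ', hμ', h'⟩
  exact ⟨ν', hν'.2, μ', hμ'.2, hdisj.ne_of_mem hν'.1 hμ'.1, h, h'⟩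

/-- Properness gives limits of both preimages. Were the limits equal, local injectivity there would
identify the preimages far along the sequence. -/
theorem closure_doublePoints : closure doublePoints ∩ M₁ ⊆ doublePoints := by
  rintro q ⟨hq, hqM⟩
  obtain ⟨u, hu, hlim⟩ := mem_closure_iff_seq_limit.1 hq
  choose ν hν μ hμ hne hνu hμu using hu
  obtain rfl : (fun n => Exp (ν n)) = u := funext hνu
  obtain ⟨ν', hν', φ, hφ, hφlim⟩ := exists_tendsto_subseq hν hqM hlim
  have hlim2 : Tendsto (fun n => Exp (μ (φ n))) atTop (𝓝 q) := by
    simp only [hμu]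
    exact hlim.comp hφ.tendsto_atTop
  obtain ⟨μ', hμ', ψ, hψ, hψlim⟩ := exists_tendsto_subseq (fun n => hμ (φ n)) hqM hlim2
  have hφψ := hφlim.comp hψ.tendsto_atTop
  refine ⟨ν', hν', μ', hμ', ?_,
    tendsto_nhds_unique ((continuous_Exp.tendsto ν').comp hφlim) (hlim.comp hφ.tendsto_atTop),
    tendsto_nhds_unique ((continuous_Exp.tendsto μ').comp hψlim) (hlim2.comp hψ.tendsto_atTop)⟩
  rintro rfl
  obtain ⟨a, rfl⟩ := isOpenQuotientMap_proj.surjective ν'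
  obtain ⟨U, hU, hinj⟩ := exists_injOn_Exp (fderiv_liftedExp_injective hν')
  obtain ⟨n, h1, h2⟩ := ((hφψ.eventually_mem hU).and (hψlim.eventually_mem hU)).exists
  exact hne _ (hinj h1 h2 ((hνu _).trans (hμu _).symm))

/-- A nonempty set of double points would be all of `M₁`, whereas `(0, 0, 1)` has a single preimage.
-/
theorem injOn_Exp : InjOn Exp D₁ := by
  intro ν hν μ hμ h
  by_contra hne
  obtain ⟨ν', hν', μ', hμ', hne', h1, h2⟩ :=
    isPreconnected_M₁.subset_of_closure_inter_subset isOpen_doublePoints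
      ⟨Exp ν, D₁_subset_preimage hν, ν, hν, μ, hμ, hne, rfl, h.symm⟩ closure_doublePoints
      (show ((0, 0, 1) : M) ∈ M₁ from one_pos (α := ℝ))
  exact hne' ((eq_of_Exp_eq hν' h1).trans (eq_of_Exp_eq hμ' h2).symm)

theorem bijOn_Exp : BijOn Exp D₁ M₁ :=
  ⟨fun _ => D₁_subset_preimage, injOn_Exp, surjOn_Exp⟩

/-! ### Smoothness in the sense of manifolds -/

theorem coe_chartAt (γ x : AddCircle (4 * π)) :
    ((chartAt ℝ γ x : ℝ) : AddCircle (4 * π)) = x :=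
  (AddCircle.equivIco (4 * π) _).symm_apply_apply x

theorem contMDiff_Exp : ContMDiff modelN 𝓘(ℝ, M) ∞ Exp := by
  intro ν
  -- The chart, as a total function, is a right inverse of the projection on the whole circle, so it
  -- gives a global factorization of `Exp` through `liftedExp`; its smoothness is needed only at the
  -- point.
  obtain ⟨κ, hκ, hκν⟩ : ∃ κ : AddCircle (4 * π) → ℝ,
      (∀ x, (κ x : AddCircle (4 * π)) = x) ∧ ContMDiffAt 𝓘(ℝ, ℝ) 𝓘(ℝ, ℝ) ∞ κ ν.1.1 :=
    ⟨chartAt ℝ ν.1.1, coe_chartAt ν.1.1, contMDiffOn_chart.contMDiffAt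
      ((chartAt ℝ ν.1.1).open_source.mem_nhds (mem_chart_source ℝ _))⟩
  have h1 : ContMDiffAt modelN 𝓘(ℝ, ℝ) ∞ (fun μ : PhaseCylinder × ℝ => κ μ.1.1) ν :=
    ContMDiffAt.comp (I' := 𝓘(ℝ, ℝ)) ν hκν (contMDiffAt_fst.comp ν contMDiffAt_fst)
  have h2 : ContMDiffAt modelN 𝓘(ℝ, ℝ) ∞ (fun μ : PhaseCylinder × ℝ => μ.1.2) ν :=
    contMDiffAt_snd.comp ν contMDiffAt_fst
  have hL : ContMDiffAt modelN 𝓘(ℝ, (ℝ × ℝ) × ℝ) ∞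
      (fun μ : PhaseCylinder × ℝ => ((κ μ.1.1, μ.1.2), μ.2)) ν :=
    (h1.prodMk_space h2).prodMk_space contMDiffAt_snd
  have h := ContMDiffAt.comp (I' := 𝓘(ℝ, (ℝ × ℝ) × ℝ)) ν
    contDiff_liftedExp.contMDiff.contMDiffAt hL
  refine h.congr_of_eventuallyEq (Eventually.of_forall fun μ => ?_)
  have h3 : μ = proj ((κ μ.1.1, μ.1.2), μ.2) := Prod.ext (Prod.ext (hκ _).symm rfl) rfl
  exact congrArg Exp h3

theorem contMDiff_coe : ContMDiff 𝓘(ℝ, ℝ) 𝓘(ℝ, ℝ) ∞ ((↑) : ℝ → AddCircle (4 * π)) := by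
  intro x
  have h := contMDiffOn_symm_of_mem_maximalAtlas (I := 𝓘(ℝ, ℝ)) (n := ∞)
    (IsManifold.subset_maximalAtlas (I := 𝓘(ℝ, ℝ)) (n := ∞)
      (mem_range_self (x - 2 * π) : (AddCircle.openPartialHomeomorphCoe (4 * π) (x - 2 * π)).symm
        ∈ atlas ℝ (AddCircle (4 * π))))
  refine h.contMDiffAt (isOpen_Ioo.mem_nhds ⟨?_, ?_⟩) <;> linarith [pi_pos]

theorem contMDiff_proj : ContMDiff 𝓘(ℝ, (ℝ × ℝ) × ℝ) modelN ∞ proj :=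
  ((contMDiff_coe.comp (contDiff_fst.fst : ContDiff ℝ ∞ fun a : (ℝ × ℝ) × ℝ => a.1.1).contMDiff).prodMk
    (contDiff_fst.snd : ContDiff ℝ ∞ fun a : (ℝ × ℝ) × ℝ => a.1.2).contMDiff).prodMk
    contDiff_snd.contMDiff

theorem restrictsToDiffeomorphism_Exp {D : TopologicalSpace.Opens (PhaseCylinder × ℝ)}
    {V : TopologicalSpace.Opens M} (hbij : BijOn Exp D V)
    (hinj : ∀ a, proj a ∈ D → Function.Injective (fderiv ℝ liftedExp a)) :
    RestrictsToDiffeomorphism Exp D V := by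
  set Φ : D ≃ V := hbij.equiv with hΦ
  have hval : ∀ ν : D, (Φ ν : M) = Exp ν := fun ν => rfl
  refine ⟨⟨Φ, ?_, ?_⟩, hval⟩
  · rw [← ContMDiff.subtypeVal_comp_iff]
    exact contMDiff_Exp.comp contMDiff_subtype_val
  · intro q
    rw [← ContMDiffAt.subtypeVal_comp_iff]
    obtain ⟨a, ha⟩ := isOpenQuotientMap_proj.surjective (Φ.symm q : PhaseCylinder × ℝ)
    have haD : proj a ∈ D := ha ▸ (Φ.symm q).2
    have hq : liftedExp a = q := by
      rw [← Exp_proj, ha, ← hval, Equiv.apply_symm_apply]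
    obtain ⟨e, he⟩ := exists_hasStrictFDerivAt_equiv (hinj a haD)
    have hcd : ContDiffAt ℝ ∞ liftedExp a := contDiff_liftedExp.contDiffAt
    -- The global inverse agrees near `q` with the projected local inverse, because the latter stays
    -- in `D`, where `Exp` is injective.
    set g := hcd.localInverse he.hasFDerivAt (by simp) with hg
    have hgs : ContDiffAt ℝ ∞ g (q : M) := hq ▸ hcd.to_localInverse he.hasFDerivAt (by simp)
    have hga : g q = a := hq ▸ hcd.localInverse_apply_image he.hasFDerivAt (by simp)
    have hright : ∀ᶠ r in 𝓝 (q : M), liftedExp (g r) = r := by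
      rw [← hq]
      exact (hcd.hasStrictFDerivAt' he.hasFDerivAt (by simp)).eventually_right_inverse
    have hsm : ContMDiffAt 𝓘(ℝ, M) modelN ∞ (fun r : V => proj (g r)) q :=
      contMDiff_proj.contMDiffAt.comp q
        (hgs.contMDiffAt.comp q contMDiff_subtype_val.contMDiffAt)
    refine hsm.congr_of_eventuallyEq ?_
    have hD : ∀ᶠ r in 𝓝 (q : M), proj (g r) ∈ D :=
      (continuous_proj.continuousAt.comp hgs.continuousAt).eventually_mem
        (D.isOpen.mem_nhds (by simpa [hga] using haD))
    filter_upwards [continuous_subtype_val.continuousAt.eventually hright,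
      continuous_subtype_val.continuousAt.eventually hD] with r hr1 hr2
    refine hbij.injOn (Φ.symm r).2 hr2 ?_
    rw [Exp_proj, hr1, ← hval, Equiv.apply_symm_apply]

/-! ### Reflection -/

theorem pendulumFlow_neg (p : ℝ × ℝ) (t : ℝ) : pendulumFlow (-p) t = -pendulumFlow p t := by
  refine congrFun (pendulumFlow_eq (u := fun t => -pendulumFlow p t) ?_ fun t => ?_) t
  · rw [pendulumFlow_zero]
  · refine (pendulumFlow_solution p t).neg.congr_deriv (Prod.ext rfl ?_)
    simp

/-- The reflection of the state space in the `x`-axis. -/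
def reflection : M ≃L[ℝ] M :=
  (ContinuousLinearEquiv.refl ℝ ℝ).prodCongr (ContinuousLinearEquiv.neg ℝ)

theorem reflection_reflection (q : M) : reflection (reflection q) = q := by
  simp [reflection]

/-- Changing the signs of `γ` and `c` preserves `cos θ` and reverses `sin θ`, hence reverses `y` and
`z`. This symmetry exchanges the two domains and the two half-spaces. -/
theorem extremal_neg (p : ℝ × ℝ) (t : ℝ) : extremal (-p) t = reflection (extremal p t) := by
  refine congrFun (extremal_eq (q := fun t => reflection (extremal p t)) ⟨?_, fun t => ?_⟩) t
  · simp [reflection, extremal_zero]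
  · refine (reflection.hasFDerivAt.comp_hasDerivAt t ((extremal_spec p).2 t)).congr_deriv ?_
    simp [reflection, pendulumFlow_neg, neg_div]

/-- The reflection of the preimage of the exponential mapping. -/
def conj (ν : PhaseCylinder × ℝ) : PhaseCylinder × ℝ := (-ν.1, ν.2)

theorem conj_conj (ν : PhaseCylinder × ℝ) : conj (conj ν) = ν := by simp [conj]

theorem Exp_conj (ν : PhaseCylinder × ℝ) : Exp (conj ν) = reflection (Exp ν) := by
  obtain ⟨a, rfl⟩ := isOpenQuotientMap_proj.surjective ν
  exact extremal_neg a.1 a.2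

theorem energy_neg (l : PhaseCylinder) : energy (-l) = energy l := by
  obtain ⟨⟨γ⟩, c⟩ := l
  change (-c) ^ 2 / 2 - cos (-γ) = c ^ 2 / 2 - cos γ
  rw [neg_sq, cos_neg]

theorem cutBound_neg (l : PhaseCylinder) : cutBound (-l) = cutBound l := by
  have h1 : -l ∈ C₁ ↔ l ∈ C₁ := by simp only [C₁, mem_ofPred_eq, energy_neg]
  have h2 : -l ∈ C₂ ↔ l ∈ C₂ := by simp only [C₂, mem_ofPred_eq, energy_neg]
  have h4 : -l ∈ C₄ ↔ l ∈ C₄ := by simp [C₄, energy_neg]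
  have hk : modulus (-l) = modulus l := by simp only [modulus, energy_neg]
  rw [cutBound, cutBound, hk]
  classical exact if_congr h1 rfl (if_congr h2 rfl (if_congr h4 rfl rfl))

theorem sinHalf_phaseFlow_neg (t : ℝ) (l : PhaseCylinder) :
    sinHalf (phaseFlow t (-l)).1 = -sinHalf (phaseFlow t l).1 := by
  obtain ⟨⟨γ⟩, c⟩ := l
  change sin ((pendulumFlow (-(γ, c)) t).1 / 2) = -sin ((pendulumFlow (γ, c) t).1 / 2)
  rw [pendulumFlow_neg, Prod.fst_neg, neg_div, sin_neg]

theorem conj_mem_D₁_iff {ν : PhaseCylinder × ℝ} : conj ν ∈ D₁ ↔ ν ∈ D₂ := by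
  have hC : -ν.1 ∈ C₁ ∪ C₂ ∪ C₃ ∪ C₅ ↔ ν.1 ∈ C₁ ∪ C₂ ∪ C₃ ∪ C₅ := by
    simp [C₁, C₂, C₃, C₅, energy_neg]
  simp only [D₁, D₂, conj, mem_ofPred_eq, hC, cutBound_neg, sinHalf_phaseFlow_neg, neg_pos]

theorem isOpen_D₂ : IsOpen D₂ := by
  have h : D₂ = conj ⁻¹' D₁ := Set.ext fun ν => conj_mem_D₁_iff.symm
  rw [h]
  exact isOpen_D₁.preimage (by unfold conj; fun_prop)

theorem reflection_mem_M₁_iff {q : M} : reflection q ∈ M₁ ↔ q ∈ M₂ := by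
  change 0 < -q.2.2 ↔ q.2.2 < 0
  exact neg_pos

theorem bijOn_Exp_D₂ : BijOn Exp D₂ M₂ := by
  refine ⟨fun ν hν => ?_, fun ν hν μ hμ h => ?_, fun q hq => ?_⟩
  · have := D₁_subset_preimage (conj_mem_D₁_iff.2 hν)
    rwa [Exp_conj, reflection_mem_M₁_iff] at this
  · have := injOn_Exp (conj_mem_D₁_iff.2 hν) (conj_mem_D₁_iff.2 hμ) (by rw [Exp_conj, Exp_conj, h])
    rw [← conj_conj ν, this, conj_conj]
  · obtain ⟨ν, hν, h⟩ := surjOn_Exp (reflection_mem_M₁_iff.2 hq)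
    refine ⟨conj ν, conj_mem_D₁_iff.1 (by rwa [conj_conj]), ?_⟩
    rw [Exp_conj, h, reflection_reflection]

theorem fderiv_liftedExp_injective_of_mem_D₂ {a : (ℝ × ℝ) × ℝ} (ha : proj a ∈ D₂) :
    Function.Injective (fderiv ℝ liftedExp a) := by
  set σ : ((ℝ × ℝ) × ℝ) ≃L[ℝ] (ℝ × ℝ) × ℝ :=
    (ContinuousLinearEquiv.neg ℝ).prodCongr (ContinuousLinearEquiv.refl ℝ ℝ) with hσ
  have hσa : ∀ b, liftedExp b = reflection (liftedExp (σ b)) := fun b => by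
    have h : liftedExp (σ b) = reflection (liftedExp b) := extremal_neg b.1 b.2
    rw [h, reflection_reflection]
  have hd : HasFDerivAt liftedExp (fderiv ℝ liftedExp (σ a)) (σ a) :=
    (contDiff_liftedExp.differentiable (by simp)).differentiableAt.hasFDerivAt
  have h := (reflection.hasFDerivAt.comp a (hd.comp a σ.hasFDerivAt)).congr_of_eventuallyEq
    (Eventually.of_forall hσa)
  rw [h.fderiv]
  have h1 : Function.Injective (fderiv ℝ liftedExp (σ a)) :=
    fderiv_liftedExp_injective (conj_mem_D₁_iff.2 ha : proj (-a.1, a.2) ∈ D₁)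
  exact reflection.injective.comp (h1.comp σ.injective)

end

end SH2

theorem mainTheorem3 :
    ∃ (h₁ : IsOpen SH2.D₁) (h₂ : IsOpen SH2.D₂),
      SH2.RestrictsToDiffeomorphism SH2.Exp ⟨SH2.D₁, h₁⟩ SH2.M₁ ∧
      SH2.RestrictsToDiffeomorphism SH2.Exp ⟨SH2.D₂, h₂⟩ SH2.M₂ :=
  ⟨SH2.isOpen_D₁, SH2.isOpen_D₂,
    SH2.restrictsToDiffeomorphism_Exp SH2.bijOn_Exp fun _ => SH2.fderiv_liftedExp_injective,
    SH2.restrictsToDiffeomorphism_Exp SH2.bijOn_Exp_D₂ fun _ =>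
      SH2.fderiv_liftedExp_injective_of_mem_D₂⟩
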